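/- **Setting.** All manifolds are smooth, finite dimensional, Hausdorff and $\sigma$-compact. Let $\pi:E\to M$ be a smooth surjective submersion (for instance a fibre bundle), $\dim M=m\ge 2$, and let $\eta$ be a (smooth, nowhere vanishing) volume form on $M$. Let $\pi^1:J^1\pi\to E$ be the first jet bundle, $\bar\pi^1=\pi\circ\pi^1:J^1\pi\to M$, $\omega=\bar\pi^{1*}\eta$, and let $J^1\pi^*=\Lambda^m_2T^*E/\pi^*\Lambda^mT^*M$ be the multimomentum bundle, where $\Lambda^m_2T^*E$ is the bundle of $m$-forms on $E$ vanishing on two $\pi$-vertical vectors, with projection $\bar\tau^1:J^1\pi^*\to M$; put $\omega^*=\bar\tau^{1*}\eta$. Let $L:J^1\pi\to\mathbb R$ be smooth, $\mathcal L=L\,\omega$, let $\Theta_{\mathcal L}=i(\mathcal V)\mathcal L+\mathcal L$ be its Poincaré–Cartan $m$-form ($\mathcal V$ being the vertical endomorphism of $J^1\pi$; locally, with $\omega=d^mx$, $\Theta_{\mathcal L}=\frac{\partial L}{\partial v^A_\alpha}dy^A\wedge d^{m-1}x_\alpha-\bigl(\frac{\partial L}{\partial v^A_\alpha}v^A_\alpha-L\bigr)d^mx$),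 and $\Omega_{\mathcal L}=-d\Theta_{\mathcal L}$. Let $\widetilde{\mathcal{FL}}:J^1\pi\to\Lambda^m_2T^*E$, $\widetilde{\mathcal{FL}}(\bar y)(T\pi^1\bar Z_1,\dots,T\pi^1\bar Z_m)=(\Theta_{\mathcal L})_{\bar y}(\bar Z_1,\dots,\bar Z_m)$, be the extended Legendre map and $\mathcal{FL}:J^1\pi\to J^1\pi^*$ its composition with the quotient map. An $(m+1)$-form $\Omega$ is *1-nondegenerate* if $v\mapsto i(v)\Omega$ is injective on each tangent space. The Lagrangian system $(J^1\pi,\Omega_{\mathcal L})$ is *regular* if $\Omega_{\mathcal L}$ is 1-nondegenerate. For an Ehresmann connection $\nabla$ on $\kappa:N\to M$ (smooth horizontal lifts $\nabla_q:T_{\kappa(q)}M\to T_qN$ with $T\kappa\circ\nabla_q=\mathrm{id}$) and an $(m+1)$-form $\Omega$ on $N$, put $\Omega^\nabla=\Omega-\kappa^*\eta\wedge\gamma$, where $\gamma=i(Y^\nabla_\eta)\Omega$, $Y^\nabla_\eta=\Lambda^m\nabla(Z)$ with $\eta(Z)=1$, and $(i(X)\Omega)(w)=\Omega(X,w)$ for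 an $m$-vector $X$. **Statement.** Suppose that $(J^1\pi,\Omega_{\mathcal L})$ is regular. Then: 1. $\mathcal{FL}$ is a local diffeomorphism. 2. For every Ehresmann connection $\nabla$ on $\bar\pi^1:J^1\pi\to M$, the form $\Omega_{\mathcal L}^\nabla$ is 1-nondegenerate on $J^1\pi$. 3. There is an Euler–Lagrange $m$-vector field on the whole of $J^1\pi$: a locally decomposable $m$-vector field $X$ with $i(X)\omega=1$, $i(X)\Omega_{\mathcal L}=0$ and $i(X)\mathcal V=0$ (semi-holonomy; integrability is not claimed). 4. Let $U\subseteq J^1\pi$ be open and such that $\mathcal{FL}$ restricts to a diffeomorphism of $U$ onto an open set $U^*\subseteq J^1\pi^*$ (when $\mathcal{FL}$ is a global diffeomorphism, i.e. in the hyper-regular case, one may take $U=J^1\pi$ and $U^*=J^1\pi^*$; in general such $U$ cover $J^1\pi$ by 1). Let $h=\widetilde{\mathcal{FL}}\circ(\mathcal{FL}|_U)^{-1}$ be the Hamiltonian section on $U^*$ and $\Omega_h=h^*\Omega=-d(h^*\Theta)$, where $\Theta$ is the tautological $m$-form of $\Lambda^m_2T^*E$ and $\Omega=-d\Theta$. Then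 for every Ehresmann connection $\nabla$ on $\bar\pi^1$ there is a transported connection $\nabla^*$ on $\bar\tau^1$ over $U^*$, i.e. $\nabla^*_{\mathcal{FL}(\bar y)}=T_{\bar y}\mathcal{FL}\circ\nabla_{\bar y}$ for $\bar y\in U$, and for every such $\nabla^*$ the form $\Omega_h^{\nabla^*}$ is 1-nondegenerate on $U^*$. Moreover there is a Hamilton–De Donder–Weyl $m$-vector field on the whole of $U^*$: a locally decomposable $m$-vector field $X$ with $i(X)\omega^*=1$ and $i(X)\Omega_h=0$. -/

import Mathlib

open scoped Manifold ContDiff Topology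
open Set
noncomputable section
namespace Multisymp

section Setup
variable {B F M E : Type*}
  [NormedAddCommGroup B] [NormedSpace ℝ B]
  [NormedAddCommGroup F] [NormedSpace ℝ F]
  [TopologicalSpace M] [ChartedSpace B M]
  [TopologicalSpace E] [ChartedSpace (B × F) E]

variable (B F M E) in
/-- A fibred manifold `π : E → M`, i.e. a smooth surjective submersion; `M` is modelled on `B`, the
fibres on `F`, and `E` on `B × F`. -/
structure FibredManifold where
  proj : E → M
  surjective : Function.Surjective proj
  submersion : Manifold.IsSubmersionOfComplement F 𝓘(ℝ, B × F) 𝓘(ℝ, B) ∞ proj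

/-- The tangent map `Tπ` of the projection. -/
def FibredManifold.dproj (P : FibredManifold B F M E) (y : E) :
    TangentSpace 𝓘(ℝ, B × F) y →L[ℝ] TangentSpace 𝓘(ℝ, B) (P.proj y) :=
  mfderiv 𝓘(ℝ, B × F) 𝓘(ℝ, B) P.proj y

/-- A pair of (smooth) charts of `E` and `M` in which the projection is `(x, y) ↦ x`, with a chosen
point in the domain of the first one. -/
structure AdaptedChart (P : FibredManifold B F M E) where
  tot : OpenPartialHomeomorph E (B × F)
  base : OpenPartialHomeomorph M B
  ctr : E
  ctr_mem : ctr ∈ tot.source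
  smooth_tot : ContMDiffOn 𝓘(ℝ, B × F) 𝓘(ℝ, B × F) ∞ tot tot.source
  smooth_tot_symm : ContMDiffOn 𝓘(ℝ, B × F) 𝓘(ℝ, B × F) ∞ tot.symm tot.target
  smooth_base : ContMDiffOn 𝓘(ℝ, B) 𝓘(ℝ, B) ∞ base base.source
  smooth_base_symm : ContMDiffOn 𝓘(ℝ, B) 𝓘(ℝ, B) ∞ base.symm base.target
  mapsTo : ∀ y ∈ tot.source, P.proj y ∈ base.source
  fst_eq : ∀ y ∈ tot.source, (tot y).1 = base (P.proj y)

variable {P : FibredManifold B F M E}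

theorem FibredManifold.exists_adaptedChart (P : FibredManifold B F M E) (y : E) :
    ∃ e : AdaptedChart P, e.ctr = y := by
  have h := P.submersion y
  have hd := h.domChart_mem_maximalAtlas
  have hc := h.codChart_mem_maximalAtlas
  have hT : ContMDiff 𝓘(ℝ, B × F) 𝓘(ℝ, B × F) ∞ h.equiv := h.equiv.contDiff.contMDiff
  have hT' : ContMDiff 𝓘(ℝ, B × F) 𝓘(ℝ, B × F) ∞ h.equiv.symm := h.equiv.symm.contDiff.contMDiff
  refine ⟨{ tot := h.domChart.transHomeomorph h.equiv.toHomeomorph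
            base := h.codChart
            ctr := y
            ctr_mem := h.mem_domChart_source
            smooth_tot := ?_
            smooth_tot_symm := ?_
            smooth_base := contMDiffOn_of_mem_maximalAtlas hc
            smooth_base_symm := contMDiffOn_symm_of_mem_maximalAtlas hc
            mapsTo := fun z hz => h.source_subset_preimage_source hz
            fst_eq := ?_ }, rfl⟩
  · exact hT.comp_contMDiffOn (contMDiffOn_of_mem_maximalAtlas hd)
  · have h1 := contMDiffOn_symm_of_mem_maximalAtlas hd
    exact h1.comp hT'.contMDiffOn (fun z hz => hz)
  · intro z hz
    have hz' : h.domChart z ∈ (h.domChart.extend 𝓘(ℝ, B × F)).target := by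
      simpa using h.domChart.map_source hz
    have h2 := h.writtenInCharts hz'
    have hz2 : h.domChart.symm (h.domChart z) = z := h.domChart.left_inv hz
    simp [hz2] at h2
    exact h2.symm

namespace AdaptedChart

variable (e e' : AdaptedChart P)

/-- The tangent map of the chart of `E` at `y`. -/
def dTot (y : E) : TangentSpace 𝓘(ℝ, B × F) y →L[ℝ] B × F :=
  mfderiv 𝓘(ℝ, B × F) 𝓘(ℝ, B × F) e.tot y

/-- The tangent map of the inverse of the chart of `E`, at the image of `y`. -/
def dTotInv (y : E) : B × F →L[ℝ] TangentSpace 𝓘(ℝ, B × F) y :=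
  mfderiv 𝓘(ℝ, B × F) 𝓘(ℝ, B × F) e.tot.symm (e.tot y)

/-- The tangent map of the chart of `M` at `x`. -/
def dBase (x : M) : TangentSpace 𝓘(ℝ, B) x →L[ℝ] B :=
  mfderiv 𝓘(ℝ, B) 𝓘(ℝ, B) e.base x

/-- The tangent map of the inverse of the chart of `M`, at the image of `x`. -/
def dBaseInv (x : M) : B →L[ℝ] TangentSpace 𝓘(ℝ, B) x :=
  mfderiv 𝓘(ℝ, B) 𝓘(ℝ, B) e.base.symm (e.base x)

theorem mdiff_tot : e.tot.MDifferentiable 𝓘(ℝ, B × F) 𝓘(ℝ, B × F) :=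
  ⟨e.smooth_tot.mdifferentiableOn (by simp), e.smooth_tot_symm.mdifferentiableOn (by simp)⟩

theorem mdiff_base : e.base.MDifferentiable 𝓘(ℝ, B) 𝓘(ℝ, B) :=
  ⟨e.smooth_base.mdifferentiableOn (by simp), e.smooth_base_symm.mdifferentiableOn (by simp)⟩

theorem dTotInv_dTot {y : E} (hy : y ∈ e.tot.source) (w : TangentSpace 𝓘(ℝ, B × F) y) :
    e.dTotInv y (e.dTot y w) = w :=
  congrArg (fun f => f w) (e.mdiff_tot.symm_comp_deriv hy)

theorem dTot_dTotInv {y : E} (hy : y ∈ e.tot.source) (w : B × F) :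
    e.dTot y (e.dTotInv y w) = w := by
  have h := e.mdiff_tot.comp_symm_deriv (e.tot.map_source hy)
  rw [e.tot.left_inv hy] at h
  exact congrArg (fun f => f w) h

theorem dBaseInv_dBase {x : M} (hx : x ∈ e.base.source) (w : TangentSpace 𝓘(ℝ, B) x) :
    e.dBaseInv x (e.dBase x w) = w :=
  congrArg (fun f => f w) (e.mdiff_base.symm_comp_deriv hx)

theorem dBase_dBaseInv {x : M} (hx : x ∈ e.base.source) (w : B) :
    e.dBase x (e.dBaseInv x w) = w := by
  have h := e.mdiff_base.comp_symm_deriv (e.base.map_source hx)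
  rw [e.base.left_inv hx] at h
  exact congrArg (fun f => f w) h

theorem mdiffAt_proj {y : E} :
    MDifferentiableAt 𝓘(ℝ, B × F) 𝓘(ℝ, B) P.proj y :=
  (P.submersion y).contMDiffAt.mdifferentiableAt (by simp)

theorem dBase_dproj {y : E} (hy : y ∈ e.tot.source) (w : TangentSpace 𝓘(ℝ, B × F) y) :
    e.dBase (P.proj y) (P.dproj y w) = (e.dTot y w).1 := by
  have h1 : HasMFDerivAt 𝓘(ℝ, B × F) 𝓘(ℝ, B) (fun z => e.base (P.proj z)) y
      ((e.dBase (P.proj y)).comp (P.dproj y)) :=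
    HasMFDerivAt.comp y (e.mdiff_base.mdifferentiableAt (e.mapsTo y hy)).hasMFDerivAt
      mdiffAt_proj.hasMFDerivAt
  have h2 : HasMFDerivAt 𝓘(ℝ, B × F) 𝓘(ℝ, B) (fun z => (e.tot z).1) y
      ((ContinuousLinearMap.fst ℝ B F).comp (e.dTot y)) :=
    HasMFDerivAt.comp y ((ContinuousLinearMap.fst ℝ B F).hasMFDerivAt)
      (e.mdiff_tot.mdifferentiableAt hy).hasMFDerivAt
  have h3 : (fun z => (e.tot z).1) =ᶠ[𝓝 y] (fun z => e.base (P.proj z)) := by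
    filter_upwards [e.tot.open_source.mem_nhds hy] with z hz using e.fst_eq z hz
  have h4 := hasMFDerivAt_unique h1 (h2.congr_of_eventuallyEq h3.symm)
  exact congrArg (fun f => f w) h4

theorem dproj_dTotInv {y : E} (hy : y ∈ e.tot.source) (w : B × F) :
    P.dproj y (e.dTotInv y w) = e.dBaseInv (P.proj y) w.1 := by
  rw [← e.dBaseInv_dBase (e.mapsTo y hy) (P.dproj y (e.dTotInv y w)), e.dBase_dproj hy,
    e.dTot_dTotInv hy]

theorem dTot_dTotInv_eq_fderiv {y : E} (hy : y ∈ e.tot.source) (hy' : y ∈ e'.tot.source) (w : B × F) :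
    e'.dTot y (e.dTotInv y w) = fderiv ℝ (e'.tot ∘ e.tot.symm) (e.tot y) w := by
  have ht := e.tot.map_source hy
  have h1 := (e.mdiff_tot.mdifferentiableAt_symm ht)
  have hy2 : e.tot.symm (e.tot y) ∈ e'.tot.source := by rwa [e.tot.left_inv hy]
  have h2 := (e'.mdiff_tot.mdifferentiableAt hy2)
  have h3 := mfderiv_comp (e.tot y) h2 h1
  rw [mfderiv_eq_fderiv] at h3
  rw [e.tot.left_inv hy] at h3
  exact (congrArg (fun f => f w) h3).symm

theorem dBase_dBaseInv_eq_fderiv {x : M} (hy : x ∈ e.base.source) (hy' : x ∈ e'.base.source)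
    (w : B) :
    e'.dBase x (e.dBaseInv x w) = fderiv ℝ (e'.base ∘ e.base.symm) (e.base x) w := by
  have ht := e.base.map_source hy
  have h1 := (e.mdiff_base.mdifferentiableAt_symm ht)
  have hy2 : e.base.symm (e.base x) ∈ e'.base.source := by rwa [e.base.left_inv hy]
  have h2 := (e'.mdiff_base.mdifferentiableAt hy2)
  have h3 := mfderiv_comp (e.base x) h2 h1
  rw [mfderiv_eq_fderiv] at h3
  rw [e.base.left_inv hy] at h3
  exact (congrArg (fun f => f w) h3).symm

/-- The transition maps of the total space. -/
theorem contDiffOn_tot : ContDiffOn ℝ ∞ (e'.tot ∘ e.tot.symm) (e.tot.symm.trans e'.tot).source :=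
  contMDiffOn_iff_contDiffOn.1
    (e'.smooth_tot.comp (e.smooth_tot_symm.mono inter_subset_left) inter_subset_right)

theorem contDiffOn_base :
    ContDiffOn ℝ ∞ (e'.base ∘ e.base.symm) (e.base.symm.trans e'.base).source :=
  contMDiffOn_iff_contDiffOn.1
    (e'.smooth_base.comp (e.smooth_base_symm.mono inter_subset_left) inter_subset_right)

end AdaptedChart

/-! ### The first jet bundle -/

/-- The first jet bundle `J¹π`: a point over `y ∈ E` is a linear section `T_{π y} M → T_y E` of `T_y π`
(the differential at `π y` of a local section of `π` through `y`). The field `pt` is the projection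
`π¹ : J¹π → E`. -/
structure Jet1 (P : FibredManifold B F M E) where
  pt : E
  lin : TangentSpace 𝓘(ℝ, B) (P.proj pt) →L[ℝ] TangentSpace 𝓘(ℝ, B × F) pt
  sec : (P.dproj pt).comp lin = ContinuousLinearMap.id ℝ _

namespace Jet1

/-- The projection `π̄¹ : J¹π → M`. -/
def toBase (j : Jet1 P) : M := P.proj j.pt

theorem dproj_lin (j : Jet1 P) (w : TangentSpace 𝓘(ℝ, B) (P.proj j.pt)) :
    P.dproj j.pt (j.lin w) = w :=
  congrArg (fun f => f w) j.sec

theorem ext_of {j j' : Jet1 P} (h : j.pt = j'.pt)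
    (h2 : ∀ w : B, (j.lin w : B × F) = j'.lin w) : j = j' := by
  obtain ⟨y, φ, s⟩ := j
  obtain ⟨y', φ', s'⟩ := j'
  dsimp only at h
  subst h
  have : φ = φ' := ContinuousLinearMap.ext h2
  subst this
  rfl

variable (e e' : AdaptedChart P)

/-- The natural coordinates `(x, y, v)` of a jet, in an adapted chart: in coordinates the section is
`ξ ↦ (ξ, v ξ)`. -/
def coords (j : Jet1 P) : (B × F) × (B →L[ℝ] F) :=
  (e.tot j.pt, (ContinuousLinearMap.snd ℝ B F).comp
    ((e.dTot j.pt).comp (j.lin.comp (e.dBaseInv (P.proj j.pt)))))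

/-- The jet at `y` with given fibre coordinates. -/
def ofCoords (y : E) (hy : y ∈ e.tot.source) (v : B →L[ℝ] F) : Jet1 P where
  pt := y
  lin := (e.dTotInv y).comp (((ContinuousLinearMap.id ℝ B).prod v).comp (e.dBase (P.proj y)))
  sec := by
    ext w
    simp [e.dproj_dTotInv hy, e.dBaseInv_dBase (e.mapsTo y hy)]

theorem coords_ofCoords (y : E) (hy : y ∈ e.tot.source) (v : B →L[ℝ] F) :
    coords e (ofCoords e y hy v) = (e.tot y, v) := by
  refine Prod.ext rfl ?_
  ext w
  change (e.dTot y (e.dTotInv y (e.dBase (P.proj y) (e.dBaseInv (P.proj y) w),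
    v (e.dBase (P.proj y) (e.dBaseInv (P.proj y) w))))).2 = v w
  rw [e.dTot_dTotInv hy, e.dBase_dBaseInv (e.mapsTo y hy)]

theorem ofCoords_coords (j : Jet1 P) (hy : j.pt ∈ e.tot.source) :
    ofCoords e j.pt hy (coords e j).2 = j := by
  refine ext_of rfl fun w => ?_
  have h1 : (e.dTot j.pt (j.lin w)).1 = e.dBase (P.proj j.pt) w := by
    rw [← e.dBase_dproj hy]
    exact congrArg _ (j.dproj_lin w)
  have h2 : (e.dBaseInv (P.proj j.pt)) ((e.dBase (P.proj j.pt)) w) = w :=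
    e.dBaseInv_dBase (e.mapsTo _ hy) w
  have h3 : ((e.dBase (P.proj j.pt)) w, (coords e j).2 ((e.dBase (P.proj j.pt)) w))
      = e.dTot j.pt (j.lin w) := by
    refine Prod.ext h1.symm ?_
    simp only [coords, ContinuousLinearMap.comp_apply]
    rw [h2]
    rfl
  calc _ = e.dTotInv j.pt ((e.dBase (P.proj j.pt)) w, (coords e j).2 ((e.dBase (P.proj j.pt)) w)) :=
        rfl
    _ = _ := by rw [h3]; exact e.dTotInv_dTot hy _

theorem ofCoords_congr {y y' : E} (h : y = y') (hy : y ∈ e.tot.source) (v : B →L[ℝ] F) :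
    ofCoords e y hy v = ofCoords e y' (h ▸ hy) v := by
  subst h; rfl

open Classical in
/-- The natural chart of the jet bundle induced by an adapted chart. -/
def natChart : PartialEquiv (Jet1 P) ((B × F) × (B →L[ℝ] F)) where
  toFun := coords e
  invFun z := if h : z.1 ∈ e.tot.target then ofCoords e (e.tot.symm z.1) (e.tot.map_target h) z.2
    else ofCoords e e.ctr e.ctr_mem 0
  source := {j | j.pt ∈ e.tot.source}
  target := {z | z.1 ∈ e.tot.target}
  map_source' j hj := e.tot.map_source hj
  map_target' z hz := by
    have hz' : z.1 ∈ e.tot.target := hz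
    simp only [hz', dite_true]
    exact e.tot.map_target hz
  left_inv' j hj := by
    have hj' : (coords e j).1 ∈ e.tot.target := e.tot.map_source hj
    simp only [hj', dite_true]
    exact (ofCoords_congr e (e.tot.left_inv hj) _ _).trans (ofCoords_coords e j hj)
  right_inv' z hz := by
    have hz' : z.1 ∈ e.tot.target := hz
    simp only [hz', dite_true]
    rw [coords_ofCoords, e.tot.right_inv hz]

theorem natChart_symm_apply {z : (B × F) × (B →L[ℝ] F)} (h : z.1 ∈ e.tot.target) :
    (natChart e).symm z = ofCoords e (e.tot.symm z.1) (e.tot.map_target h) z.2 :=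
  dif_pos h

/-- The change of natural coordinates. -/
def transition (z : (B × F) × (B →L[ℝ] F)) : (B × F) × (B →L[ℝ] F) :=
  ((e'.tot ∘ e.tot.symm) z.1, (ContinuousLinearMap.snd ℝ B F).comp
    ((fderiv ℝ (e'.tot ∘ e.tot.symm) z.1).comp (((ContinuousLinearMap.id ℝ B).prod z.2).comp
      (fderiv ℝ (e.base ∘ e'.base.symm) ((e'.tot ∘ e.tot.symm) z.1).1))))

theorem natChart_trans_source :
    ((natChart e).symm.trans (natChart e')).source
      = Prod.fst ⁻¹' (e.tot.symm.trans e'.tot).source := by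
  ext z
  simp only [PartialEquiv.trans_source, PartialEquiv.symm_source, mem_inter_iff, mem_preimage,
    OpenPartialHomeomorph.trans_source, OpenPartialHomeomorph.symm_source]
  refine and_congr_right fun hz => ?_
  have hz' : z.1 ∈ e.tot.target := hz
  rw [natChart_symm_apply e hz']
  rfl

theorem natChart_trans_eqOn : EqOn ((natChart e).symm.trans (natChart e')) (transition e e')
    (Prod.fst ⁻¹' (e.tot.symm.trans e'.tot).source) := by
  intro z hz
  have hz' : z.1 ∈ e.tot.target := hz.1
  have hy : e.tot.symm z.1 ∈ e.tot.source := e.tot.map_target hz'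
  have hy' : e.tot.symm z.1 ∈ e'.tot.source := hz.2
  change coords e' ((natChart e).symm z) = _
  rw [natChart_symm_apply e hz']
  refine Prod.ext rfl ?_
  ext w
  have h1 := e'.dBase_dBaseInv_eq_fderiv e (e'.mapsTo _ hy') (e.mapsTo _ hy) w
  have h2 := fun w => e.dTot_dTotInv_eq_fderiv e' hy hy' w
  rw [e.tot.right_inv hz'] at h2
  rw [← e'.fst_eq _ hy'] at h1
  change (e'.dTot (e.tot.symm z.1) (e.dTotInv (e.tot.symm z.1) (e.dBase _ (e'.dBaseInv (P.proj (e.tot.symm z.1)) w),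
    z.2 (e.dBase _ (e'.dBaseInv (P.proj (e.tot.symm z.1)) w))))).2 = _
  rw [h1, h2]
  rfl

theorem isOpen_dom : IsOpen
    (Prod.fst ⁻¹' (e.tot.symm.trans e'.tot).source : Set ((B × F) × (B →L[ℝ] F))) :=
  (e.tot.symm.trans e'.tot).open_source.preimage continuous_fst

theorem contDiffOn_transition : ContDiffOn ℝ ∞ (transition e e')
    (Prod.fst ⁻¹' (e.tot.symm.trans e'.tot).source) := by
  have hS := (e.tot.symm.trans e'.tot).open_source
  have hS' := (e'.base.symm.trans e.base).open_source
  have h1 : ContDiffOn ℝ ∞ (fun z : (B × F) × (B →L[ℝ] F) => (e'.tot ∘ e.tot.symm) z.1)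
      (Prod.fst ⁻¹' (e.tot.symm.trans e'.tot).source) :=
    (e.contDiffOn_tot e').comp contDiff_fst.contDiffOn (fun z hz => hz)
  have h2 : ContDiffOn ℝ ∞ (fun z : (B × F) × (B →L[ℝ] F) =>
      fderiv ℝ (e'.tot ∘ e.tot.symm) z.1) (Prod.fst ⁻¹' (e.tot.symm.trans e'.tot).source) :=
    ((e.contDiffOn_tot e').fderiv_of_isOpen hS (by simp)).comp contDiff_fst.contDiffOn
      (fun z hz => hz)
  have h3 : ContDiffOn ℝ ∞ (fun z : (B × F) × (B →L[ℝ] F) =>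
      fderiv ℝ (e.base ∘ e'.base.symm) ((e'.tot ∘ e.tot.symm) z.1).1)
      (Prod.fst ⁻¹' (e.tot.symm.trans e'.tot).source) := by
    refine ((e'.contDiffOn_base e).fderiv_of_isOpen hS' (m := ∞) (by simp)).comp
      (contDiff_fst.comp_contDiffOn h1) ?_
    intro z hz
    have hy : e.tot.symm z.1 ∈ e.tot.source := e.tot.map_target hz.1
    have hy' : e.tot.symm z.1 ∈ e'.tot.source := hz.2
    have h4 : ((e'.tot ∘ e.tot.symm) z.1).1 = e'.base (P.proj (e.tot.symm z.1)) :=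
      e'.fst_eq _ hy'
    change ((e'.tot ∘ e.tot.symm) z.1).1 ∈ (e'.base.symm.trans e.base).source
    rw [h4]
    refine ⟨e'.base.map_source (e'.mapsTo _ hy'), ?_⟩
    change e'.base.symm (e'.base (P.proj (e.tot.symm z.1))) ∈ e.base.source
    rw [e'.base.left_inv (e'.mapsTo _ hy')]
    exact e.mapsTo _ hy
  have h5 : ContDiff ℝ ∞ (fun z : (B × F) × (B →L[ℝ] F) =>
      (ContinuousLinearMap.id ℝ B).prod z.2) := by
    have : (fun z : (B × F) × (B →L[ℝ] F) => (ContinuousLinearMap.id ℝ B).prod z.2) =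
        fun z => (ContinuousLinearMap.inl ℝ B F) + (ContinuousLinearMap.inr ℝ B F).comp z.2 := by
      ext z w <;> simp
    rw [this]
    exact contDiff_const.add (contDiff_const.clm_comp contDiff_snd)
  exact h1.prodMk (contDiffOn_const.clm_comp (h2.clm_comp (h5.contDiffOn.clm_comp h3)))

variable (P) in
/-- The manifold structure of the jet bundle, given by the natural charts. -/
def core : ChartedSpaceCore ((B × F) × (B →L[ℝ] F)) (Jet1 P) where
  atlas := range natChart
  chartAt j := natChart (P.exists_adaptedChart j.pt).choose
  mem_chart_source j := by
    have h := (P.exists_adaptedChart j.pt).choose_spec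
    have h2 := (P.exists_adaptedChart j.pt).choose.ctr_mem
    rw [h] at h2
    exact h2
  chart_mem_atlas j := mem_range_self _
  open_source := by
    rintro _ _ ⟨e, rfl⟩ ⟨e', rfl⟩
    rw [natChart_trans_source]
    exact isOpen_dom e e'
  continuousOn_toFun := by
    rintro _ _ ⟨e, rfl⟩ ⟨e', rfl⟩
    rw [natChart_trans_source]
    exact (contDiffOn_transition e e').continuousOn.congr (natChart_trans_eqOn e e')

instance : TopologicalSpace (Jet1 P) := (core P).toTopologicalSpace

instance : ChartedSpace ((B × F) × (B →L[ℝ] F)) (Jet1 P) := (core P).toChartedSpace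

instance : IsManifold 𝓘(ℝ, (B × F) × (B →L[ℝ] F)) ∞ (Jet1 P) := by
  refine isManifold_of_contDiffOn _ _ _ ?_
  intro c c' hc hc'
  change c ∈ (⋃ (e : PartialEquiv (Jet1 P) ((B × F) × (B →L[ℝ] F))) (he : e ∈ (core P).atlas),
    {(core P).openPartialHomeomorph e he}) at hc
  change c' ∈ (⋃ (e : PartialEquiv (Jet1 P) ((B × F) × (B →L[ℝ] F))) (he : e ∈ (core P).atlas),
    {(core P).openPartialHomeomorph e he}) at hc'
  simp only [mem_iUnion, mem_singleton_iff] at hc hc'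
  obtain ⟨_, ⟨e, rfl⟩, rfl⟩ := hc
  obtain ⟨_, ⟨e', rfl⟩, rfl⟩ := hc'
  have h := (contDiffOn_transition e e').congr (natChart_trans_eqOn e e')
  rw [← natChart_trans_source] at h
  simp only [mfld_simps]
  exact h

end Jet1

/-! ### Multimomentum bundles -/

/-- The fibre at `y` of `π^*Λ^m T^*M`, with `m = k + 1`: the `m`-forms on `T_y E` pulled back from
`T_{π y} M`. -/
def basicForms (P : FibredManifold B F M E) (k : ℕ) (y : E) :
    Submodule ℝ (TangentSpace 𝓘(ℝ, B × F) y [⋀^Fin (k + 1)]→L[ℝ] ℝ) where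
  carrier := {α | ∃ β : TangentSpace 𝓘(ℝ, B) (P.proj y) [⋀^Fin (k + 1)]→L[ℝ] ℝ,
    α = β.compContinuousLinearMap (P.dproj y)}
  zero_mem' := ⟨0, by ext; simp⟩
  add_mem' := by
    rintro _ _ ⟨β, rfl⟩ ⟨β', rfl⟩
    exact ⟨β + β', by ext; simp⟩
  smul_mem' := by
    rintro c _ ⟨β, rfl⟩
    exact ⟨c • β, by ext; simp⟩

/-- The fibre at `y` of `Λ^m_2 T^*E`, with `m = k + 1`: the `m`-forms on `T_y E` that vanish on any two
`π`-vertical vectors. -/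
def multimomentumForms (P : FibredManifold B F M E) (k : ℕ) (y : E) :
    Submodule ℝ (TangentSpace 𝓘(ℝ, B × F) y [⋀^Fin (k + 1)]→L[ℝ] ℝ) where
  carrier := {α | ∀ (w : Fin (k + 1) → TangentSpace 𝓘(ℝ, B × F) y) (i j : Fin (k + 1)), i ≠ j →
    P.dproj y (w i) = 0 → P.dproj y (w j) = 0 → α w = 0}
  zero_mem' := fun _ _ _ _ _ _ => rfl
  add_mem' := by
    intro α β hα hβ w i j hij hi hj
    simp [hα w i j hij hi hj, hβ w i j hij hi hj]
  smul_mem' := by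
    intro c α hα w i j hij hi hj
    simp [hα w i j hij hi hj]

/-- The extended multimomentum bundle `Λ^m_2 T^*E`, with `m = k + 1`. -/
structure ExtMultimomentum (P : FibredManifold B F M E) (k : ℕ) where
  pt : E
  form : multimomentumForms P k pt

/-- The multimomentum bundle `J¹π^* = Λ^m_2 T^*E / π^*Λ^m T^*M`, with `m = k + 1`. A point over `y ∈ E`
is a class modulo `basicForms` which has a representative in `multimomentumForms`. -/
structure Multimomentum (P : FibredManifold B F M E) (k : ℕ) where
  pt : E
  cls : (TangentSpace 𝓘(ℝ, B × F) pt [⋀^Fin (k + 1)]→L[ℝ] ℝ) ⧸ basicForms P k pt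
  mem : cls ∈ (multimomentumForms P k pt).map (basicForms P k pt).mkQ

/-- The quotient map `μ : Λ^m_2 T^*E → J¹π^*`. -/
def ExtMultimomentum.toMultimomentum {k : ℕ} (a : ExtMultimomentum P k) : Multimomentum P k :=
  ⟨a.pt, (basicForms P k a.pt).mkQ a.form, Submodule.mem_map_of_mem a.form.2⟩

section Coefficients

variable {W : Type*} [NormedAddCommGroup W] [NormedSpace ℝ W] {k : ℕ}

variable (B F k) in
/-- The momenta `u ↦ (ξ ↦ β(u, ξ_1, ..., ξ_k))` of a form on `B × F`, for `u` vertical and `ξ_i`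
horizontal. -/
def momentumCoeff : ((B × F) [⋀^Fin (k + 1)]→L[ℝ] ℝ) →L[ℝ] (F →L[ℝ] B [⋀^Fin k]→L[ℝ] ℝ) :=
  ((ContinuousLinearMap.compL ℝ F ((B × F) [⋀^Fin k]→L[ℝ] ℝ) (B [⋀^Fin k]→L[ℝ] ℝ)
    (ContinuousAlternatingMap.compContinuousLinearMapCLM (ContinuousLinearMap.inl ℝ B F))).comp
      ((ContinuousLinearMap.compL ℝ F (B × F) ((B × F) [⋀^Fin k]→L[ℝ] ℝ)).flip
        (ContinuousLinearMap.inr ℝ B F))).comp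
    (ContinuousAlternatingMap.curryLeftLI (𝕜 := ℝ) (E := B × F) (F := ℝ)
      (n := k)).toContinuousLinearMap

theorem momentumCoeff_apply (β : (B × F) [⋀^Fin (k + 1)]→L[ℝ] ℝ) (u : F) (ξ : Fin k → B) :
    momentumCoeff B F k β u ξ = β (Matrix.vecCons ((0 : B), u) fun i => (ξ i, (0 : F))) := rfl

variable (B F k) in
/-- The form on `B × F` with given momenta that vanishes on horizontal vectors and on any two vertical
ones. -/
def momentumForm : (F →L[ℝ] B [⋀^Fin k]→L[ℝ] ℝ) →L[ℝ] ((B × F) [⋀^Fin (k + 1)]→L[ℝ] ℝ) :=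
  (ContinuousAlternatingMap.alternatizeUncurryFinCLM ℝ (B × F) ℝ).comp
    ((ContinuousLinearMap.compL ℝ (B × F) (B [⋀^Fin k]→L[ℝ] ℝ) ((B × F) [⋀^Fin k]→L[ℝ] ℝ)
      (ContinuousAlternatingMap.compContinuousLinearMapCLM (ContinuousLinearMap.fst ℝ B F))).comp
      ((ContinuousLinearMap.compL ℝ (B × F) F (B [⋀^Fin k]→L[ℝ] ℝ)).flip
        (ContinuousLinearMap.snd ℝ B F)))

theorem momentumForm_apply (p : F →L[ℝ] B [⋀^Fin k]→L[ℝ] ℝ) (w : Fin (k + 1) → B × F) :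
    momentumForm B F k p w =
      ∑ i : Fin (k + 1), (-1) ^ (i : ℕ) • p (w i).2 fun l => (w (i.succAbove l)).1 := by
  change ContinuousAlternatingMap.alternatizeUncurryFin _ w = _
  rw [ContinuousAlternatingMap.alternatizeUncurryFin_apply]
  rfl

theorem momentumForm_eq_zero (p : F →L[ℝ] B [⋀^Fin k]→L[ℝ] ℝ) (w : Fin (k + 1) → B × F)
    {i j : Fin (k + 1)} (hij : i ≠ j) (hi : (w i).1 = 0) (hj : (w j).1 = 0) :
    momentumForm B F k p w = 0 := by
  rw [momentumForm_apply]
  refine Finset.sum_eq_zero fun l _ => ?_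
  have : ∃ a, a ≠ l ∧ (w a).1 = 0 := by
    by_cases h : i = l
    · exact ⟨j, fun h' => hij (h.trans h'.symm), hj⟩
    · exact ⟨i, h, hi⟩
  obtain ⟨a, ha, ha0⟩ := this
  obtain ⟨b, rfl⟩ := Fin.exists_succAbove_eq ha
  rw [(p (w l).2).map_coord_zero b ha0, smul_zero]

theorem momentumCoeff_momentumForm (p : F →L[ℝ] B [⋀^Fin k]→L[ℝ] ℝ) :
    momentumCoeff B F k (momentumForm B F k p) = p := by
  ext u ξ
  rw [momentumCoeff_apply, momentumForm_apply, Fin.sum_univ_succ]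
  rw [Finset.sum_eq_zero]
  · simp
  · intro l _
    simp

/-- A form that is killed by vertical vectors only depends on the horizontal components. -/
theorem form_eq_of_vertical_zero (β : (B × F) [⋀^Fin (k + 1)]→L[ℝ] ℝ)
    (h2 : ∀ (w : Fin (k + 1) → B × F) (i j : Fin (k + 1)), i ≠ j → (w i).1 = 0 → (w j).1 = 0 →
      β w = 0) (h1 : momentumCoeff B F k β = 0) (w : Fin (k + 1) → B × F) :
    β w = β fun i => ((w i).1, (0 : F)) := by
  have key : ∀ (w : Fin (k + 1) → B × F) (i : Fin (k + 1)), (w i).1 = 0 →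
      (∀ j, j ≠ i → (w j).2 = 0) → β w = 0 := by
    intro w i hi hj
    have h3 : β (i.insertNth (w i) (i.removeNth w)) = 0 := by
      rw [β.map_insertNth]
      have h4 : momentumCoeff B F k β (w i).2 (fun l => (i.removeNth w l).1) = 0 := by
        rw [h1]; rfl
      rw [momentumCoeff_apply] at h4
      have h5 : w i = ((0 : B), (w i).2) := Prod.ext hi rfl
      have h6 : (i.removeNth w) = fun l => ((i.removeNth w l).1, (0 : F)) := by
        funext l
        exact Prod.ext rfl (hj _ (Fin.succAbove_ne i l))
      rw [h5, h6]
      exact (congrArg (fun c : ℝ => (-1 : ℤ) ^ (i : ℕ) • c) h4).trans (smul_zero _)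
    rwa [Fin.insertNth_self_removeNth] at h3
  have key2 : ∀ (w : Fin (k + 1) → B × F) (i : Fin (k + 1)), (w i).1 = 0 → β w = 0 := by
    intro w i hi
    -- replace the other entries one at a time
    have : ∀ s : Finset (Fin (k + 1)), i ∉ s →
        β w = β (fun l => if l ∈ s then ((w l).1, (0 : F)) else w l) := by
      intro s
      induction s using Finset.induction_on with
      | empty => intro _; simp
      | insert a s ha ih =>
        intro hi'
        simp only [Finset.mem_insert, not_or] at hi'
        rw [ih hi'.2]
        set w' := fun l => if l ∈ s then ((w l).1, (0 : F)) else w l with hw'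
        have e1 : w' = Function.update w' a (((w a).1, (0 : F)) + ((0 : B), (w a).2)) := by
          funext l
          by_cases hl : l = a
          · subst hl; simp [hw', ha]
          · simp [hl]
        have e2 : (fun l => if l ∈ insert a s then ((w l).1, (0 : F)) else w l)
            = Function.update w' a ((w a).1, (0 : F)) := by
          funext l
          by_cases hl : l = a
          · subst hl; simp
          · simp [hl, hw']
        rw [e2]
        conv_lhs => rw [e1]
        rw [β.map_update_add]
        rw [h2 (Function.update w' a ((0 : B), (w a).2)) a i (fun h => hi'.1 h.symm) (by simp)
          (by rw [Function.update_of_ne hi'.1]; simp [hw', hi'.2, hi]), add_zero]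
    rw [this (Finset.univ.erase i) (by simp)]
    refine key _ i (by simp [hi]) ?_
    intro j hj
    simp [hj]
  have : ∀ s : Finset (Fin (k + 1)),
      β w = β (fun l => if l ∈ s then ((w l).1, (0 : F)) else w l) := by
    intro s
    induction s using Finset.induction_on with
    | empty => simp
    | insert a s ha ih =>
      rw [ih]
      set w' := fun l => if l ∈ s then ((w l).1, (0 : F)) else w l with hw'
      have e1 : w' = Function.update w' a (((w a).1, (0 : F)) + ((0 : B), (w a).2)) := by
        funext l
        by_cases hl : l = a
        · subst hl; simp [hw', ha]
        · simp [hl]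
      have e2 : (fun l => if l ∈ insert a s then ((w l).1, (0 : F)) else w l)
          = Function.update w' a ((w a).1, (0 : F)) := by
        funext l
        by_cases hl : l = a
        · subst hl; simp
        · simp [hl, hw']
      rw [e2]
      conv_lhs => rw [e1]
      rw [β.map_update_add, key2 (Function.update w' a ((0 : B), (w a).2)) a (by simp), add_zero]
  simpa using this Finset.univ

theorem contDiff_compContinuousLinearMap {V : Type*} [NormedAddCommGroup V] [NormedSpace ℝ V]
    [FiniteDimensional ℝ V] [FiniteDimensional ℝ W] (d : ℕ) :
    ContDiff ℝ ∞ fun x : (W [⋀^Fin d]→L[ℝ] ℝ) × (V →L[ℝ] W) =>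
      x.1.compContinuousLinearMap x.2 := by
  let j : (V [⋀^Fin d]→L[ℝ] ℝ) →ₗ[ℝ] ContinuousMultilinearMap ℝ (fun _ : Fin d => V) ℝ :=
    { toFun := fun f => f.toContinuousMultilinearMap
      map_add' := fun _ _ => rfl
      map_smul' := fun _ _ => rfl }
  have hinj : Function.Injective j :=
    ContinuousAlternatingMap.toContinuousMultilinearMap_injective
  have hfin : FiniteDimensional ℝ (ContinuousMultilinearMap ℝ (fun _ : Fin d => V) ℝ) :=
    Module.Finite.of_injective
      ({ toFun := fun f => f.toMultilinearMap
         map_add' := fun _ _ => rfl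
         map_smul' := fun _ _ => rfl } : ContinuousMultilinearMap ℝ (fun _ : Fin d => V) ℝ →ₗ[ℝ]
          MultilinearMap ℝ (fun _ : Fin d => V) ℝ)
      ContinuousMultilinearMap.toMultilinearMap_injective
  obtain ⟨r, hr⟩ := j.exists_leftInverse_of_injective
    (LinearMap.ker_eq_bot.2 hinj)
  have h1 : ContDiff ℝ ∞ fun x : (W [⋀^Fin d]→L[ℝ] ℝ) × (V →L[ℝ] W) =>
      ContinuousMultilinearMap.compContinuousLinearMapContinuousMultilinear ℝ
        (fun _ : Fin d => V) (fun _ : Fin d => W) ℝ (fun _ => x.2)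
        (ContinuousAlternatingMap.toContinuousMultilinearMapCLM ℝ x.1) :=
    ((ContinuousMultilinearMap.contDiff _).comp (contDiff_pi.2 fun _ => contDiff_snd)).clm_apply
      ((ContinuousLinearMap.contDiff _).comp contDiff_fst)
  have h2 := (LinearMap.toContinuousLinearMap r).contDiff (n := ∞) |>.comp h1
  have h3 : (fun x : (W [⋀^Fin d]→L[ℝ] ℝ) × (V →L[ℝ] W) => x.1.compContinuousLinearMap x.2) =
      (LinearMap.toContinuousLinearMap r) ∘ fun x : (W [⋀^Fin d]→L[ℝ] ℝ) × (V →L[ℝ] W) =>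
      ContinuousMultilinearMap.compContinuousLinearMapContinuousMultilinear ℝ
        (fun _ : Fin d => V) (fun _ : Fin d => W) ℝ (fun _ => x.2)
        (ContinuousAlternatingMap.toContinuousMultilinearMapCLM ℝ x.1) := by
    funext x
    exact (congrArg (fun f => f (x.1.compContinuousLinearMap x.2)) hr).symm
  rw [h3]
  exact h2

theorem contDiff_momentumForm : ContDiff ℝ ∞ fun p : F →L[ℝ] B [⋀^Fin k]→L[ℝ] ℝ =>
    momentumForm B F k p :=
  ContinuousLinearMap.contDiff (𝕜 := ℝ) (E := F →L[ℝ] B [⋀^Fin k]→L[ℝ] ℝ)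
    (F := (B × F) [⋀^Fin (k + 1)]→L[ℝ] ℝ) (momentumForm B F k)

theorem contDiff_momentumCoeff : ContDiff ℝ ∞ fun p : (B × F) [⋀^Fin (k + 1)]→L[ℝ] ℝ =>
    momentumCoeff B F k p :=
  ContinuousLinearMap.contDiff (𝕜 := ℝ) (F := F →L[ℝ] B [⋀^Fin k]→L[ℝ] ℝ)
    (E := (B × F) [⋀^Fin (k + 1)]→L[ℝ] ℝ) (momentumCoeff B F k)

end Coefficients

namespace Multimomentum

variable {k : ℕ} (e e' : AdaptedChart P)

/-- The projection `τ̄¹ : J¹π^* → M`. -/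
def toBase (q : Multimomentum P k) : M := P.proj q.pt

theorem ext_of {y : E} {c c' : (TangentSpace 𝓘(ℝ, B × F) y [⋀^Fin (k + 1)]→L[ℝ] ℝ) ⧸
    basicForms P k y} (h : c = c') (m m') : (⟨y, c, m⟩ : Multimomentum P k) = ⟨y, c', m'⟩ := by
  subst h; rfl

/-- The natural coordinates of a multimomentum: the adapted coordinates of its base point, and the
momenta, read off from any representative. -/
def coords (q : Multimomentum P k) : (B × F) × (F →L[ℝ] B [⋀^Fin k]→L[ℝ] ℝ) :=
  (e.tot q.pt, momentumCoeff B F k (q.mem.choose.compContinuousLinearMap (e.dTotInv q.pt)))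

theorem momentumCoeff_basic {y : E} (hy : y ∈ e.tot.source)
    {α : TangentSpace 𝓘(ℝ, B × F) y [⋀^Fin (k + 1)]→L[ℝ] ℝ} (hα : α ∈ basicForms P k y) :
    momentumCoeff B F k (α.compContinuousLinearMap (e.dTotInv y)) = 0 := by
  obtain ⟨β, rfl⟩ := hα
  ext u ξ
  change β _ = 0
  refine β.map_coord_zero 0 ?_
  change P.dproj y (e.dTotInv y ((0 : B), u)) = 0
  rw [e.dproj_dTotInv hy]
  exact map_zero _

theorem coords_mk {y : E} (hy : y ∈ e.tot.source)
    (α : TangentSpace 𝓘(ℝ, B × F) y [⋀^Fin (k + 1)]→L[ℝ] ℝ) (m) :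
    coords e (⟨y, (basicForms P k y).mkQ α, m⟩ : Multimomentum P k) =
      (e.tot y, momentumCoeff B F k (α.compContinuousLinearMap (e.dTotInv y))) := by
  refine Prod.ext rfl ?_
  have h := (Submodule.Quotient.eq _).1 (Exists.choose_spec m).2
  have h2 := momentumCoeff_basic e hy h
  have h3 : momentumCoeff B F k ((Exists.choose m).compContinuousLinearMap (e.dTotInv y)) -
      momentumCoeff B F k (α.compContinuousLinearMap (e.dTotInv y)) = 0 := by
    exact (map_sub (momentumCoeff B F k) _ _).symm.trans h2
  exact sub_eq_zero.1 h3

theorem dproj_eq_zero_iff {y : E} (hy : y ∈ e.tot.source) (w : TangentSpace 𝓘(ℝ, B × F) y) :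
    P.dproj y w = 0 ↔ (e.dTot y w).1 = 0 := by
  rw [← e.dBase_dproj hy]
  refine ⟨fun h => by rw [h]; exact map_zero _, fun h => ?_⟩
  rw [← e.dBaseInv_dBase (e.mapsTo y hy) (P.dproj y w), h]
  exact map_zero _

theorem momentumForm_mem {y : E} (hy : y ∈ e.tot.source) (p : F →L[ℝ] B [⋀^Fin k]→L[ℝ] ℝ) :
    (momentumForm B F k p).compContinuousLinearMap (e.dTot y) ∈ multimomentumForms P k y := by
  intro w i j hij hi hj
  exact momentumForm_eq_zero p _ hij ((dproj_eq_zero_iff e hy _).1 hi)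
    ((dproj_eq_zero_iff e hy _).1 hj)

/-- The multimomentum at `y` with given momenta. -/
def ofCoords (y : E) (hy : y ∈ e.tot.source) (p : F →L[ℝ] B [⋀^Fin k]→L[ℝ] ℝ) :
    Multimomentum P k :=
  ⟨y, (basicForms P k y).mkQ ((momentumForm B F k p).compContinuousLinearMap (e.dTot y)),
    Submodule.mem_map_of_mem (momentumForm_mem e hy p)⟩

theorem coords_ofCoords' (y : E) (hy : y ∈ e.tot.source) (hy' : y ∈ e'.tot.source)
    (p : F →L[ℝ] B [⋀^Fin k]→L[ℝ] ℝ) :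
    coords e' (ofCoords e y hy p) = (e'.tot y, momentumCoeff B F k
      ((momentumForm B F k p).compContinuousLinearMap
        ((e.dTot y).comp (e'.dTotInv y)))) :=
  coords_mk e' hy' _ _

theorem coords_ofCoords (y : E) (hy : y ∈ e.tot.source) (p : F →L[ℝ] B [⋀^Fin k]→L[ℝ] ℝ) :
    coords e (ofCoords e y hy p) = (e.tot y, p) := by
  rw [coords_ofCoords' e e y hy hy]
  have : (e.dTot y).comp (e.dTotInv y) = ContinuousLinearMap.id ℝ (B × F) :=
    ContinuousLinearMap.ext fun w => e.dTot_dTotInv hy w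
  rw [this]
  exact Prod.ext rfl (momentumCoeff_momentumForm p)

theorem ofCoords_coords (q : Multimomentum P k) (hy : q.pt ∈ e.tot.source) :
    ofCoords e q.pt hy (coords e q).2 = q := by
  obtain ⟨y, c, m⟩ := q
  obtain ⟨α, hα, rfl⟩ := id m
  rw [coords_mk e hy]
  refine ext_of ?_ _ _
  refine (Submodule.Quotient.eq _).2 ?_
  set β := α.compContinuousLinearMap (e.dTotInv y) with hβ
  set δ : (B × F) [⋀^Fin (k + 1)]→L[ℝ] ℝ := momentumForm B F k (momentumCoeff B F k β) - β with hδ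
  have hv : ∀ w : B × F, w.1 = 0 → P.dproj y (e.dTotInv y w) = 0 := fun w hw => by
    rw [e.dproj_dTotInv hy, hw]; exact map_zero _
  have h2 : ∀ (w : Fin (k + 1) → B × F) (i j : Fin (k + 1)), i ≠ j → (w i).1 = 0 → (w j).1 = 0 →
      δ w = 0 := by
    intro w i j hij hi hj
    have h3 : β w = 0 := hα _ i j hij (hv _ hi) (hv _ hj)
    have h4 := momentumForm_eq_zero (momentumCoeff B F k β) w hij hi hj
    change momentumForm B F k (momentumCoeff B F k β) w - β w = 0
    rw [h3, h4, sub_zero]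
  have h1 : momentumCoeff B F k δ = 0 := by
    rw [hδ, map_sub, momentumCoeff_momentumForm, sub_self]
  have h5 := form_eq_of_vertical_zero δ h2 h1
  refine ⟨(δ.compContinuousLinearMap (ContinuousLinearMap.inl ℝ B F)).compContinuousLinearMap
    (e.dBase (P.proj y)), ?_⟩
  ext w
  have h6 : δ (fun i => e.dTot y (w i)) = momentumForm B F k (momentumCoeff B F k β)
      (fun i => e.dTot y (w i)) - α w := by
    have : β (fun i => e.dTot y (w i)) = α w := by
      change α (fun i => e.dTotInv y (e.dTot y (w i))) = α w
      exact congrArg α (funext fun i => e.dTotInv_dTot hy (w i))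
    rw [← this]; rfl
  refine h6.symm.trans ((h5 _).trans ?_)
  refine congrArg δ (funext fun i => ?_)
  exact Prod.ext (e.dBase_dproj hy (w i)).symm rfl

theorem ofCoords_congr {y y' : E} (h : y = y') (hy : y ∈ e.tot.source)
    (p : F →L[ℝ] B [⋀^Fin k]→L[ℝ] ℝ) : ofCoords e y hy p = ofCoords e y' (h ▸ hy) p := by
  subst h; rfl

open Classical in
/-- The natural chart of the multimomentum bundle induced by an adapted chart. -/
def natChart (k : ℕ) (e : AdaptedChart P) :
    PartialEquiv (Multimomentum P k) ((B × F) × (F →L[ℝ] B [⋀^Fin k]→L[ℝ] ℝ)) where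
  toFun := coords e
  invFun z := if h : z.1 ∈ e.tot.target then ofCoords e (e.tot.symm z.1) (e.tot.map_target h) z.2
    else ofCoords e e.ctr e.ctr_mem 0
  source := {q | q.pt ∈ e.tot.source}
  target := {z | z.1 ∈ e.tot.target}
  map_source' q hq := e.tot.map_source hq
  map_target' z hz := by
    have hz' : z.1 ∈ e.tot.target := hz
    simp only [hz', dite_true]
    exact e.tot.map_target hz
  left_inv' q hq := by
    have hq' : (coords e q).1 ∈ e.tot.target := e.tot.map_source hq
    simp only [hq', dite_true]
    exact (ofCoords_congr e (e.tot.left_inv hq) _ _).trans (ofCoords_coords e q hq)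
  right_inv' z hz := by
    have hz' : z.1 ∈ e.tot.target := hz
    simp only [hz', dite_true]
    rw [coords_ofCoords, e.tot.right_inv hz]

theorem natChart_symm_apply {z : (B × F) × (F →L[ℝ] B [⋀^Fin k]→L[ℝ] ℝ)}
    (h : z.1 ∈ e.tot.target) :
    (natChart k e).symm z = ofCoords e (e.tot.symm z.1) (e.tot.map_target h) z.2 :=
  dif_pos h

/-- The change of natural coordinates. -/
def transition (z : (B × F) × (F →L[ℝ] B [⋀^Fin k]→L[ℝ] ℝ)) :
    (B × F) × (F →L[ℝ] B [⋀^Fin k]→L[ℝ] ℝ) :=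
  ((e'.tot ∘ e.tot.symm) z.1, momentumCoeff B F k
    ((momentumForm B F k z.2).compContinuousLinearMap
      (fderiv ℝ (e.tot ∘ e'.tot.symm) ((e'.tot ∘ e.tot.symm) z.1))))

theorem natChart_trans_source :
    ((natChart k e).symm.trans (natChart k e')).source
      = Prod.fst ⁻¹' (e.tot.symm.trans e'.tot).source := by
  ext z
  simp only [PartialEquiv.trans_source, PartialEquiv.symm_source, mem_inter_iff, mem_preimage,
    OpenPartialHomeomorph.trans_source, OpenPartialHomeomorph.symm_source]
  refine and_congr_right fun hz => ?_
  have hz' : z.1 ∈ e.tot.target := hz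
  rw [natChart_symm_apply e hz']
  rfl

theorem natChart_trans_eqOn :
    EqOn ((natChart k e).symm.trans (natChart k e')) (transition e e')
      (Prod.fst ⁻¹' (e.tot.symm.trans e'.tot).source) := by
  intro z hz
  have hz' : z.1 ∈ e.tot.target := hz.1
  have hy : e.tot.symm z.1 ∈ e.tot.source := e.tot.map_target hz'
  have hy' : e.tot.symm z.1 ∈ e'.tot.source := hz.2
  change coords e' ((natChart k e).symm z) = _
  rw [natChart_symm_apply e hz', coords_ofCoords' e e' _ hy hy']
  have : (e.dTot (e.tot.symm z.1)).comp (e'.dTotInv (e.tot.symm z.1)) =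
      fderiv ℝ (e.tot ∘ e'.tot.symm) ((e'.tot ∘ e.tot.symm) z.1) :=
    ContinuousLinearMap.ext fun w => e'.dTot_dTotInv_eq_fderiv e hy' hy w
  rw [this]
  rfl

theorem isOpen_dom : IsOpen (Prod.fst ⁻¹' (e.tot.symm.trans e'.tot).source :
    Set ((B × F) × (F →L[ℝ] B [⋀^Fin k]→L[ℝ] ℝ))) :=
  (e.tot.symm.trans e'.tot).open_source.preimage continuous_fst

variable [FiniteDimensional ℝ B] [FiniteDimensional ℝ F]

theorem contDiffOn_transition : ContDiffOn ℝ ∞ (transition (k := k) e e')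
    (Prod.fst ⁻¹' (e.tot.symm.trans e'.tot).source) := by
  have hS' := (e'.tot.symm.trans e.tot).open_source
  have h1 : ContDiffOn ℝ ∞ (fun z : (B × F) × (F →L[ℝ] B [⋀^Fin k]→L[ℝ] ℝ) =>
      (e'.tot ∘ e.tot.symm) z.1) (Prod.fst ⁻¹' (e.tot.symm.trans e'.tot).source) :=
    (e.contDiffOn_tot e').comp contDiff_fst.contDiffOn (fun z hz => hz)
  have h2 : ContDiffOn ℝ ∞ (fun z : (B × F) × (F →L[ℝ] B [⋀^Fin k]→L[ℝ] ℝ) =>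
      fderiv ℝ (e.tot ∘ e'.tot.symm) ((e'.tot ∘ e.tot.symm) z.1))
      (Prod.fst ⁻¹' (e.tot.symm.trans e'.tot).source) := by
    refine ((e'.contDiffOn_tot e).fderiv_of_isOpen hS' (m := ∞) (by simp)).comp h1 ?_
    intro z hz
    have hy : e.tot.symm z.1 ∈ e.tot.source := e.tot.map_target hz.1
    have hy' : e.tot.symm z.1 ∈ e'.tot.source := hz.2
    refine ⟨e'.tot.map_source hy', ?_⟩
    change e'.tot.symm (e'.tot (e.tot.symm z.1)) ∈ e.tot.source
    rwa [e'.tot.left_inv hy']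
  have h3 : ContDiffOn ℝ ∞ (fun z : (B × F) × (F →L[ℝ] B [⋀^Fin k]→L[ℝ] ℝ) =>
      (momentumForm B F k z.2).compContinuousLinearMap
        (fderiv ℝ (e.tot ∘ e'.tot.symm) ((e'.tot ∘ e.tot.symm) z.1)))
      (Prod.fst ⁻¹' (e.tot.symm.trans e'.tot).source) :=
    (contDiff_compContinuousLinearMap (V := B × F) (W := B × F) (k + 1)).comp_contDiffOn
      ((contDiff_momentumForm.comp contDiff_snd).contDiffOn.prodMk h2)
  exact h1.prodMk (contDiff_momentumCoeff.comp_contDiffOn h3)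

variable (P k) in
/-- The manifold structure of the multimomentum bundle, given by the natural charts. -/
def core : ChartedSpaceCore ((B × F) × (F →L[ℝ] B [⋀^Fin k]→L[ℝ] ℝ)) (Multimomentum P k) where
  atlas := range (natChart k)
  chartAt q := natChart k (P.exists_adaptedChart q.pt).choose
  mem_chart_source q := by
    have h := (P.exists_adaptedChart q.pt).choose_spec
    have h2 := (P.exists_adaptedChart q.pt).choose.ctr_mem
    rw [h] at h2
    exact h2
  chart_mem_atlas q := mem_range_self _
  open_source := by
    rintro _ _ ⟨e, rfl⟩ ⟨e', rfl⟩
    rw [natChart_trans_source (k := k)]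
    exact isOpen_dom e e'
  continuousOn_toFun := by
    rintro _ _ ⟨e, rfl⟩ ⟨e', rfl⟩
    rw [natChart_trans_source (k := k)]
    exact (contDiffOn_transition (k := k) e e').continuousOn.congr (natChart_trans_eqOn (k := k) e e')

instance : TopologicalSpace (Multimomentum P k) := (core P k).toTopologicalSpace

instance : ChartedSpace ((B × F) × (F →L[ℝ] B [⋀^Fin k]→L[ℝ] ℝ)) (Multimomentum P k) :=
  (core P k).toChartedSpace

instance : IsManifold 𝓘(ℝ, (B × F) × (F →L[ℝ] B [⋀^Fin k]→L[ℝ] ℝ)) ∞ (Multimomentum P k) := by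
  refine isManifold_of_contDiffOn _ _ _ ?_
  intro c c' hc hc'
  change c ∈ (⋃ (e : PartialEquiv (Multimomentum P k) ((B × F) × (F →L[ℝ] B [⋀^Fin k]→L[ℝ] ℝ)))
    (he : e ∈ (core P k).atlas), {(core P k).openPartialHomeomorph e he}) at hc
  change c' ∈ (⋃ (e : PartialEquiv (Multimomentum P k) ((B × F) × (F →L[ℝ] B [⋀^Fin k]→L[ℝ] ℝ)))
    (he : e ∈ (core P k).atlas), {(core P k).openPartialHomeomorph e he}) at hc'
  simp only [mem_iUnion, mem_singleton_iff] at hc hc'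
  obtain ⟨_, ⟨e, rfl⟩, rfl⟩ := hc
  obtain ⟨_, ⟨e', rfl⟩, rfl⟩ := hc'
  have h := (contDiffOn_transition (k := k) e e').congr (natChart_trans_eqOn (k := k) e e')
  rw [← natChart_trans_source (k := k)] at h
  simp only [mfld_simps]
  exact h

end Multimomentum

/-! ### The Legendre maps -/

section Legendre

variable {k : ℕ}

/-- The affine structure of the fibres of the jet bundle: `j.shift A` is the jet `j + A`, where a
linear map `A : T_x M → T_y E` is first made vertical, by subtracting its horizontal part with
respect to `j`. -/
def Jet1.shift (j : Jet1 P)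
    (A : TangentSpace 𝓘(ℝ, B) (P.proj j.pt) →L[ℝ] TangentSpace 𝓘(ℝ, B × F) j.pt) : Jet1 P where
  pt := j.pt
  lin := j.lin + (A - j.lin.comp ((P.dproj j.pt).comp A))
  sec := by
    ext v
    simp [j.dproj_lin]

/-- The derivative at `j` of a function on the jet bundle along the fibre of `J¹π → E`. -/
def fibreDeriv (L : Jet1 P → ℝ) (j : Jet1 P) : (B →L[ℝ] B × F) →L[ℝ] ℝ :=
  fderiv ℝ (fun A : B →L[ℝ] B × F => L (j.shift A)) 0

/-- The map `Z ↦ S Z ∘ a`, as a continuous linear map. -/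
def postcompAlternating {V W A : Type*} [NormedAddCommGroup V] [NormedSpace ℝ V]
    [NormedAddCommGroup W] [NormedSpace ℝ W] [NormedAddCommGroup A] [NormedSpace ℝ A]
    (S : W →L[ℝ] A →L[ℝ] ℝ) (a : V [⋀^Fin k]→L[ℝ] A) : W →L[ℝ] V [⋀^Fin k]→L[ℝ] ℝ :=
  LinearMap.mkContinuous
    { toFun := fun Z => (S Z).compContinuousAlternatingMap a
      map_add' := fun Z Z' => by rw [map_add]; rfl
      map_smul' := fun c Z => by rw [map_smul]; rfl } (‖S‖ * ‖a‖)
    fun Z => ((S Z).norm_compContinuousAlternatingMap_le a).trans (by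
      calc ‖S Z‖ * ‖a‖ ≤ (‖S‖ * ‖Z‖) * ‖a‖ := by gcongr; exact S.le_opNorm Z
        _ = ‖S‖ * ‖a‖ * ‖Z‖ := by ring)

/-- For `Z ∈ T_y E`, the `k`-form `ξ ↦ d_v L(η(·, ξ_1, ..., ξ_k) ⊗ Z)` on `T_x M`, where `d_v L` is the
derivative of `L` at `j` along the fibre. -/
def legendreCoeff (L : Jet1 P → ℝ) (j : Jet1 P) (η₀ : B [⋀^Fin (k + 1)]→L[ℝ] ℝ) :
    (B × F) →L[ℝ] B [⋀^Fin k]→L[ℝ] ℝ :=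
  postcompAlternating
    ((ContinuousLinearMap.compL ℝ (B →L[ℝ] ℝ) (B →L[ℝ] B × F) ℝ (fibreDeriv L j)).comp
      (ContinuousLinearMap.smulRightL ℝ B (B × F)).flip)
    η₀.curryLeft.flipAlternating

theorem legendreCoeff_apply (L : Jet1 P → ℝ) (j : Jet1 P) (η₀ : B [⋀^Fin (k + 1)]→L[ℝ] ℝ)
    (Z : B × F) (ξ : Fin k → B) :
    legendreCoeff L j η₀ Z ξ =
      fibreDeriv L j ((η₀.curryLeft.flipAlternating ξ).smulRight Z) := rfl


theorem alternatize_eq_zero {G : B × F →L[ℝ] B [⋀^Fin k]→L[ℝ] ℝ} {d : B × F →L[ℝ] B}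
    (w : Fin (k + 1) → B × F) {a b : Fin (k + 1)} (hab : a ≠ b) (ha : d (w a) = 0)
    (hb : d (w b) = 0) :
    ContinuousAlternatingMap.alternatizeUncurryFin
      ((ContinuousAlternatingMap.compContinuousLinearMapCLM d).comp G :
        B × F →L[ℝ] (B × F) [⋀^Fin k]→L[ℝ] ℝ) w = 0 := by
  rw [ContinuousAlternatingMap.alternatizeUncurryFin_apply]
  refine Finset.sum_eq_zero fun l _ => ?_
  have : ∃ c, c ≠ l ∧ d (w c) = 0 := by
    by_cases h : a = l
    · exact ⟨b, fun h' => hab (h.trans h'.symm), hb⟩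
    · exact ⟨a, h, ha⟩
  obtain ⟨c, hc, hc0⟩ := this
  obtain ⟨c', rfl⟩ := Fin.exists_succAbove_eq hc
  have h : G (w l) (fun i => d (w (l.succAbove i))) = 0 := (G (w l)).map_coord_zero c' hc0
  exact (congrArg (fun r : ℝ => (-1 : ℤ) ^ (l : ℕ) • r) h).trans (smul_zero _)

/-- The value at `j` of the Poincaré-Cartan form, as a form on `T_y E`, `y = π¹(j)`:
`(w_1, ..., w_m) ↦ L(j) η(Tπ w_1, ..., Tπ w_m)
  + Σ_l d_v L(η(Tπ w_1, ..., ·, ..., Tπ w_m) ⊗ w_l)` with the free argument at the `l`-th place.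
In natural coordinates with `η = d^m x` this is
`∂L/∂v^A_α (dy^A - v^A_β dx^β) ∧ d^{m-1}x_α + L d^m x`. -/
def legendreForm (L : Jet1 P → ℝ)
    (η : ∀ x : M, TangentSpace 𝓘(ℝ, B) x [⋀^Fin (k + 1)]→L[ℝ] ℝ) (j : Jet1 P) :
    TangentSpace 𝓘(ℝ, B × F) j.pt [⋀^Fin (k + 1)]→L[ℝ] ℝ :=
  let d : B × F →L[ℝ] B := P.dproj j.pt
  let η₀ : B [⋀^Fin (k + 1)]→L[ℝ] ℝ := η (P.proj j.pt)
  (L j • η₀.compContinuousLinearMap d + ContinuousAlternatingMap.alternatizeUncurryFin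
      ((ContinuousAlternatingMap.compContinuousLinearMapCLM d).comp (legendreCoeff L j η₀)) :
    (B × F) [⋀^Fin (k + 1)]→L[ℝ] ℝ)

theorem legendreForm_mem (L : Jet1 P → ℝ)
    (η : ∀ x : M, TangentSpace 𝓘(ℝ, B) x [⋀^Fin (k + 1)]→L[ℝ] ℝ) (j : Jet1 P) :
    legendreForm L η j ∈ multimomentumForms P k j.pt := by
  intro w a b hab ha hb
  have h1 : (η (P.proj j.pt)) (fun i => P.dproj j.pt (w i)) = 0 :=
    (η (P.proj j.pt)).map_coord_zero a ha
  have h2 := alternatize_eq_zero (G := legendreCoeff L j (η (P.proj j.pt)))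
    (d := P.dproj j.pt) w hab ha hb
  change L j • (η (P.proj j.pt)) (fun i => P.dproj j.pt (w i)) + _ = 0
  rw [h1, smul_zero, zero_add]
  exact h2

/-- The extended Legendre map `J¹π → Λ^m_2 T^*E`. -/
def extLegendre (L : Jet1 P → ℝ)
    (η : ∀ x : M, TangentSpace 𝓘(ℝ, B) x [⋀^Fin (k + 1)]→L[ℝ] ℝ) (j : Jet1 P) :
    ExtMultimomentum P k :=
  ⟨j.pt, legendreForm L η j, legendreForm_mem L η j⟩

/-- The (restricted) Legendre map `FL : J¹π → J¹π^*`. -/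
def legendre (L : Jet1 P → ℝ)
    (η : ∀ x : M, TangentSpace 𝓘(ℝ, B) x [⋀^Fin (k + 1)]→L[ℝ] ℝ) (j : Jet1 P) :
    Multimomentum P k :=
  (extLegendre L η j).toMultimomentum

end Legendre

/-! ### Forms, multivector fields and connections on manifolds -/

section Calculus

variable {V N : Type*} [NormedAddCommGroup V] [NormedSpace ℝ V]
  [TopologicalSpace N] [ChartedSpace V N]

/-- The expression of a differential form of degree `d` in the preferred chart at `q₀`. -/
def formInChart {d : ℕ} (α : ∀ q : N, TangentSpace 𝓘(ℝ, V) q [⋀^Fin d]→L[ℝ] ℝ) (q₀ : N) (u : V) :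
    V [⋀^Fin d]→L[ℝ] ℝ :=
  (α ((chartAt V q₀).symm u)).compContinuousLinearMap
    (mfderiv 𝓘(ℝ, V) 𝓘(ℝ, V) (chartAt V q₀).symm u)

/-- The exterior derivative of a differential form on a manifold, computed at each point in the
preferred chart at that point. -/
def extD {d : ℕ} (α : ∀ q : N, TangentSpace 𝓘(ℝ, V) q [⋀^Fin d]→L[ℝ] ℝ) (q : N) :
    TangentSpace 𝓘(ℝ, V) q [⋀^Fin (d + 1)]→L[ℝ] ℝ :=
  (extDeriv (formInChart α q) (chartAt V q q)).compContinuousLinearMap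
    (mfderiv 𝓘(ℝ, V) 𝓘(ℝ, V) (chartAt V q) q)

/-- Volume forms: smooth, nowhere vanishing forms (of top degree, in the use below). -/
structure IsVolumeForm {d : ℕ} (η : ∀ q : N, TangentSpace 𝓘(ℝ, V) q [⋀^Fin d]→L[ℝ] ℝ) : Prop where
  smooth : ∀ q₀ : N, ContDiffOn ℝ ∞ (formInChart η q₀) (chartAt V q₀).target
  ne_zero : ∀ q : N, η q ≠ 0

/-- A field of `d`-forms is `1`-nondegenerate on `s` if `v ↦ i(v)Ω_q` is injective on `T_q N` for
all `q ∈ s`. -/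
def IsOneNondegenerateOn {d : ℕ} (s : Set N)
    (Ω : ∀ q : N, TangentSpace 𝓘(ℝ, V) q [⋀^Fin (d + 1)]→ₗ[ℝ] ℝ) : Prop :=
  ∀ q ∈ s, Function.Injective (Ω q).curryLeft

variable [IsManifold 𝓘(ℝ, V) ∞ N]

/-- A vector field on `N` is smooth on `U`. -/
def IsSmoothFieldOn (Y : ∀ q : N, TangentSpace 𝓘(ℝ, V) q) (U : Set N) : Prop :=
  ContMDiffOn 𝓘(ℝ, V) 𝓘(ℝ, V).tangent ∞ (fun q => (⟨q, Y q⟩ : TangentBundle 𝓘(ℝ, V) N)) U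

/-- An `m`-vector field is locally decomposable on `s`: near each point of `s` it is
`Y_1 ∧ ... ∧ Y_m` for smooth vector fields. -/
def IsLocallyDecomposableOn {m : ℕ} (s : Set N)
    (X : ∀ q : N, ⋀[ℝ]^m (TangentSpace 𝓘(ℝ, V) q)) : Prop :=
  ∀ q ∈ s, ∃ U : Set N, IsOpen U ∧ q ∈ U ∧ U ⊆ s ∧
    ∃ Y : Fin m → ∀ q : N, TangentSpace 𝓘(ℝ, V) q, (∀ i, IsSmoothFieldOn (Y i) U) ∧
      ∀ q' ∈ U, X q' = exteriorPower.ιMulti ℝ m fun i => Y i q'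

/-- An Ehresmann connection on the open set `s`, for a map `κ : N → M`: the horizontal lifts
`T_{κ q} M → T_q N` are sections of `Tκ`, and the horizontal part of every smooth vector field is
smooth. -/
structure IsEhresmannConnectionOn (κ : N → M) (s : Set N)
    (nabla : ∀ q : N, TangentSpace 𝓘(ℝ, B) (κ q) →L[ℝ] TangentSpace 𝓘(ℝ, V) q) : Prop where
  lift : ∀ q ∈ s, ∀ ξ, mfderiv 𝓘(ℝ, V) 𝓘(ℝ, B) κ q (nabla q ξ) = ξ
  smooth : ∀ (U : Set N) (Y : ∀ q : N, TangentSpace 𝓘(ℝ, V) q), IsOpen U → U ⊆ s →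
    IsSmoothFieldOn Y U →
      IsSmoothFieldOn (fun q => nabla q (mfderiv 𝓘(ℝ, V) 𝓘(ℝ, B) κ q (Y q))) U

end Calculus

section Algebra

variable {T : Type*} [AddCommGroup T] [Module ℝ T] {d : ℕ}

/-- The pairing `φ(X)` of a `d`-form with a `d`-vector. -/
def pairing (φ : T [⋀^Fin d]→ₗ[ℝ] ℝ) : ⋀[ℝ]^d T →ₗ[ℝ] ℝ :=
  exteriorPower.alternatingMapLinearEquiv φ

/-- The `1`-form `i(X)Ω`, for `X` of degree `d` and `Ω` of degree `d + 1`, with the convention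
`(i(X_1 ∧ ... ∧ X_d)Ω)(w) = Ω(X_1, ..., X_d, w)`. -/
def contract (Ω : T [⋀^Fin (d + 1)]→ₗ[ℝ] ℝ) (X : ⋀[ℝ]^d T) : T →ₗ[ℝ] ℝ :=
  (-1 : ℝ) ^ d • (LinearMap.applyₗ X ∘ₗ
    exteriorPower.alternatingMapLinearEquiv.toLinearMap ∘ₗ Ω.curryLeft)

theorem contract_ιMulti (Ω : T [⋀^Fin (d + 1)]→ₗ[ℝ] ℝ) (v : Fin d → T) (w : T) :
    contract Ω (exteriorPower.ιMulti ℝ d v) w = Ω (Fin.snoc v w) := by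
  have h := Ω.map_insertNth (Fin.last d) w v
  rw [Fin.insertNth_last'] at h
  rw [h]
  simp [contract]

/-- The wedge product `σ ∧ γ` of a `d`-form and a `1`-form. -/
def wedgeOne (σ : T [⋀^Fin d]→ₗ[ℝ] ℝ) (γ : T →ₗ[ℝ] ℝ) : T [⋀^Fin (d + 1)]→ₗ[ℝ] ℝ :=
  (-1 : ℝ) ^ d • AlternatingMap.alternatizeUncurryFin (γ.smulRight σ)

/-- The multivector `Z` of top degree with `η(Z) = 1`, for a volume `η`. -/
def dualMultivector (η : T [⋀^Fin d]→ₗ[ℝ] ℝ) : ⋀[ℝ]^d T :=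
  Classical.epsilon fun Z => pairing η Z = 1

theorem pairing_dualMultivector {η : T [⋀^Fin d]→ₗ[ℝ] ℝ} (h : η ≠ 0) :
    pairing η (dualMultivector η) = 1 := by
  refine Classical.epsilon_spec (p := fun Z => pairing η Z = 1) ?_
  have : ∃ v, η v ≠ 0 := by
    by_contra! h'
    exact h (AlternatingMap.ext h')
  obtain ⟨v, hv⟩ := this
  refine ⟨(η v)⁻¹ • exteriorPower.ιMulti ℝ d v, ?_⟩
  rw [map_smul, pairing, exteriorPower.alternatingMapLinearEquiv_apply_ιMulti, smul_eq_mul,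
    inv_mul_cancel₀ hv]

end Algebra

/-- The form `Ω^∇ = Ω - ω ∧ i(Y^∇_η)Ω`, where `ω` is the pullback of the volume form `η` of the base
and `Y^∇_η` is the horizontal `m`-vector with `η(Tκ Y^∇_η) = 1`. -/
def modifiedForm {V N : Type*} [NormedAddCommGroup V] [NormedSpace ℝ V] [TopologicalSpace N]
    [ChartedSpace V N] {m : ℕ} (η : ∀ x : M, TangentSpace 𝓘(ℝ, B) x [⋀^Fin m]→L[ℝ] ℝ)
    (κ : N → M) (Ω : ∀ q : N, TangentSpace 𝓘(ℝ, V) q [⋀^Fin (m + 1)]→L[ℝ] ℝ)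
    (nabla : ∀ q : N, TangentSpace 𝓘(ℝ, B) (κ q) →L[ℝ] TangentSpace 𝓘(ℝ, V) q) (q : N) :
    TangentSpace 𝓘(ℝ, V) q [⋀^Fin (m + 1)]→ₗ[ℝ] ℝ :=
  (Ω q).toAlternatingMap - wedgeOne
    ((η (κ q)).compContinuousLinearMap (mfderiv 𝓘(ℝ, V) 𝓘(ℝ, B) κ q)).toAlternatingMap
    (contract (Ω q).toAlternatingMap
      (exteriorPower.map m (nabla q).toLinearMap (dualMultivector (η (κ q)).toAlternatingMap)))

/-! ### Lagrangian and Hamiltonian systems -/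

section Systems

variable {k : ℕ}

/-- The Poincaré-Cartan `m`-form `Θ_L = i(𝒱)ℒ + ℒ` of the Lagrangian density `ℒ = L ω`, where `ω` is the
pullback of `η` to `J¹π`. -/
def thetaL (L : Jet1 P → ℝ) (η : ∀ x : M, TangentSpace 𝓘(ℝ, B) x [⋀^Fin (k + 1)]→L[ℝ] ℝ)
    (j : Jet1 P) : TangentSpace 𝓘(ℝ, (B × F) × (B →L[ℝ] F)) j [⋀^Fin (k + 1)]→L[ℝ] ℝ :=
  (legendreForm L η j).compContinuousLinearMap
    (mfderiv 𝓘(ℝ, (B × F) × (B →L[ℝ] F)) 𝓘(ℝ, B × F) Jet1.pt j)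

/-- The Poincaré-Cartan `(m+1)`-form `Ω_L = -dΘ_L`. -/
def omegaL (L : Jet1 P → ℝ) (η : ∀ x : M, TangentSpace 𝓘(ℝ, B) x [⋀^Fin (k + 1)]→L[ℝ] ℝ)
    (j : Jet1 P) : TangentSpace 𝓘(ℝ, (B × F) × (B →L[ℝ] F)) j [⋀^Fin (k + 1 + 1)]→L[ℝ] ℝ :=
  -extD (thetaL L η) j

/-- The Lagrangian system `(J¹π, Ω_L)` is regular: `Ω_L` is `1`-nondegenerate. -/
def IsRegularLagrangian (L : Jet1 P → ℝ)
    (η : ∀ x : M, TangentSpace 𝓘(ℝ, B) x [⋀^Fin (k + 1)]→L[ℝ] ℝ) : Prop :=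
  IsOneNondegenerateOn univ fun j => (omegaL L η j).toAlternatingMap

/-- The vertical endomorphism `𝒱` of the jet bundle: `verticalEndo j β Z` is the vector tangent at `j`
to the fibre of `π¹` in the direction `β ⊗ (Tπ¹ Z - j(Tπ̄¹ Z))`. In natural coordinates
`𝒱 = (dy^A - v^A_α dx^α) ⊗ ∂/∂v^A_β ⊗ ∂/∂x^β`. (Note that `j.shift 0 = j`.) -/
def verticalEndo (j : Jet1 P) (β : B →L[ℝ] ℝ) :
    TangentSpace 𝓘(ℝ, (B × F) × (B →L[ℝ] F)) j →L[ℝ]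
      TangentSpace 𝓘(ℝ, (B × F) × (B →L[ℝ] F)) j :=
  let dpt : (B × F) × (B →L[ℝ] F) →L[ℝ] B × F :=
    mfderiv 𝓘(ℝ, (B × F) × (B →L[ℝ] F)) 𝓘(ℝ, B × F) Jet1.pt j
  let dproj : B × F →L[ℝ] B := P.dproj j.pt
  let lin : B →L[ℝ] B × F := j.lin
  let contact : B × F →L[ℝ] B × F := ContinuousLinearMap.id ℝ (B × F) - lin.comp dproj
  let vlift : (B →L[ℝ] B × F) →L[ℝ] (B × F) × (B →L[ℝ] F) :=
    mfderiv 𝓘(ℝ, B →L[ℝ] B × F) 𝓘(ℝ, (B × F) × (B →L[ℝ] F)) 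
      (fun A : B →L[ℝ] B × F => j.shift A) 0
  vlift.comp ((ContinuousLinearMap.smulRightL ℝ B (B × F) β).comp (contact.comp dpt))

/-- An `m`-vector field `X` on `J¹π` is semi-holonomic if `i(X)𝒱 = 0`: the interior products of `X` with
all the components `l ∘ 𝒱(·, β)` of `𝒱` vanish. -/
def IsSemiHolonomic
    (X : ∀ j : Jet1 P, ⋀[ℝ]^(k + 1) (TangentSpace 𝓘(ℝ, (B × F) × (B →L[ℝ] F)) j)) : Prop :=
  ∀ (j : Jet1 P) (β : B →L[ℝ] ℝ)
    (l : Module.Dual ℝ (TangentSpace 𝓘(ℝ, (B × F) × (B →L[ℝ] F)) j)),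
    CliffordAlgebra.contractLeft (Q := 0) (l ∘ₗ (verticalEndo j β).toLinearMap)
      (X j : ExteriorAlgebra ℝ (TangentSpace 𝓘(ℝ, (B × F) × (B →L[ℝ] F)) j)) = 0

/-- Euler–Lagrange `m`-vector fields on `J¹π`, normalized by `i(X)ω = 1`: locally decomposable,
semi-holonomic solutions of `i(X)Ω_L = 0`. -/
structure IsEulerLagrange (L : Jet1 P → ℝ)
    (η : ∀ x : M, TangentSpace 𝓘(ℝ, B) x [⋀^Fin (k + 1)]→L[ℝ] ℝ)
    (X : ∀ j : Jet1 P, ⋀[ℝ]^(k + 1) (TangentSpace 𝓘(ℝ, (B × F) × (B →L[ℝ] F)) j)) : Prop where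
  decomposable : IsLocallyDecomposableOn univ X
  transverse : ∀ j, pairing ((η j.toBase).compContinuousLinearMap
    (mfderiv 𝓘(ℝ, (B × F) × (B →L[ℝ] F)) 𝓘(ℝ, B) Jet1.toBase j)).toAlternatingMap (X j) = 1
  semiHolonomic : IsSemiHolonomic X
  equation : ∀ j, contract (omegaL L η j).toAlternatingMap (X j) = 0

variable [FiniteDimensional ℝ B] [FiniteDimensional ℝ F]

/-- The pullback `h^*Θ` of the tautological form of `Λ^m_2 T^*E`, whose value at `(y, α)` is the pullback
of `α` by the projection to `E`. -/
def thetaH (h : Multimomentum P k → ExtMultimomentum P k) (q : Multimomentum P k) :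
    TangentSpace 𝓘(ℝ, (B × F) × (F →L[ℝ] B [⋀^Fin k]→L[ℝ] ℝ)) q [⋀^Fin (k + 1)]→L[ℝ] ℝ :=
  ((h q).form : TangentSpace 𝓘(ℝ, B × F) (h q).pt [⋀^Fin (k + 1)]→L[ℝ] ℝ).compContinuousLinearMap
    (mfderiv 𝓘(ℝ, (B × F) × (F →L[ℝ] B [⋀^Fin k]→L[ℝ] ℝ)) 𝓘(ℝ, B × F) (fun q => (h q).pt) q)

/-- The Hamilton-Cartan form `Ω_h = h^*Ω = -d(h^*Θ)` of a section `h` of `Λ^m_2 T^*E → J¹π^*`. -/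
def omegaH (h : Multimomentum P k → ExtMultimomentum P k) (q : Multimomentum P k) :
    TangentSpace 𝓘(ℝ, (B × F) × (F →L[ℝ] B [⋀^Fin k]→L[ℝ] ℝ)) q [⋀^Fin (k + 1 + 1)]→L[ℝ] ℝ :=
  -extD (thetaH h) q

/-- The Hamiltonian section `h` associated with `L`: the extended Legendre map composed with the inverse
of the Legendre map, on a set where the latter restricts to a diffeomorphism `Φ`. -/
def hamiltonianSection (L : Jet1 P → ℝ)
    (η : ∀ x : M, TangentSpace 𝓘(ℝ, B) x [⋀^Fin (k + 1)]→L[ℝ] ℝ)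
    (Φ : PartialDiffeomorph 𝓘(ℝ, (B × F) × (B →L[ℝ] F))
      𝓘(ℝ, (B × F) × (F →L[ℝ] B [⋀^Fin k]→L[ℝ] ℝ)) (Jet1 P) (Multimomentum P k) ∞)
    (q : Multimomentum P k) : ExtMultimomentum P k :=
  extLegendre L η (Φ.symm q)

/-- The connection `∇^*` on the multimomentum bundle is transported from `∇` by the Legendre map, over
`FL(s)`: `∇^*_{FL(j)} = T FL ∘ ∇_j` for all `j ∈ s`. -/
def IsTransportedOn (L : Jet1 P → ℝ)
    (η : ∀ x : M, TangentSpace 𝓘(ℝ, B) x [⋀^Fin (k + 1)]→L[ℝ] ℝ) (s : Set (Jet1 P))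
    (nabla : ∀ j : Jet1 P,
      TangentSpace 𝓘(ℝ, B) j.toBase →L[ℝ] TangentSpace 𝓘(ℝ, (B × F) × (B →L[ℝ] F)) j)
    (nablaStar : ∀ q : Multimomentum P k, TangentSpace 𝓘(ℝ, B) q.toBase →L[ℝ]
      TangentSpace 𝓘(ℝ, (B × F) × (F →L[ℝ] B [⋀^Fin k]→L[ℝ] ℝ)) q) : Prop :=
  ∀ j ∈ s, ∀ ξ : TangentSpace 𝓘(ℝ, B) j.toBase,
    nablaStar (legendre L η j) ξ = mfderiv 𝓘(ℝ, (B × F) × (B →L[ℝ] F))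
      𝓘(ℝ, (B × F) × (F →L[ℝ] B [⋀^Fin k]→L[ℝ] ℝ)) (legendre L η) j (nabla j ξ)

/-- Hamilton-De Donder-Weyl `m`-vector fields on the open set `s` of `J¹π^*`, normalized by
`i(X)ω^* = 1`: locally decomposable solutions of `i(X)Ω_h = 0`. -/
structure IsHamiltonDeDonderWeylOn (h : Multimomentum P k → ExtMultimomentum P k)
    (η : ∀ x : M, TangentSpace 𝓘(ℝ, B) x [⋀^Fin (k + 1)]→L[ℝ] ℝ) (s : Set (Multimomentum P k))
    (X : ∀ q : Multimomentum P k,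
      ⋀[ℝ]^(k + 1) (TangentSpace 𝓘(ℝ, (B × F) × (F →L[ℝ] B [⋀^Fin k]→L[ℝ] ℝ)) q)) : Prop where
  decomposable : IsLocallyDecomposableOn s X
  transverse : ∀ q ∈ s, pairing ((η q.toBase).compContinuousLinearMap
    (mfderiv 𝓘(ℝ, (B × F) × (F →L[ℝ] B [⋀^Fin k]→L[ℝ] ℝ)) 𝓘(ℝ, B)
      Multimomentum.toBase q)).toAlternatingMap (X q) = 1
  equation : ∀ q ∈ s, contract (omegaH h q).toAlternatingMap (X q) = 0

end Systems

end Setup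

end Multisymp

end

open Multisymp

noncomputable section

namespace Multisymp

/-! ### Smoothness of maps into spaces of forms and of linear maps -/

section AlternatingForms

variable {V X : Type*} [NormedAddCommGroup V] [NormedSpace ℝ V] [FiniteDimensional ℝ V]
  [NormedAddCommGroup X] [NormedSpace ℝ X] {d : ℕ}

/-! In natural coordinates z = (x, y, v) on the jet bundle, let N be the volume of the base and p =
`mom` the momenta ∂L/∂v, regarded via N as k-forms on the base with values in the dual of the fibre,
where m = k + 1. The Poincaré-Cartan form is Θ = L N + p ∧ (dy - v dx) (`thetaLoc`). When Θ is
differentiated, the term (∂L/∂v) dv N cancels, by Cramer's rule, against the variation of v inside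
dy - v dx (`fderiv_thetaLoc_apply`). Hence fibre velocities enter dΘ only through dp, and ∂p/∂v is
the fibre Hessian of L followed by the linear isomorphism `momMap`.

Local diffeomorphism. If a is in the kernel of the Hessian, then (0, 0, a) is in the kernel of dΘ,
so regularity makes the Hessian invertible (`hess_injective_of_nondegenerate`). In coordinates the
Legendre map is (x, y, v) ↦ (x, y, p), so its differential is bijective and the inverse function
theorem applies.

Nondegeneracy of the modified forms. The form ω ∧ γ vanishes as soon as two arguments are vertical
over M, whatever the 1-form γ. On such arguments a kernel vector W of Ω - ω ∧ γ is therefore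
annihilated by Ω itself, which there is an expression in dp alone (`extDeriv_thetaLoc_cons_cons`).
Since dp takes every value on fibre directions, these equations force the base, fibre and jet
components of W to vanish in turn (`eq_zero_of_extDeriv_thetaLoc_vertical`). The base component is
detected by placing W beside two vertical vectors, which needs m + 1 ≥ 3; nonzero vertical vectors
exist because regularity excludes zero-dimensional fibres.

Euler-Lagrange fields. On a semi-holonomic lift ξ ↦ (ξ, v ξ, G ξ) the contact terms drop out, and
i(X)Ω = 0 becomes one covector equation, affine in G (`IsSemiHolonomicLift.equation_iff`). Inverting
the Hessian gives a smooth local solution `elSol`. The solutions over a given jet form an affine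
space, so a partition of unity on E, pulled back to the jets, glues local solutions to a global
connection; its horizontal m-vector is the required field.

Hamiltonian side. On U^* the form h^*Θ is the pullback of Θ_L by the inverse of the Legendre map.
The exterior derivative commutes with pullbacks, so nondegeneracy, connections and solutions are all
carried over by the tangent isomorphisms (`omegaH_hamiltonianSection`). -/

instance finiteDimensional_continuousAlternatingMap :
    FiniteDimensional ℝ (V [⋀^Fin d]→L[ℝ] ℝ) :=
  Module.Finite.of_injective
    ({ toFun := fun f => f.toAlternatingMap.toMultilinearMap
       map_add' := fun _ _ => rfl
       map_smul' := fun _ _ => rfl } :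
      V [⋀^Fin d]→L[ℝ] ℝ →ₗ[ℝ] MultilinearMap ℝ (fun _ : Fin d => V) ℝ)
    (fun _ _ h => ContinuousAlternatingMap.ext fun v => congrArg (fun φ => φ v) h)

/-- A map into a space of forms is smooth if all its evaluations are. -/
theorem contDiffAt_alternating {n : WithTop ℕ∞} {f : X → V [⋀^Fin d]→L[ℝ] ℝ} {x : X}
    (h : ∀ v, ContDiffAt ℝ n (fun z => f z v) x) : ContDiffAt ℝ n f x := by
  -- Evaluation on tuples of basis vectors embeds the forms linearly into a finite dimensional
  -- function space. A linear left inverse of this embedding recovers `f` from its smooth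
  -- evaluations.
  let b := Module.finBasis ℝ V
  let ev : (V [⋀^Fin d]→L[ℝ] ℝ) →ₗ[ℝ] ((Fin d → Fin (Module.finrank ℝ V)) → ℝ) :=
    { toFun := fun f s => f fun i => b (s i)
      map_add' := fun _ _ => rfl
      map_smul' := fun _ _ => rfl }
  have hinj : Function.Injective ev := by
    intro f g hfg
    have : f.toAlternatingMap = g.toAlternatingMap :=
      b.ext_alternating fun v _ => congrFun hfg v
    exact ContinuousAlternatingMap.ext fun v => congrArg (fun φ => φ v) this
  obtain ⟨r, hr⟩ := ev.exists_leftInverse_of_injective (LinearMap.ker_eq_bot.2 hinj)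
  have h2 : ContDiffAt ℝ n (fun z => ev (f z)) x := contDiffAt_pi.2 fun s => h _
  have h3 : f = fun z => LinearMap.toContinuousLinearMap r (ev (f z)) := by
    funext z
    exact (congrArg (fun φ => φ (f z)) hr).symm
  rw [h3]
  exact (ContinuousLinearMap.contDiff _).contDiffAt.comp x h2

theorem contDiffAt_clm {W : Type*} [NormedAddCommGroup W] [NormedSpace ℝ W]
    {n : WithTop ℕ∞} {f : X → V →L[ℝ] W} {x : X}
    (h : ∀ v, ContDiffAt ℝ n (fun z => f z v) x) : ContDiffAt ℝ n f x := by
  let b := Module.finBasis ℝ V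
  let e : (V →L[ℝ] W) →L[ℝ] (Fin (Module.finrank ℝ V) → W) :=
    ContinuousLinearMap.pi fun i => ContinuousLinearMap.apply ℝ W (b i)
  let r : (Fin (Module.finrank ℝ V) → W) →L[ℝ] (V →L[ℝ] W) :=
    ∑ i, (ContinuousLinearMap.smulRightL ℝ V W (LinearMap.toContinuousLinearMap (b.coord i))).comp
      (ContinuousLinearMap.proj i)
  have h2 : ContDiffAt ℝ n (fun z => e (f z)) x := contDiffAt_pi.2 fun s => h _
  have h3 : f = fun z => r (e (f z)) := by
    funext z
    ext v
    simp only [r, e, sum_apply, ContinuousLinearMap.comp_apply]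
    conv_lhs => rw [← b.sum_repr v, map_sum]
    simp
  rw [h3]
  exact r.contDiff.contDiffAt.comp x h2

end AlternatingForms

/-! ### Linear algebra of forms of top degree -/

section TopForms

variable {B : Type*} [NormedAddCommGroup B] [NormedSpace ℝ B] {k : ℕ}

theorem alternating_eq_zero_of_finrank_lt [FiniteDimensional ℝ B] {W : Type*}
    [AddCommGroup W] [Module ℝ W] {d : ℕ} (hd : Module.finrank ℝ B < d)
    (f : B [⋀^Fin d]→ₗ[ℝ] W) : f = 0 := by
  ext v
  refine f.map_linearDependent v fun hv => ?_
  have := hv.fintype_card_le_finrank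
  simp at this
  omega

theorem int_neg_one_pow_smul {W : Type*} [AddCommGroup W] [Module ℝ W] (l : ℕ) (x : W) :
    (-1 : ℤ) ^ l • x = (-1 : ℝ) ^ l • x := by
  rw [← Int.cast_smul_eq_zsmul ℝ]
  push_cast
  rfl

/-- Cramer's rule. -/
theorem cramer [FiniteDimensional ℝ B] (hdim : Module.finrank ℝ B = k + 1)
    (n : B [⋀^Fin (k + 1)]→L[ℝ] ℝ) (ξ : Fin (k + 1) → B) (b : B) :
    ∑ l : Fin (k + 1), (-1 : ℝ) ^ (l : ℕ) • n (Matrix.vecCons b (l.removeNth ξ)) • ξ l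
      = n ξ • b := by
  -- The alternation of n ⊗ id is a `B`-valued form of degree dim B + 1, hence zero. Its expansion
  -- on (b, ξ_1, ..., ξ_m) is the formula.
  let g : B →ₗ[ℝ] B [⋀^Fin (k + 1)]→ₗ[ℝ] B :=
    { toFun := fun x => ((LinearMap.id (R := ℝ) (M := ℝ)).smulRight x).compAlternatingMap
        n.toAlternatingMap
      map_add' := fun x y => by ext; simp
      map_smul' := fun c x => by ext; simp [smul_comm c] }
  have h0 : AlternatingMap.alternatizeUncurryFin g = 0 :=
    alternating_eq_zero_of_finrank_lt (by omega) _
  have h1 := congrArg (fun f => f (Matrix.vecCons b ξ)) h0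
  simp only [AlternatingMap.alternatizeUncurryFin_apply, AlternatingMap.zero_apply] at h1
  rw [Fin.sum_univ_succ] at h1
  have h2 : ∀ l : Fin (k + 1), (l.succ.removeNth (Matrix.vecCons b ξ) : Fin (k + 1) → B)
      = Matrix.vecCons b (l.removeNth ξ) := by
    intro l
    funext i
    refine Fin.cases ?_ (fun i => ?_) i
    · simp [Fin.removeNth]
    · simp [Fin.removeNth]
  have h3 : ∀ x v, g x v = n v • x := fun x v => rfl
  have h4 : ((0 : Fin (k + 1 + 1)).removeNth (Matrix.vecCons b ξ) : Fin (k + 1) → B) = ξ := by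
    funext i; simp [Fin.removeNth]
  simp only [h2, h3, h4, int_neg_one_pow_smul, Fin.val_succ, Fin.val_zero, pow_zero,
    Matrix.cons_val_zero, Matrix.cons_val_succ, pow_succ, mul_neg, mul_one, one_smul, neg_smul,
    Finset.sum_neg_distrib] at h1
  exact (sub_eq_zero.1 ((sub_eq_add_neg _ _).trans h1)).symm

theorem exists_ne_zero_of_form_ne_zero {n : B [⋀^Fin (k + 1)]→L[ℝ] ℝ} (hn : n ≠ 0) :
    ∃ v, n v ≠ 0 := by
  by_contra! h
  exact hn (ContinuousAlternatingMap.ext h)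

/-- A volume has no kernel. -/
theorem eq_zero_of_volume_cons_eq_zero [FiniteDimensional ℝ B] (hdim : Module.finrank ℝ B = k + 1)
    {n : B [⋀^Fin (k + 1)]→L[ℝ] ℝ} (hn : n ≠ 0) {b : B}
    (h : ∀ v : Fin k → B, n (Matrix.vecCons b v) = 0) : b = 0 := by
  obtain ⟨v, hv⟩ := exists_ne_zero_of_form_ne_zero hn
  have := cramer hdim n v b
  simp only [h, zero_smul, smul_zero, Finset.sum_const_zero] at this
  exact (smul_eq_zero.1 this.symm).resolve_left hv

/-- Two forms of top degree are proportional. -/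
theorem topForm_mul_comm {W : Type*} [AddCommGroup W] [Module ℝ W]
    (hdim : Module.finrank ℝ B = k + 1) (n : B [⋀^Fin (k + 1)]→ₗ[ℝ] ℝ)
    (g : B [⋀^Fin (k + 1)]→ₗ[ℝ] W) (v w : Fin (k + 1) → B) : n v • g w = n w • g v := by
  -- If `v` is a basis, a top form is determined by its values on permutations of `v`, where both
  -- sides pick up the same sign. If `v` is dependent, both sides vanish.
  by_cases hv : LinearIndependent ℝ v
  · let b := basisOfLinearIndependentOfCardEqFinrank hv (by simp [hdim])
    have hb : (b : Fin (k + 1) → B) = v := by simp [b]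
    have h1 : n v • g = (LinearMap.toSpanSingleton ℝ W (g v)).compAlternatingMap n := by
      refine b.ext_alternating fun s hs => ?_
      have hs' : Function.Bijective s := Finite.injective_iff_bijective.1 hs
      let σ : Equiv.Perm (Fin (k + 1)) := Equiv.ofBijective s hs'
      have hg := g.map_perm v σ
      have hn := n.map_perm v σ
      change n v • g (fun i => b (s i)) = n (fun i => b (s i)) • g v
      rw [hb]
      change n v • g (v ∘ σ) = n (v ∘ σ) • g v
      rw [hg, hn, smul_comm, smul_assoc]
    exact congrArg (fun f => f w) h1
  · rw [n.map_linearDependent v hv, g.map_linearDependent v hv, zero_smul, smul_zero]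

/-- The complementary form of Cramer's rule. -/
theorem cramer_form (hdim : Module.finrank ℝ B = k + 1) {n : B [⋀^Fin (k + 1)]→L[ℝ] ℝ}
    (hn : n ≠ 0) (β : B [⋀^Fin k]→L[ℝ] ℝ) (b : Fin (k + 1) → B) (ξ : Fin k → B) :
    ∑ l : Fin (k + 1), (-1 : ℝ) ^ (l : ℕ) * (n (Matrix.vecCons (b l) ξ) * β (l.removeNth b))
      = n b * β ξ := by
  -- The left side is the alternation of n(·, ξ) ⊗ β evaluated at `b`, a form of top degree and
  -- hence proportional to `n`. The factor is found by evaluating at a tuple (x, ξ), where only the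
  -- first term survives.
  let g : B →ₗ[ℝ] B [⋀^Fin k]→ₗ[ℝ] ℝ :=
    (n.curryLeft.flipAlternating ξ).toLinearMap.smulRight β.toAlternatingMap
  have hg : ∀ b : Fin (k + 1) → B, AlternatingMap.alternatizeUncurryFin g b =
      ∑ l : Fin (k + 1), (-1 : ℝ) ^ (l : ℕ) *
        (n (Matrix.vecCons (b l) ξ) * β (l.removeNth b)) := by
    intro b
    rw [AlternatingMap.alternatizeUncurryFin_apply]
    refine Finset.sum_congr rfl fun l _ => ?_
    rw [zsmul_eq_mul]
    push_cast
    rfl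
  rw [← hg]
  by_cases hξ : ∃ x, n (Matrix.vecCons x ξ) ≠ 0
  · obtain ⟨x, hx⟩ := hξ
    have h1 := topForm_mul_comm hdim n.toAlternatingMap (AlternatingMap.alternatizeUncurryFin g)
      (Matrix.vecCons x ξ) b
    have h2 : AlternatingMap.alternatizeUncurryFin g (Matrix.vecCons x ξ) =
        n (Matrix.vecCons x ξ) * β ξ := by
      rw [hg, Fin.sum_univ_succ, Finset.sum_eq_zero]
      · simp only [Fin.val_zero, pow_zero, one_mul, add_zero, Matrix.cons_val_zero]
        congr 2
      · intro l _
        have : n (Matrix.vecCons (ξ l) ξ) = 0 :=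
          n.map_eq_zero_of_eq _ (i := 0) (j := l.succ) (by simp) (Fin.succ_ne_zero l).symm
        simp [this]
    rw [h2] at h1
    refine mul_left_cancel₀ hx ?_
    have h3 : n (Matrix.vecCons x ξ) * (AlternatingMap.alternatizeUncurryFin g) b =
      n b * (n (Matrix.vecCons x ξ) * β ξ) := h1
    rw [h3]; ring
  · push Not at hξ
    -- If n(x, ξ) = 0 for all x, then ξ is linearly dependent: otherwise it would extend to a basis,
    -- on which `n` does not vanish.
    have h1 : β ξ = 0 := by
      refine β.toAlternatingMap.map_linearDependent ξ fun hli => ?_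
      have hlt : Module.finrank ℝ (Submodule.span ℝ (range ξ)) < Module.finrank ℝ B := by
        rw [finrank_span_eq_card hli]; simp [hdim]
      obtain ⟨x, hx⟩ : ∃ x, x ∉ Submodule.span ℝ (range ξ) := by
        by_contra! h
        rw [Submodule.eq_top_iff'.2 h, finrank_top] at hlt
        exact lt_irrefl _ hlt
      have hli' : LinearIndependent ℝ (Fin.cons x ξ : Fin (k + 1) → B) :=
        linearIndependent_finCons.2 ⟨hli, hx⟩
      let c := basisOfLinearIndependentOfCardEqFinrank hli' (by simp [hdim])
      have hc : (c : Fin (k + 1) → B) = Fin.cons x ξ := by simp [c]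
      have h2 := (AlternatingMap.map_basis_ne_zero_iff c n.toAlternatingMap).2 (fun h => hn
        (ContinuousAlternatingMap.ext fun v => congrArg (fun f => f v) h))
      rw [hc] at h2
      exact h2 (hξ x)
    rw [h1, mul_zero, hg]
    simp [hξ]

end TopForms

/-! ### The Poincaré-Cartan form and the Legendre map in coordinates -/

section Local

set_option maxSynthPendingDepth 3

variable {B F : Type*} [NormedAddCommGroup B] [NormedSpace ℝ B]
  [NormedAddCommGroup F] [NormedSpace ℝ F] {k : ℕ}

/-- The momentum map of a volume `n`: `λ ↦ (u ↦ (ξ ↦ λ (n(·, ξ) ⊗ u)))`. -/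
def momMap (n : B [⋀^Fin (k + 1)]→L[ℝ] ℝ) (lam : (B →L[ℝ] F) →L[ℝ] ℝ) :
    F →L[ℝ] B [⋀^Fin k]→L[ℝ] ℝ :=
  postcompAlternating
    ((ContinuousLinearMap.compL ℝ (B →L[ℝ] ℝ) (B →L[ℝ] F) ℝ lam).comp
      (ContinuousLinearMap.smulRightL ℝ B F).flip)
    n.curryLeft.flipAlternating

theorem momMap_apply (n : B [⋀^Fin (k + 1)]→L[ℝ] ℝ) (lam : (B →L[ℝ] F) →L[ℝ] ℝ) (u : F)
    (ξ : Fin k → B) :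
    momMap n lam u ξ = lam ((n.curryLeft.flipAlternating ξ).smulRight u) := rfl

theorem curryLeft_flipAlternating_apply (n : B [⋀^Fin (k + 1)]→L[ℝ] ℝ) (ξ : Fin k → B) (b : B) :
    n.curryLeft.flipAlternating ξ b = n (Matrix.vecCons b ξ) := rfl

/-- The inverse of the momentum map. -/
theorem clm_eq_sum_smulRight [FiniteDimensional ℝ B] (hdim : Module.finrank ℝ B = k + 1)
    (n : B [⋀^Fin (k + 1)]→L[ℝ] ℝ) (b : Fin (k + 1) → B) (A : B →L[ℝ] F) :
    ∑ l : Fin (k + 1), (-1 : ℝ) ^ (l : ℕ) •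
      (n.curryLeft.flipAlternating (l.removeNth b)).smulRight (A (b l)) = n b • A := by
  ext x
  have h := congrArg A (cramer hdim n b x)
  simp only [map_sum, map_smul] at h
  simpa [sum_apply, curryLeft_flipAlternating_apply] using h

/-- By `clm_eq_sum_smulRight` the maps n(·, ξ) ⊗ u span all linear maps from `B` to `F`, and the
momenta are the values of `lam` on them. -/
theorem momMap_injective [FiniteDimensional ℝ B] (hdim : Module.finrank ℝ B = k + 1)
    {n : B [⋀^Fin (k + 1)]→L[ℝ] ℝ} (hn : n ≠ 0) {lam : (B →L[ℝ] F) →L[ℝ] ℝ}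
    (h : momMap n lam = 0) : lam = 0 := by
  obtain ⟨b, hb⟩ := exists_ne_zero_of_form_ne_zero hn
  ext A
  have h1 := congrArg lam (clm_eq_sum_smulRight hdim n b A)
  rw [map_sum, map_smul, Finset.sum_eq_zero] at h1
  · exact (smul_eq_zero.1 h1.symm).resolve_left hb
  · intro l _
    rw [map_smul, ← momMap_apply, h]
    simp

/-- The preimage is dictated by `clm_eq_sum_smulRight`: expand A in terms n(·, ξ) ⊗ u and replace
the value of `lam` on each by the prescribed momentum. That it has the right momenta is
`cramer_form`. -/
theorem momMap_surjective [FiniteDimensional ℝ B] [FiniteDimensional ℝ F]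
    (hdim : Module.finrank ℝ B = k + 1)
    {n : B [⋀^Fin (k + 1)]→L[ℝ] ℝ} (hn : n ≠ 0) (q : F →L[ℝ] B [⋀^Fin k]→L[ℝ] ℝ) :
    ∃ lam, momMap n lam = q := by
  obtain ⟨b, hb⟩ := exists_ne_zero_of_form_ne_zero hn
  let lam : (B →L[ℝ] F) →ₗ[ℝ] ℝ := (n b)⁻¹ • ∑ l : Fin (k + 1), (-1 : ℝ) ^ (l : ℕ) •
    { toFun := fun A => q (A (b l)) (l.removeNth b)
      map_add' := fun A A' => by simp
      map_smul' := fun c A => by simp }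
  refine ⟨LinearMap.toContinuousLinearMap lam, ?_⟩
  ext u ξ
  rw [momMap_apply]
  have h := cramer_form hdim hn (q u) b ξ
  have hlam : ∀ A, lam A = (n b)⁻¹ * ∑ l : Fin (k + 1), (-1 : ℝ) ^ (l : ℕ) *
      q (A (b l)) (l.removeNth b) := fun A => by
    simp only [lam, LinearMap.smul_apply, LinearMap.sum_apply]
    rfl
  refine (hlam _).trans ?_
  rw [← inv_mul_cancel_left₀ hb (q u ξ), ← h]
  congr 1
  refine Finset.sum_congr rfl fun i _ => ?_
  rw [ContinuousLinearMap.smulRight_apply, map_smul, curryLeft_flipAlternating_apply]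
  rfl

/-- The derivative along the fibres. -/
def dvert (l : (B × F) × (B →L[ℝ] F) → ℝ) (z : (B × F) × (B →L[ℝ] F)) : (B →L[ℝ] F) →L[ℝ] ℝ :=
  (fderiv ℝ l z).comp (ContinuousLinearMap.inr ℝ (B × F) (B →L[ℝ] F))

/-- The Hessian along the fibres. -/
def hess (l : (B × F) × (B →L[ℝ] F) → ℝ) (z : (B × F) × (B →L[ℝ] F)) :
    (B →L[ℝ] F) →L[ℝ] (B →L[ℝ] F) →L[ℝ] ℝ :=
  (fderiv ℝ (dvert l) z).comp (ContinuousLinearMap.inr ℝ (B × F) (B →L[ℝ] F))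

/-- The Legendre map in coordinates. -/
def mom (l : (B × F) × (B →L[ℝ] F) → ℝ) (N : B → B [⋀^Fin (k + 1)]→L[ℝ] ℝ)
    (z : (B × F) × (B →L[ℝ] F)) : F →L[ℝ] B [⋀^Fin k]→L[ℝ] ℝ :=
  momMap (N z.1.1) (dvert l z)

/-- The Poincaré-Cartan form in coordinates. -/
def thetaLoc (l : (B × F) × (B →L[ℝ] F) → ℝ) (N : B → B [⋀^Fin (k + 1)]→L[ℝ] ℝ)
    (z : (B × F) × (B →L[ℝ] F)) : ((B × F) × (B →L[ℝ] F)) [⋀^Fin (k + 1)]→L[ℝ] ℝ :=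
  (l z • (N z.1.1).compContinuousLinearMap (ContinuousLinearMap.fst ℝ B F) +
    ContinuousAlternatingMap.alternatizeUncurryFin
      ((ContinuousAlternatingMap.compContinuousLinearMapCLM (ContinuousLinearMap.fst ℝ B F)).comp
        ((mom l N z).comp (ContinuousLinearMap.snd ℝ B F -
          z.2.comp (ContinuousLinearMap.fst ℝ B F)) : B × F →L[ℝ] B [⋀^Fin k]→L[ℝ] ℝ) :
        B × F →L[ℝ] (B × F) [⋀^Fin k]→L[ℝ] ℝ)).compContinuousLinearMap
    (ContinuousLinearMap.fst ℝ (B × F) (B →L[ℝ] F))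

theorem thetaLoc_apply (l : (B × F) × (B →L[ℝ] F) → ℝ) (N : B → B [⋀^Fin (k + 1)]→L[ℝ] ℝ)
    (z : (B × F) × (B →L[ℝ] F)) (W : Fin (k + 1) → (B × F) × (B →L[ℝ] F)) :
    thetaLoc l N z W = l z * N z.1.1 (fun i => (W i).1.1) + ∑ i : Fin (k + 1), (-1 : ℝ) ^ (i : ℕ) *
      mom l N z ((W i).1.2 - z.2 (W i).1.1) (i.removeNth fun i => (W i).1.1) := by
  change l z * N z.1.1 (fun i => (W i).1.1) +
    ContinuousAlternatingMap.alternatizeUncurryFin _ (fun i => (W i).1) = _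
  rw [ContinuousAlternatingMap.alternatizeUncurryFin_apply]
  congr 1
  refine Finset.sum_congr rfl fun i _ => ?_
  rw [int_neg_one_pow_smul]
  rfl

variable {l : (B × F) × (B →L[ℝ] F) → ℝ} {N : B → B [⋀^Fin (k + 1)]→L[ℝ] ℝ}
  {z : (B × F) × (B →L[ℝ] F)}

theorem contDiffAt_dvert (hl : ContDiffAt ℝ ∞ l z) : ContDiffAt ℝ ∞ (dvert l) z :=
  (hl.fderiv_right (m := ∞) (by simp)).clm_comp contDiffAt_const

theorem contDiffAt_hess (hl : ContDiffAt ℝ ∞ l z) : ContDiffAt ℝ ∞ (hess l) z :=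
  ((contDiffAt_dvert hl).fderiv_right (m := ∞) (by simp)).clm_comp contDiffAt_const

theorem contDiffAt_evalBase (hN : ContDiffAt ℝ ∞ N z.1.1) (v : Fin (k + 1) → B) :
    ContDiffAt ℝ ∞ (fun z : (B × F) × (B →L[ℝ] F) => N z.1.1 v) z :=
  (ContinuousAlternatingMap.apply ℝ B ℝ v).contDiff.contDiffAt.comp z
    (hN.comp z (contDiff_fst.comp contDiff_fst).contDiffAt)

variable [FiniteDimensional ℝ B]

theorem contDiffAt_smulRight_volume (hN : ContDiffAt ℝ ∞ N z.1.1) (u : F) (ξ : Fin k → B) :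
    ContDiffAt ℝ ∞ (fun x : B => ((N x).curryLeft.flipAlternating ξ).smulRight u) z.1.1 := by
  refine ContDiffAt.smulRight (contDiffAt_clm fun b => ?_) contDiffAt_const
  exact (ContinuousAlternatingMap.apply ℝ B ℝ (Matrix.vecCons b ξ)).contDiff.contDiffAt.comp _ hN

variable [FiniteDimensional ℝ F]

theorem contDiffAt_mom (hl : ContDiffAt ℝ ∞ l z) (hN : ContDiffAt ℝ ∞ N z.1.1) :
    ContDiffAt ℝ ∞ (mom l N) z := by
  refine contDiffAt_clm fun u => contDiffAt_alternating fun ξ => ?_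
  exact (contDiffAt_dvert hl).clm_apply
    (ContDiffAt.comp (f := fun z : (B × F) × (B →L[ℝ] F) => z.1.1) z
      (contDiffAt_smulRight_volume hN u ξ) (contDiff_fst.comp contDiff_fst).contDiffAt)

theorem contDiffAt_thetaLoc (hl : ContDiffAt ℝ ∞ l z) (hN : ContDiffAt ℝ ∞ N z.1.1) :
    ContDiffAt ℝ ∞ (thetaLoc l N) z := by
  refine contDiffAt_alternating fun W => ?_
  simp only [thetaLoc_apply]
  refine (hl.mul (contDiffAt_evalBase hN _)).add (ContDiffAt.sum fun i _ => ?_)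
  refine contDiffAt_const.mul ?_
  refine (ContinuousAlternatingMap.apply ℝ B ℝ _).contDiff.contDiffAt.comp z
    ((contDiffAt_mom hl hN).clm_apply ?_)
  exact contDiffAt_const.sub (contDiff_snd.contDiffAt.clm_apply contDiffAt_const)

/-- Along the jet fibre the volume factor is constant and `momMap` is linear, so only the fibre
derivative of L gets differentiated. -/
theorem fderiv_mom_vertical (hl : ContDiffAt ℝ ∞ l z) (hN : ContDiffAt ℝ ∞ N z.1.1)
    (a : B →L[ℝ] F) :
    fderiv ℝ (mom l N) z ((0 : B × F), a) = momMap (N z.1.1) (hess l z a) := by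
  ext u ξ
  have h1 := ((contDiffAt_mom hl hN).differentiableAt (by simp)).hasFDerivAt
  have h2 : HasFDerivAt (fun z => mom l N z u ξ) _ z :=
    (ContinuousAlternatingMap.apply ℝ B ℝ ξ).hasFDerivAt.comp z
      (h1.clm_apply (hasFDerivAt_const u z))
  have h3 := ((contDiffAt_dvert hl).differentiableAt (by simp)).hasFDerivAt
  have h4 := (((contDiffAt_smulRight_volume hN u ξ).differentiableAt (by simp)).hasFDerivAt).comp z
    ((hasFDerivAt_fst (𝕜 := ℝ) (p := z.1)).comp z (hasFDerivAt_fst (𝕜 := ℝ) (p := z)))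
  have h5 : HasFDerivAt (fun z => mom l N z u ξ) _ z := h3.clm_apply h4
  have h6 := congrArg (fun f => f ((0 : B × F), a)) (h2.unique h5)
  rw [momMap_apply]
  simpa [hess] using h6

/-- The contact form: `(ξ, u) ↦ (ξ, u - v ξ)`. -/
def contactSplit (z W : (B × F) × (B →L[ℝ] F)) : B × F := (W.1.1, W.1.2 - z.2 W.1.1)

/-- The point is what is missing on the right: the derivative of `l` is taken only along `(W.1, 0)`,
and the contact form is not differentiated. These two contributions of the jet component `W.2`
cancel, so `W.2` is felt only through the derivative of `mom`. -/
theorem fderiv_thetaLoc_apply (hdim : Module.finrank ℝ B = k + 1)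
    (hl : ContDiffAt ℝ ∞ l z) (hN : ContDiffAt ℝ ∞ N z.1.1)
    (V : Fin (k + 1) → (B × F) × (B →L[ℝ] F)) (W : (B × F) × (B →L[ℝ] F)) :
    fderiv ℝ (fun z => thetaLoc l N z V) z W =
      fderiv ℝ l z (W.1, 0) * N z.1.1 (fun i => (V i).1.1) +
        l z * fderiv ℝ N z.1.1 W.1.1 (fun i => (V i).1.1) +
        momentumForm B F k (fderiv ℝ (mom l N) z W) (fun i => contactSplit z (V i)) := by
  have h1 := ((contDiffAt_mom hl hN).differentiableAt (by simp)).hasFDerivAt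
  have h2 := (hl.differentiableAt (by simp)).hasFDerivAt
  have h3 := ((hN.differentiableAt (by simp)).hasFDerivAt).comp z
    ((hasFDerivAt_fst (𝕜 := ℝ) (p := z.1)).comp z (hasFDerivAt_fst (𝕜 := ℝ) (p := z)))
  have h4 := (ContinuousAlternatingMap.apply ℝ B ℝ (fun i => (V i).1.1)).hasFDerivAt.comp z h3
  have h5 : ∀ i : Fin (k + 1), HasFDerivAt (fun z : (B × F) × (B →L[ℝ] F) =>
      (V i).1.2 - z.2 (V i).1.1) _ z := fun i =>
    (hasFDerivAt_const (V i).1.2 z).sub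
      ((hasFDerivAt_snd (𝕜 := ℝ) (p := z)).clm_apply (hasFDerivAt_const (V i).1.1 z))
  have h6 := fun i : Fin (k + 1) =>
    ((ContinuousAlternatingMap.apply ℝ B ℝ (i.removeNth fun i => (V i).1.1)).hasFDerivAt.comp z
      (h1.clm_apply (h5 i))).const_mul ((-1 : ℝ) ^ (i : ℕ))
  have h7 := (h2.mul h4).add (HasFDerivAt.sum (u := Finset.univ) fun i _ => h6 i)
  have h8 : (fun z => thetaLoc l N z V) = _ := funext fun z => thetaLoc_apply l N z V
  rw [h8]
  have h9 := congrArg (fun f => f W) h7.fderiv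
  have hsplit : fderiv ℝ l z W = fderiv ℝ l z (W.1, 0) + dvert l z W.2 := by
    rw [dvert, ContinuousLinearMap.comp_apply, ← map_add]
    simp
  -- The cancellation: by Cramer's rule, varying v inside the contact form produces exactly the
  -- fibre derivative of `l` times the volume.
  have hcr : ∑ i : Fin (k + 1), (-1 : ℝ) ^ (i : ℕ) *
      mom l N z (W.2 (V i).1.1) (i.removeNth fun i => (V i).1.1) =
      dvert l z W.2 * N z.1.1 (fun i => (V i).1.1) := by
    have := congrArg (dvert l z)
      (clm_eq_sum_smulRight hdim (N z.1.1) (fun i => (V i).1.1) W.2)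
    rw [map_sum, map_smul, smul_eq_mul, mul_comm] at this
    rw [← this]
    refine Finset.sum_congr rfl fun i _ => ?_
    rw [map_smul]
    rfl
  refine Eq.trans ?_ (h9.trans ?_)
  · congr 2
    funext z
    simp
  have hsum : ∀ i : Fin (k + 1), ((-1 : ℝ) ^ (i : ℕ) •
      (ContinuousAlternatingMap.apply ℝ B ℝ (i.removeNth fun i => (V i).1.1)).comp
        ((mom l N z).comp (0 - (z.2.comp (0 : (B × F) × (B →L[ℝ] F) →L[ℝ] B) +
          (ContinuousLinearMap.snd ℝ (B × F) (B →L[ℝ] F)).flip (V i).1.1)) +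
          (fderiv ℝ (mom l N) z).flip ((V i).1.2 - z.2 (V i).1.1))) W =
      (-1 : ℝ) ^ (i : ℕ) • fderiv ℝ (mom l N) z W (contactSplit z (V i)).2
        (fun l => (contactSplit z (V (i.succAbove l))).1) -
      (-1 : ℝ) ^ (i : ℕ) * mom l N z (W.2 (V i).1.1) (i.removeNth fun i => (V i).1.1) := by
    intro i
    have e : (i.removeNth fun i => (V i).1.1) = fun l => (contactSplit z (V (i.succAbove l))).1 :=
      rfl
    rw [e]
    simp only [contactSplit, smul_apply, ContinuousLinearMap.comp_apply, add_apply, sub_apply,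
      ContinuousLinearMap.flip_apply, map_sub, map_add, ContinuousAlternatingMap.apply_apply,
      ContinuousLinearMap.coe_snd', zero_apply, map_zero, zero_sub, zero_add, smul_eq_mul,
      neg_apply, map_neg, ContinuousAlternatingMap.sub_apply]
    ring
  rw [momentumForm_apply, add_apply, sum_apply, Finset.sum_congr rfl fun i _ => hsum i,
    Finset.sum_sub_distrib, hcr]
  change l z * fderiv ℝ N z.1.1 W.1.1 (fun i => (V i).1.1) +
    N z.1.1 (fun i => (V i).1.1) * fderiv ℝ l z W + _ = _
  rw [hsplit]
  ring_nf

end Local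

/-! ### The exterior derivative of the Poincaré-Cartan form and its kernel -/

section LocalForm

set_option maxSynthPendingDepth 3

variable {B F : Type*} [NormedAddCommGroup B] [NormedSpace ℝ B]
  [NormedAddCommGroup F] [NormedSpace ℝ F] {k : ℕ}
  {l : (B × F) × (B →L[ℝ] F) → ℝ} {N : B → B [⋀^Fin (k + 1)]→L[ℝ] ℝ}
  {z : (B × F) × (B →L[ℝ] F)}

/-- In every other term of the alternating sum the vertical vector is an argument of a k-form that
sees base components only. -/
theorem momentumForm_cons_vertical (q : F →L[ℝ] B [⋀^Fin k]→L[ℝ] ℝ) (u : F) (w : Fin k → B × F) :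
    momentumForm B F k q (Matrix.vecCons ((0 : B), u) w) = q u fun i => (w i).1 := by
  rw [momentumForm_apply, Fin.sum_univ_succ, Finset.sum_eq_zero]
  · simp
  · intro i _
    obtain _ | k := k
    · exact i.elim0
    · rw [(q _).map_coord_zero 0 (by simp), smul_zero]

variable [FiniteDimensional ℝ B] [FiniteDimensional ℝ F]

/-- The exterior derivative of the Poincaré-Cartan form on a vertical vector. -/
theorem extDeriv_thetaLoc_cons (hdim : Module.finrank ℝ B = k + 1)
    (hl : ContDiffAt ℝ ∞ l z) (hN : ContDiffAt ℝ ∞ N z.1.1)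
    (u : F) (a : B →L[ℝ] F) (V : Fin (k + 1) → (B × F) × (B →L[ℝ] F)) :
    extDeriv (thetaLoc l N) z (Matrix.vecCons (((0 : B), u), a) V) =
      fderiv ℝ l z (((0 : B), u), 0) * N z.1.1 (fun i => (V i).1.1) +
        momentumForm B F k (fderiv ℝ (mom l N) z (((0 : B), u), a))
          (fun i => contactSplit z (V i)) -
        ∑ i : Fin (k + 1), (-1 : ℝ) ^ (i : ℕ) *
          fderiv ℝ (mom l N) z (V i) u (i.removeNth fun i => (V i).1.1) := by
  rw [extDeriv_apply ((contDiffAt_thetaLoc hl hN).differentiableAt (by simp)),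
    Fin.sum_univ_succ, sub_eq_add_neg, ← Finset.sum_neg_distrib]
  congr 1
  · rw [fderiv_thetaLoc_apply hdim hl hN]
    simp [Fin.removeNth]
  -- In the remaining terms the vertical vector is an argument of Θ: the two volume terms vanish,
  -- and `momentumForm` reduces to the pairing of dp with `u`.
  · refine Finset.sum_congr rfl fun i _ => ?_
    rw [fderiv_thetaLoc_apply hdim hl hN, int_neg_one_pow_smul]
    have e1 : (i.succ.removeNth (Matrix.vecCons (((0 : B), u), a) V)) =
        Matrix.vecCons (((0 : B), u), a) (i.removeNth V) := by
      funext j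
      refine Fin.cases ?_ (fun j => ?_) j <;> simp [Fin.removeNth]
    have e2 : (fun j => contactSplit z (Matrix.vecCons (((0 : B), u), a) (i.removeNth V) j)) =
        Matrix.vecCons ((0 : B), u) (fun j => contactSplit z (i.removeNth V j)) := by
      funext j
      refine Fin.cases ?_ (fun j => ?_) j <;> simp [contactSplit]
    have e3 : ∀ n : B [⋀^Fin (k + 1)]→L[ℝ] ℝ,
        n (fun j => (Matrix.vecCons (((0 : B), u), a) (i.removeNth V) j).1.1) = 0 :=
      fun n => n.map_coord_zero 0 rfl
    rw [e1, e2, e3, e3, momentumForm_cons_vertical]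
    simp only [mul_zero, zero_add, Matrix.cons_val_succ, smul_eq_mul, Fin.val_succ, pow_succ]
    simp only [mul_neg, mul_one, neg_mul, contactSplit]
    rfl

/-- The exterior derivative of the Poincaré-Cartan form on two vertical vectors. -/
theorem extDeriv_thetaLoc_cons_cons (hdim : Module.finrank ℝ B = k + 1)
    (hl : ContDiffAt ℝ ∞ l z) (hN : ContDiffAt ℝ ∞ N z.1.1)
    (u u' : F) (a a' : B →L[ℝ] F) (V : Fin k → (B × F) × (B →L[ℝ] F)) :
    extDeriv (thetaLoc l N) z (Matrix.vecCons (((0 : B), u), a)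
      (Matrix.vecCons (((0 : B), u'), a') V)) =
      fderiv ℝ (mom l N) z (((0 : B), u), a) u' (fun i => (V i).1.1) -
        fderiv ℝ (mom l N) z (((0 : B), u'), a') u (fun i => (V i).1.1) := by
  rw [extDeriv_thetaLoc_cons hdim hl hN]
  have e1 : N z.1.1 (fun i => (Matrix.vecCons (((0 : B), u'), a') V i).1.1) = 0 :=
    (N z.1.1).map_coord_zero 0 rfl
  have e2 : (fun j => contactSplit z (Matrix.vecCons (((0 : B), u'), a') V j)) =
        Matrix.vecCons ((0 : B), u') (fun j => contactSplit z (V j)) := by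
    funext j
    refine Fin.cases ?_ (fun j => ?_) j <;> simp [contactSplit]
  rw [e1, mul_zero, zero_add, e2, momentumForm_cons_vertical, Fin.sum_univ_succ,
    Finset.sum_eq_zero, add_zero]
  · simp [contactSplit]
    rfl
  · intro i _
    obtain _ | k := k
    · exact i.elim0
    · rw [ContinuousAlternatingMap.map_coord_zero _ 0 (by simp [Fin.removeNth]), mul_zero]

/-- The exterior derivative of the Poincaré-Cartan form along a semi-holonomic lift. -/
theorem extDeriv_thetaLoc_cons_lift (hdim : Module.finrank ℝ B = k + 1)
    (hl : ContDiffAt ℝ ∞ l z) (hN : ContDiffAt ℝ ∞ N z.1.1)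
    (u : F) (a : B →L[ℝ] F) (V : Fin (k + 1) → (B × F) × (B →L[ℝ] F))
    (hV : ∀ i, (V i).1.2 = z.2 (V i).1.1) :
    extDeriv (thetaLoc l N) z (Matrix.vecCons (((0 : B), u), a) V) =
      fderiv ℝ l z (((0 : B), u), 0) * N z.1.1 (fun i => (V i).1.1) -
        ∑ i : Fin (k + 1), (-1 : ℝ) ^ (i : ℕ) *
          fderiv ℝ (mom l N) z (V i) u (i.removeNth fun i => (V i).1.1) := by
  -- A semi-holonomic lift has zero contact component, and `momentumForm` is linear in a contact
  -- component in each of its terms.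
  rw [extDeriv_thetaLoc_cons hdim hl hN, momentumForm_apply, Finset.sum_eq_zero, add_zero]
  intro i _
  simp [contactSplit, hV]

/-- `1`-nondegeneracy forces the Hessian to be nondegenerate. -/
theorem hess_injective_of_nondegenerate (hdim : Module.finrank ℝ B = k + 1)
    (hl : ContDiffAt ℝ ∞ l z) (hN : ContDiffAt ℝ ∞ N z.1.1)
    (hreg : ∀ W, (∀ V, extDeriv (thetaLoc l N) z (Matrix.vecCons W V) = 0) → W = 0)
    {a : B →L[ℝ] F} (ha : hess l z a = 0) : a = 0 := by
  have h0 : fderiv ℝ (mom l N) z (((0 : B), (0 : F)), a) = 0 := by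
    refine (fderiv_mom_vertical hl hN a).trans ?_
    rw [ha]
    ext u ξ
    rw [momMap_apply]
    rfl
  have h1 : fderiv ℝ l z (((0 : B), (0 : F)), (0 : B →L[ℝ] F)) = 0 := map_zero _
  -- For the vector (0, 0, a) the terms containing `u` vanish, and the derivative of `mom` along it
  -- is the momentum map of the Hessian applied to `a`, which is zero.
  have := hreg (((0 : B), (0 : F)), a) fun V => by
    rw [extDeriv_thetaLoc_cons hdim hl hN, h0, h1]
    simp
  exact congrArg Prod.snd this

/-- `1`-nondegeneracy excludes trivial fibres. -/
theorem nontrivial_fibre_of_nondegenerate (hdim : Module.finrank ℝ B = k + 1)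
    (hreg : ∀ W : (B × F) × (B →L[ℝ] F),
      (∀ V, extDeriv (thetaLoc l N) z (Matrix.vecCons W V) = 0) → W = 0) : Nontrivial F := by
  by_contra hF
  rw [not_nontrivial_iff_subsingleton] at hF
  have hB : Nontrivial B := Module.nontrivial_of_finrank_pos (R := ℝ) (by omega)
  obtain ⟨b, hb⟩ := exists_ne (0 : B)
  -- With `F` trivial the jet space has dimension m, so every (m + 1)-form is zero, although the
  -- space itself is not.
  have hfin : Module.finrank ℝ ((B × F) × (B →L[ℝ] F)) < k + 1 + 1 := by
    have h1 : Module.finrank ℝ F = 0 := Module.finrank_zero_of_subsingleton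
    have h2 : Module.finrank ℝ (B →L[ℝ] F) = 0 := Module.finrank_zero_of_subsingleton
    rw [Module.finrank_prod, Module.finrank_prod, h1, h2, hdim]
    omega
  have h3 := hreg ((b, 0), 0) fun V => by
    have := alternating_eq_zero_of_finrank_lt hfin
      (extDeriv (thetaLoc l N) z).toAlternatingMap
    exact congrArg (fun f => f (Matrix.vecCons ((b, 0), 0) V)) this
  exact hb (congrArg (fun w => w.1.1) h3)

/-- An injective map from a finite dimensional space to its dual is bijective by dimension. -/
theorem hess_bijective (hreg : ∀ a, hess l z a = 0 → a = 0) :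
    Function.Bijective (hess l z) := by
  have hinj : Function.Injective (hess l z).toLinearMap :=
    (injective_iff_map_eq_zero _).2 hreg
  refine ⟨hinj, ?_⟩
  refine (LinearMap.injective_iff_surjective_of_finrank_eq_finrank ?_).1 hinj
  rw [← (LinearMap.toContinuousLinearMap (𝕜 := ℝ) (E := B →L[ℝ] F) (F' := ℝ)).finrank_eq]
  exact (Subspace.dual_finrank_eq (K := ℝ) (V := B →L[ℝ] F)).symm

/-- Along the jet fibre the derivative of `mom` is the composite of the Hessian and `momMap`, both
surjective. This freedom to prescribe dp supplies the test vectors of the nondegeneracy argument. -/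
theorem exists_fderiv_mom_vertical_eq (hdim : Module.finrank ℝ B = k + 1)
    (hl : ContDiffAt ℝ ∞ l z) (hN : ContDiffAt ℝ ∞ N z.1.1) (hn : N z.1.1 ≠ 0)
    (hreg : ∀ a, hess l z a = 0 → a = 0) (q : F →L[ℝ] B [⋀^Fin k]→L[ℝ] ℝ) :
    ∃ a : B →L[ℝ] F, fderiv ℝ (mom l N) z ((0 : B × F), a) = q := by
  obtain ⟨lam, rfl⟩ := momMap_surjective hdim hn q
  obtain ⟨a, rfl⟩ := (hess_bijective hreg).2 lam
  exact ⟨a, fderiv_mom_vertical hl hN a⟩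

theorem eq_zero_of_fderiv_mom_vertical (hdim : Module.finrank ℝ B = k + 1)
    (hl : ContDiffAt ℝ ∞ l z) (hN : ContDiffAt ℝ ∞ N z.1.1) (hn : N z.1.1 ≠ 0)
    (hreg : ∀ a, hess l z a = 0 → a = 0) {a : B →L[ℝ] F}
    (ha : fderiv ℝ (mom l N) z ((0 : B × F), a) = 0) : a = 0 := by
  rw [fderiv_mom_vertical hl hN] at ha
  exact hreg a (momMap_injective hdim hn ha)

theorem exists_fderiv_mom_eq (hdim : Module.finrank ℝ B = k + 1)
    (hl : ContDiffAt ℝ ∞ l z) (hN : ContDiffAt ℝ ∞ N z.1.1) (hn : N z.1.1 ≠ 0)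
    (hreg : ∀ a, hess l z a = 0 → a = 0) (w : B × F) (q : F →L[ℝ] B [⋀^Fin k]→L[ℝ] ℝ) :
    ∃ a : B →L[ℝ] F, fderiv ℝ (mom l N) z (w, a) = q := by
  obtain ⟨a, ha⟩ := exists_fderiv_mom_vertical_eq hdim hl hN hn hreg
    (q - fderiv ℝ (mom l N) z (w, 0))
  refine ⟨a, ?_⟩
  have : ((w, a) : (B × F) × (B →L[ℝ] F)) = (w, 0) + (0, a) := by simp
  rw [this, map_add, ha, add_sub_cancel]

/-- A vector whose interior product with the exterior derivative of the Poincaré-Cartan form vanishes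
whenever at least two of the arguments (the vector included) are vertical is zero. -/
theorem eq_zero_of_extDeriv_thetaLoc_vertical (hdim : Module.finrank ℝ B = k + 1) (hk : 1 ≤ k)
    [Nontrivial F] (hl : ContDiffAt ℝ ∞ l z) (hN : ContDiffAt ℝ ∞ N z.1.1) (hn : N z.1.1 ≠ 0)
    (hreg : ∀ a, hess l z a = 0 → a = 0) (W : (B × F) × (B →L[ℝ] F))
    (hW : ∀ (V : Fin (k + 1 + 1) → (B × F) × (B →L[ℝ] F)), (∃ i, V i = W) →
      (V 0).1.1 = 0 → (V 1).1.1 = 0 → extDeriv (thetaLoc l N) z V = 0) : W = 0 := by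
  obtain ⟨⟨ξ, u⟩, a⟩ := W
  -- Base component: if some N(ξ, v) were nonzero, W could be detected in the third slot, behind two
  -- vertical vectors. The third slot exists because m ≥ 2.
  have hξ : ξ = 0 := by
    obtain _ | k := k
    · omega
    refine eq_zero_of_volume_cons_eq_zero hdim hn fun v => ?_
    by_contra hv
    obtain ⟨u', hu'⟩ := exists_ne (0 : F)
    obtain ⟨f, hf⟩ := SeparatingDual.exists_eq_one (R := ℝ) hu'
    -- momenta `q = f ⊗ β` with `β (ξ, …) ≠ 0`
    let β : B [⋀^Fin (k + 1)]→L[ℝ] ℝ := (N z.1.1).curryLeft (v (Fin.last k))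
    obtain ⟨a₁, ha₁⟩ := exists_fderiv_mom_eq hdim hl hN hn hreg (0 : B × F)
      (f.smulRight β)
    let H : Fin (k + 1) → (B × F) × (B →L[ℝ] F) :=
      Matrix.vecCons ((ξ, u), a) fun i => ((v i.castSucc, 0), 0)
    -- The vertical vectors are (0, 0, a₁), along which dp = f ⊗ β, and (0, u', 0) with f(u') = 1.
    -- The second term of `extDeriv_thetaLoc_cons_cons` is paired with u = 0, so the result is β(ξ,
    -- ...).
    have h1 := hW (Matrix.vecCons (((0 : B), (0 : F)), a₁)
      (Matrix.vecCons (((0 : B), u'), (0 : B →L[ℝ] F)) H)) ⟨2, rfl⟩ rfl rfl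
    rw [extDeriv_thetaLoc_cons_cons hdim hl hN] at h1
    have h2 : fderiv ℝ (mom l N) z (((0 : B), (0 : F)), a₁) = f.smulRight β := ha₁
    rw [h2, map_zero, ContinuousLinearMap.smulRight_apply, hf, one_smul] at h1
    have h3 : β (fun i => (H i).1.1) = 0 := by
      simpa using h1
    have h4 : (fun i => (H i).1.1) = Matrix.vecCons ξ fun i : Fin k => v i.castSucc := by
      funext i
      refine Fin.cases ?_ (fun i => ?_) i <;> simp [H]
    rw [h4] at h3
    have h5 : N z.1.1 (Matrix.vecCons (v (Fin.last k))
        (Matrix.vecCons ξ fun i : Fin k => v i.castSucc)) = 0 := h3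
    -- Moving the vector used to define `β` from the first slot to the last costs only a sign and
    -- restores (ξ, v).
    have h6 := (N z.1.1).map_insertNth (Fin.last (k + 1)) (v (Fin.last k))
      (Matrix.vecCons ξ fun i : Fin k => v i.castSucc)
    rw [h5, smul_zero] at h6
    refine hv (Eq.trans (congrArg _ ?_) h6)
    rw [Fin.insertNth_last']
    funext i
    refine Fin.lastCases ?_ (fun i => ?_) i
    · rw [Fin.snoc_last, ← Fin.succ_last]
      rfl
    · rw [Fin.snoc_castSucc]
      refine Fin.cases rfl (fun i => ?_) i
      rw [Fin.castSucc_succ]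
      rfl
  subst hξ
  -- Now W is vertical. Testing it against one vertical vector and k base vectors gives this
  -- symmetry of dp, with `a'` on one side only.
  have key : ∀ (u' : F) (a' : B →L[ℝ] F) (v : Fin k → B),
      fderiv ℝ (mom l N) z (((0 : B), u), a) u' v =
        fderiv ℝ (mom l N) z (((0 : B), u'), a') u v := by
    intro u' a' v
    have h1 := hW (Matrix.vecCons (((0 : B), u), a) (Matrix.vecCons (((0 : B), u'), a')
      fun i => ((v i, 0), 0))) ⟨0, rfl⟩ rfl rfl
    rw [extDeriv_thetaLoc_cons_cons hdim hl hN] at h1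
    exact sub_eq_zero.1 h1
  -- Fibre component: with u' = 0 the left side of `key` vanishes, while `a'` can be chosen so that
  -- the right side is f(u) times a nonzero volume.
  have hu : u = 0 := by
    by_contra hu
    obtain ⟨f, hf⟩ := SeparatingDual.exists_eq_one (R := ℝ) hu
    obtain ⟨v, hv⟩ := exists_ne_zero_of_form_ne_zero hn
    let β : B [⋀^Fin k]→L[ℝ] ℝ := (N z.1.1).curryLeft (v 0)
    obtain ⟨a₁, ha₁⟩ := exists_fderiv_mom_eq hdim hl hN hn hreg (0 : B × F) (f.smulRight β)
    have h1 := key 0 a₁ (fun i => v i.succ)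
    have h2 : fderiv ℝ (mom l N) z (((0 : B), (0 : F)), a₁) = f.smulRight β := ha₁
    rw [h2, map_zero, ContinuousLinearMap.smulRight_apply, hf, one_smul] at h1
    refine hv (Eq.trans (congrArg _ ?_) h1.symm)
    funext i
    refine Fin.cases rfl (fun i => rfl) i
  subst hu
  -- Jet component: with u = 0 the right side of `key` vanishes, so dp is zero along (0, 0, a) and
  -- invertibility of the Hessian applies.
  have ha : a = 0 := by
    refine eq_zero_of_fderiv_mom_vertical hdim hl hN hn hreg ?_
    ext u' v
    refine (key u' 0 v).trans ?_
    rw [map_zero]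
    rfl
  rw [ha]
  rfl

end LocalForm

/-! ### The exterior derivative on manifolds: charts and pullbacks -/

section ManifoldForms

variable {V N V' N' : Type*} [NormedAddCommGroup V] [NormedSpace ℝ V]
  [TopologicalSpace N] [ChartedSpace V N]
  [NormedAddCommGroup V'] [NormedSpace ℝ V']
  [TopologicalSpace N'] [ChartedSpace V' N']

/-- The expression of a differential form in a chart. -/
def formIn {d : ℕ} (c : OpenPartialHomeomorph N V)
    (α : ∀ q : N, TangentSpace 𝓘(ℝ, V) q [⋀^Fin d]→L[ℝ] ℝ) (u : V) : V [⋀^Fin d]→L[ℝ] ℝ :=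
  (α (c.symm u)).compContinuousLinearMap (mfderiv 𝓘(ℝ, V) 𝓘(ℝ, V) c.symm u)

theorem mdifferentiable_of_mem_maximalAtlas {c : OpenPartialHomeomorph N V}
    (hc : c ∈ IsManifold.maximalAtlas 𝓘(ℝ, V) ∞ N) : c.MDifferentiable 𝓘(ℝ, V) 𝓘(ℝ, V) :=
  ⟨(contMDiffOn_of_mem_maximalAtlas hc).mdifferentiableOn (by simp),
    (contMDiffOn_symm_of_mem_maximalAtlas hc).mdifferentiableOn (by simp)⟩

/-- Forms at equal points formally live on different tangent spaces. Since all of these unfold to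
the model space, the comparison can be stated there and proved by substitution. -/
theorem form_congr {W : Type*} [NormedAddCommGroup W] [NormedSpace ℝ W] {d : ℕ}
    (α : ∀ q : N, TangentSpace 𝓘(ℝ, V) q [⋀^Fin d]→L[ℝ] ℝ) {q q' : N} (h : q = q')
    {A A' : W →L[ℝ] V} (hA : A = A') :
    ContinuousAlternatingMap.compContinuousLinearMap (α q : V [⋀^Fin d]→L[ℝ] ℝ) A =
      ContinuousAlternatingMap.compContinuousLinearMap (α q' : V [⋀^Fin d]→L[ℝ] ℝ) A' := by
  subst h hA; rfl

variable [IsManifold 𝓘(ℝ, V') ∞ N']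

/-- The exterior derivative of a pull-back, computed in an arbitrary chart of the target. -/
theorem extD_pullback_chart {d : ℕ} {Ψ : N' → N} {s : Set N'} (hs : IsOpen s) {q : N'} (hq : q ∈ s)
    (hΨ : ContMDiffOn 𝓘(ℝ, V') 𝓘(ℝ, V) ∞ Ψ s) {c : OpenPartialHomeomorph N V}
    (hc : c ∈ IsManifold.maximalAtlas 𝓘(ℝ, V) ∞ N) (hqc : Ψ q ∈ c.source)
    {α : ∀ q : N, TangentSpace 𝓘(ℝ, V) q [⋀^Fin d]→L[ℝ] ℝ}
    {α' : ∀ q : N', TangentSpace 𝓘(ℝ, V') q [⋀^Fin d]→L[ℝ] ℝ}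
    (hα : ∀ q ∈ s, α' q = (α (Ψ q)).compContinuousLinearMap (mfderiv 𝓘(ℝ, V') 𝓘(ℝ, V) Ψ q))
    (hd : DifferentiableAt ℝ (formIn c α) (c (Ψ q))) :
    extD α' q = (extDeriv (formIn c α) (c (Ψ q))).compContinuousLinearMap
      ((mfderiv 𝓘(ℝ, V) 𝓘(ℝ, V) c (Ψ q)).comp (mfderiv 𝓘(ℝ, V') 𝓘(ℝ, V) Ψ q)) := by
  set c₀ := chartAt V' q with hc₀
  have hc₀a : c₀ ∈ IsManifold.maximalAtlas 𝓘(ℝ, V') ∞ N' := IsManifold.chart_mem_maximalAtlas q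
  have hm₀ := mdifferentiable_of_mem_maximalAtlas hc₀a
  have hm := mdifferentiable_of_mem_maximalAtlas hc
  have hqs : q ∈ c₀.source := mem_chart_source V' q
  -- a neighbourhood on which everything is defined
  have hΨc : ContinuousOn Ψ s := hΨ.continuousOn
  have ho1 : IsOpen (s ∩ Ψ ⁻¹' c.source) := hΨc.isOpen_inter_preimage hs c.open_source
  set U : Set V' := c₀.target ∩ c₀.symm ⁻¹' (s ∩ Ψ ⁻¹' c.source) with hU
  have hUo : IsOpen U := c₀.isOpen_inter_preimage_symm ho1
  have hqU : c₀ q ∈ U := by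
    refine ⟨c₀.map_source hqs, ?_⟩
    rw [mem_preimage, c₀.left_inv hqs]
    exact (⟨hq, hqc⟩ : q ∈ s ∩ Ψ ⁻¹' c.source)
  -- The coordinate expression of `Ψ`. It reduces the claim to the pullback formula for `extDeriv`
  -- on normed spaces.
  set φ : V' → V := fun u => c (Ψ (c₀.symm u)) with hφ
  have hφs : ContDiffOn ℝ ∞ φ U := by
    have h1 : ContMDiffOn 𝓘(ℝ, V') 𝓘(ℝ, V) ∞ (fun u => Ψ (c₀.symm u)) U :=
      hΨ.comp ((contMDiffOn_symm_of_mem_maximalAtlas hc₀a).mono inter_subset_left)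
        fun u hu => hu.2.1
    exact contMDiffOn_iff_contDiffOn.1
      ((contMDiffOn_of_mem_maximalAtlas hc).comp h1 fun u hu => hu.2.2)
  have hder : ∀ u ∈ U, (fderiv ℝ φ u : V' →L[ℝ] V) =
      (mfderiv 𝓘(ℝ, V) 𝓘(ℝ, V) c (Ψ (c₀.symm u))).comp
        ((mfderiv 𝓘(ℝ, V') 𝓘(ℝ, V) Ψ (c₀.symm u)).comp
          (mfderiv 𝓘(ℝ, V') 𝓘(ℝ, V') c₀.symm u)) := by
    intro u hu
    have h1 := (hm₀.mdifferentiableAt_symm hu.1).hasMFDerivAt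
    have h2 := ((hΨ.contMDiffAt (hs.mem_nhds hu.2.1)).mdifferentiableAt (by simp)).hasMFDerivAt
    have h3 := (hm.mdifferentiableAt hu.2.2).hasMFDerivAt
    have h4 := (HasMFDerivAt.comp u h3 (HasMFDerivAt.comp u h2 h1)).mfderiv
    rw [← h4, mfderiv_eq_fderiv]
    rfl
  have hev : formInChart α' q =ᶠ[𝓝 (c₀ q)]
      fun u => (formIn c α (φ u)).compContinuousLinearMap (fderiv ℝ φ u) := by
    filter_upwards [hUo.mem_nhds hqU] with u hu
    have h1 : formInChart α' q u = (α' (c₀.symm u)).compContinuousLinearMap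
      (mfderiv 𝓘(ℝ, V') 𝓘(ℝ, V') c₀.symm u) := rfl
    rw [h1, hα _ hu.2.1, hder u hu]
    have hinv : c.symm (φ u) = Ψ (c₀.symm u) := c.left_inv hu.2.2
    refine form_congr (W := V') α hinv.symm (A := (mfderiv 𝓘(ℝ, V') 𝓘(ℝ, V) Ψ (c₀.symm u)).comp
          (mfderiv 𝓘(ℝ, V') 𝓘(ℝ, V') c₀.symm u))
      (A' := (mfderiv 𝓘(ℝ, V) 𝓘(ℝ, V) c.symm (φ u)).comp
        ((mfderiv 𝓘(ℝ, V) 𝓘(ℝ, V) c (Ψ (c₀.symm u))).comp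
        ((mfderiv 𝓘(ℝ, V') 𝓘(ℝ, V) Ψ (c₀.symm u)).comp
          (mfderiv 𝓘(ℝ, V') 𝓘(ℝ, V') c₀.symm u)))) ?_
    -- The two linear maps differ by the composite of the tangent maps of `c` and of its inverse,
    -- which is the identity.
    have h5 := hm.symm_comp_deriv hu.2.2
    ext w
    exact (congrArg (fun f => f (mfderiv 𝓘(ℝ, V') 𝓘(ℝ, V) Ψ (c₀.symm u)
      (mfderiv 𝓘(ℝ, V') 𝓘(ℝ, V') c₀.symm u w))) h5).symm
  have hφq : φ (c₀ q) = c (Ψ q) := by simp only [hφ, c₀.left_inv hqs]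
  unfold extD
  rw [hev.extDeriv_eq, extDeriv_pullback (r := ∞) (by rwa [hφq])
    (hφs.contDiffAt (hUo.mem_nhds hqU)) 
    (by
      rw [minSmoothness_of_isRCLikeNormedField]
      exact WithTop.coe_le_coe.2 (le_top (a := (2 : ℕ∞)))),
    hφq, hder _ hqU]
  have hcomp := hm₀.symm_comp_deriv hqs
  ext w
  refine congrArg (extDeriv (formIn c α) (c (Ψ q))) (funext fun i => ?_)
  have h6 : mfderiv 𝓘(ℝ, V') 𝓘(ℝ, V') c₀.symm (c₀ q) (mfderiv 𝓘(ℝ, V') 𝓘(ℝ, V') c₀ q (w i)) = w i :=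
    congrArg (fun f => f (w i)) hcomp
  change mfderiv 𝓘(ℝ, V) 𝓘(ℝ, V) c (Ψ (c₀.symm (c₀ q))) (mfderiv 𝓘(ℝ, V') 𝓘(ℝ, V) Ψ (c₀.symm (c₀ q))
    (mfderiv 𝓘(ℝ, V') 𝓘(ℝ, V') c₀.symm (c₀ q) (mfderiv 𝓘(ℝ, V') 𝓘(ℝ, V') c₀ q (w i)))) = _
  -- The point is generalized because the tangent maps depend on it, so that rewriting with
  -- `c₀.left_inv` in place is not well typed.
  have h7 : ∀ q', q' = q → ∀ x : V', (mfderiv 𝓘(ℝ, V) 𝓘(ℝ, V) c (Ψ q')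
    (mfderiv 𝓘(ℝ, V') 𝓘(ℝ, V) Ψ q' x) : V) = mfderiv 𝓘(ℝ, V) 𝓘(ℝ, V) c (Ψ q)
    (mfderiv 𝓘(ℝ, V') 𝓘(ℝ, V) Ψ q x) := by rintro _ rfl x; rfl
  exact (h7 _ (c₀.left_inv hqs) _).trans (congrArg (fun x => mfderiv 𝓘(ℝ, V) 𝓘(ℝ, V) c (Ψ q)
    (mfderiv 𝓘(ℝ, V') 𝓘(ℝ, V) Ψ q x)) h6)

variable [IsManifold 𝓘(ℝ, V) ∞ N]

/-- The exterior derivative can be computed in any chart. -/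
theorem extD_eq_chart {d : ℕ} {c : OpenPartialHomeomorph N V}
    (hc : c ∈ IsManifold.maximalAtlas 𝓘(ℝ, V) ∞ N) {q : N} (hq : q ∈ c.source)
    {α : ∀ q : N, TangentSpace 𝓘(ℝ, V) q [⋀^Fin d]→L[ℝ] ℝ}
    (hd : DifferentiableAt ℝ (formIn c α) (c q)) :
    extD α q = (extDeriv (formIn c α) (c q)).compContinuousLinearMap
      (mfderiv 𝓘(ℝ, V) 𝓘(ℝ, V) c q) := by
  -- The pullback formula already allows any chart on the target, so the identity map gives
  -- independence of the chart.
  have h := extD_pullback_chart (Ψ := id) (s := univ) isOpen_univ (mem_univ q) contMDiffOn_id hc hq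
    (α := α) (α' := α) (fun q _ => by rw [mfderiv_id]; rfl) hd
  rw [mfderiv_id] at h
  exact h

/-- The exterior derivative commutes with pull-backs. -/
theorem extD_pullback {d : ℕ} {Ψ : N' → N} {s : Set N'} (hs : IsOpen s) {q : N'} (hq : q ∈ s)
    (hΨ : ContMDiffOn 𝓘(ℝ, V') 𝓘(ℝ, V) ∞ Ψ s) {c : OpenPartialHomeomorph N V}
    (hc : c ∈ IsManifold.maximalAtlas 𝓘(ℝ, V) ∞ N) (hqc : Ψ q ∈ c.source)
    {α : ∀ q : N, TangentSpace 𝓘(ℝ, V) q [⋀^Fin d]→L[ℝ] ℝ}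
    {α' : ∀ q : N', TangentSpace 𝓘(ℝ, V') q [⋀^Fin d]→L[ℝ] ℝ}
    (hα : ∀ q ∈ s, α' q = (α (Ψ q)).compContinuousLinearMap (mfderiv 𝓘(ℝ, V') 𝓘(ℝ, V) Ψ q))
    (hd : DifferentiableAt ℝ (formIn c α) (c (Ψ q))) :
    extD α' q = (extD α (Ψ q)).compContinuousLinearMap (mfderiv 𝓘(ℝ, V') 𝓘(ℝ, V) Ψ q) := by
  rw [extD_pullback_chart hs hq hΨ hc hqc hα hd, extD_eq_chart hc hqc hd]
  rfl

end ManifoldForms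

/-! ### Smooth vector fields under local diffeomorphisms -/

section Fields

variable {V N V' N' : Type*} [NormedAddCommGroup V] [NormedSpace ℝ V]
  [TopologicalSpace N] [ChartedSpace V N] [IsManifold 𝓘(ℝ, V) ∞ N]
  [NormedAddCommGroup V'] [NormedSpace ℝ V'] [CompleteSpace V']
  [TopologicalSpace N'] [ChartedSpace V' N'] [IsManifold 𝓘(ℝ, V') ∞ N']

/-- The field `B ∘ g`, where `B` is the inverse of the tangent map of a local diffeomorphism, is
smooth. -/
theorem IsSmoothFieldOn.pullback {Ψ : N' → N} {s : Set N'} {t : Set N} (hs : IsOpen s)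
    (hΨ : ContMDiffOn 𝓘(ℝ, V') 𝓘(ℝ, V) ∞ Ψ s) (hst : MapsTo Ψ s t)
    {Y : ∀ q : N, TangentSpace 𝓘(ℝ, V) q} (hY : IsSmoothFieldOn Y t)
    {Y' : ∀ q : N', TangentSpace 𝓘(ℝ, V') q}
    (hinv : ∀ q ∈ s, (mfderiv 𝓘(ℝ, V') 𝓘(ℝ, V) Ψ q).IsInvertible)
    (h : ∀ q ∈ s, mfderiv 𝓘(ℝ, V') 𝓘(ℝ, V) Ψ q (Y' q) = Y (Ψ q)) : IsSmoothFieldOn Y' s := by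
  have : IsManifold 𝓘(ℝ, V) 1 N := IsManifold.of_le (n := ∞) (by simp)
  have : IsManifold 𝓘(ℝ, V') 1 N' := IsManifold.of_le (n := ∞) (by simp)
  intro q hq
  -- Since the tangent map is invertible, the hypothesis on `Y'` identifies it with the pullback of
  -- `Y`, for which smoothness is known.
  have h1 := ContMDiffWithinAt.mpullback_vectorField_preimage (n := ∞) (m := ∞) (f := Ψ) (x₀ := q)
    (hY (Ψ q) (hst hq)) (hΨ.contMDiffAt (hs.mem_nhds hq)) (hinv q hq) (by simp)
  refine (h1.mono hst).congr (fun q' hq' => ?_) ?_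
  · obtain ⟨e, he⟩ := hinv q' hq'
    rw [VectorField.mpullback_apply, ← h q' hq', ← he]
    simp
  · obtain ⟨e, he⟩ := hinv q hq
    rw [VectorField.mpullback_apply, ← h q hq, ← he]
    simp

end Fields

/-! ### Natural charts of the jet bundle and their tangent maps -/

section JetCharts

set_option maxSynthPendingDepth 3

variable {B F M E : Type*}
  [NormedAddCommGroup B] [NormedSpace ℝ B]
  [NormedAddCommGroup F] [NormedSpace ℝ F]
  [TopologicalSpace M] [ChartedSpace B M]
  [TopologicalSpace E] [ChartedSpace (B × F) E]
  {P : FibredManifold B F M E} {k : ℕ}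

/-- The natural chart of the jet bundle, as a chart of its manifold structure. -/
def jetChart (e : AdaptedChart P) : OpenPartialHomeomorph (Jet1 P) ((B × F) × (B →L[ℝ] F)) :=
  (Jet1.core P).openPartialHomeomorph (Jet1.natChart e) (mem_range_self e)

variable (e : AdaptedChart P)

theorem jetChart_apply (j : Jet1 P) : jetChart e j = Jet1.coords e j := rfl

theorem jetChart_mem_maximalAtlas :
    jetChart e ∈ IsManifold.maximalAtlas 𝓘(ℝ, (B × F) × (B →L[ℝ] F)) ∞ (Jet1 P) := by
  refine IsManifold.subset_maximalAtlas ?_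
  exact mem_iUnion₂.2 ⟨Jet1.natChart e, mem_range_self e, rfl⟩

theorem mdifferentiable_jetChart : (jetChart e).MDifferentiable
    𝓘(ℝ, (B × F) × (B →L[ℝ] F)) 𝓘(ℝ, (B × F) × (B →L[ℝ] F)) :=
  mdifferentiable_of_mem_maximalAtlas (jetChart_mem_maximalAtlas e)

/-- The tangent map of the natural chart. -/
def dJet (j : Jet1 P) :
    TangentSpace 𝓘(ℝ, (B × F) × (B →L[ℝ] F)) j →L[ℝ] (B × F) × (B →L[ℝ] F) :=
  mfderiv 𝓘(ℝ, (B × F) × (B →L[ℝ] F)) 𝓘(ℝ, (B × F) × (B →L[ℝ] F)) (jetChart e) j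

/-- The tangent map of the inverse of the natural chart. -/
def dJetInv (j : Jet1 P) :
    (B × F) × (B →L[ℝ] F) →L[ℝ] TangentSpace 𝓘(ℝ, (B × F) × (B →L[ℝ] F)) j :=
  mfderiv 𝓘(ℝ, (B × F) × (B →L[ℝ] F)) 𝓘(ℝ, (B × F) × (B →L[ℝ] F)) (jetChart e).symm
    (jetChart e j)

variable {e}

theorem dJetInv_dJet {j : Jet1 P} (hj : j.pt ∈ e.tot.source)
    (w : TangentSpace 𝓘(ℝ, (B × F) × (B →L[ℝ] F)) j) : dJetInv e j (dJet e j w) = w :=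
  congrArg (fun f => f w) ((mdifferentiable_jetChart e).symm_comp_deriv hj)

theorem dJet_dJetInv {j : Jet1 P} (hj : j.pt ∈ e.tot.source) (w : (B × F) × (B →L[ℝ] F)) :
    dJet e j (dJetInv e j w) = w := by
  have h := (mdifferentiable_jetChart e).comp_symm_deriv ((jetChart e).map_source hj)
  rw [(jetChart e).left_inv hj] at h
  exact congrArg (fun f => f w) h

theorem continuous_jet_pt : Continuous (Jet1.pt : Jet1 P → E) := by
  refine continuous_iff_continuousAt.2 fun j => ?_
  obtain ⟨e, he⟩ := P.exists_adaptedChart j.pt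
  have hj : j.pt ∈ e.tot.source := he ▸ e.ctr_mem
  -- In natural coordinates the projection to E is (x, y, v) ↦ (x, y).
  have h1 : ContinuousAt (fun j => e.tot.symm (jetChart e j).1) j := by
    refine ContinuousAt.comp (f := fun j => (jetChart e j).1)
      (e.tot.continuousAt_symm (e.tot.map_source hj)) ?_
    exact continuous_fst.continuousAt.comp ((jetChart e).continuousAt hj)
  refine h1.congr ?_
  filter_upwards [(jetChart e).open_source.mem_nhds hj] with j' hj'
  exact e.tot.left_inv hj'

theorem contMDiff_jet_pt :
    ContMDiff 𝓘(ℝ, (B × F) × (B →L[ℝ] F)) 𝓘(ℝ, B × F) ∞ (Jet1.pt : Jet1 P → E) := by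
  intro j
  obtain ⟨e, he⟩ := P.exists_adaptedChart j.pt
  have hj : j.pt ∈ e.tot.source := he ▸ e.ctr_mem
  have h1 : ContMDiffOn 𝓘(ℝ, (B × F) × (B →L[ℝ] F)) 𝓘(ℝ, B × F) ∞
      (fun j => (jetChart e j).1) (jetChart e).source :=
    (contDiff_fst.contMDiff (n := ∞)).comp_contMDiffOn
      (contMDiffOn_of_mem_maximalAtlas (jetChart_mem_maximalAtlas e))
  have h2 := e.smooth_tot_symm.comp h1 fun j hj => e.tot.map_source hj
  refine (h2.contMDiffAt ((jetChart e).open_source.mem_nhds hj)).congr_of_eventuallyEq ?_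
  filter_upwards [(jetChart e).open_source.mem_nhds hj] with j' hj'
  exact (e.tot.left_inv hj').symm

theorem mdifferentiableAt_jet_pt (j : Jet1 P) :
    MDifferentiableAt 𝓘(ℝ, (B × F) × (B →L[ℝ] F)) 𝓘(ℝ, B × F) (Jet1.pt : Jet1 P → E) j :=
  (contMDiff_jet_pt j).mdifferentiableAt (by simp)

theorem dTot_mfderiv_pt {j : Jet1 P} (hj : j.pt ∈ e.tot.source)
    (w : TangentSpace 𝓘(ℝ, (B × F) × (B →L[ℝ] F)) j) :
    e.dTot j.pt (mfderiv 𝓘(ℝ, (B × F) × (B →L[ℝ] F)) 𝓘(ℝ, B × F) Jet1.pt j w) =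
      (dJet e j w).1 := by
  have h1 : HasMFDerivAt 𝓘(ℝ, (B × F) × (B →L[ℝ] F)) 𝓘(ℝ, B × F) (fun j : Jet1 P => e.tot j.pt) j
      ((e.dTot j.pt).comp (mfderiv 𝓘(ℝ, (B × F) × (B →L[ℝ] F)) 𝓘(ℝ, B × F) Jet1.pt j)) :=
    HasMFDerivAt.comp j (e.mdiff_tot.mdifferentiableAt hj).hasMFDerivAt
      (mdifferentiableAt_jet_pt j).hasMFDerivAt
  have h2 : HasMFDerivAt 𝓘(ℝ, (B × F) × (B →L[ℝ] F)) 𝓘(ℝ, B × F) (fun j : Jet1 P => e.tot j.pt) j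
      ((ContinuousLinearMap.fst ℝ (B × F) (B →L[ℝ] F)).comp (dJet e j)) :=
    HasMFDerivAt.comp (f := jetChart e) j
      (ContinuousLinearMap.fst ℝ (B × F) (B →L[ℝ] F)).hasMFDerivAt
      ((mdifferentiable_jetChart e).mdifferentiableAt hj).hasMFDerivAt
  exact congrArg (fun f => f w) (hasMFDerivAt_unique h1 h2)

theorem mfderiv_pt_dJetInv {j : Jet1 P} (hj : j.pt ∈ e.tot.source) (w : (B × F) × (B →L[ℝ] F)) :
    mfderiv 𝓘(ℝ, (B × F) × (B →L[ℝ] F)) 𝓘(ℝ, B × F) Jet1.pt j (dJetInv e j w) =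
      e.dTotInv j.pt w.1 := by
  rw [← e.dTotInv_dTot hj (mfderiv 𝓘(ℝ, (B × F) × (B →L[ℝ] F)) 𝓘(ℝ, B × F) Jet1.pt j _),
    dTot_mfderiv_pt hj, dJet_dJetInv hj]

theorem mfderiv_toBase (j : Jet1 P) :
    mfderiv 𝓘(ℝ, (B × F) × (B →L[ℝ] F)) 𝓘(ℝ, B) Jet1.toBase j =
      (P.dproj j.pt).comp (mfderiv 𝓘(ℝ, (B × F) × (B →L[ℝ] F)) 𝓘(ℝ, B × F) Jet1.pt j) :=
  mfderiv_comp j AdaptedChart.mdiffAt_proj (mdifferentiableAt_jet_pt j)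

theorem dBase_mfderiv_toBase {j : Jet1 P} (hj : j.pt ∈ e.tot.source)
    (w : TangentSpace 𝓘(ℝ, (B × F) × (B →L[ℝ] F)) j) :
    e.dBase (P.proj j.pt) (mfderiv 𝓘(ℝ, (B × F) × (B →L[ℝ] F)) 𝓘(ℝ, B) Jet1.toBase j w) =
      (dJet e j w).1.1 := by
  rw [mfderiv_toBase]
  exact (e.dBase_dproj hj _).trans (congrArg Prod.fst (dTot_mfderiv_pt hj w))

theorem mfderiv_toBase_eq {j : Jet1 P} (hj : j.pt ∈ e.tot.source)
    (w : TangentSpace 𝓘(ℝ, (B × F) × (B →L[ℝ] F)) j) :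
    mfderiv 𝓘(ℝ, (B × F) × (B →L[ℝ] F)) 𝓘(ℝ, B) Jet1.toBase j w =
      e.dBaseInv (P.proj j.pt) (dJet e j w).1.1 := by
  rw [← dBase_mfderiv_toBase hj]
  exact (e.dBaseInv_dBase (e.mapsTo _ hj) _).symm

theorem dTot_lin {j : Jet1 P} (hj : j.pt ∈ e.tot.source) (x : B) :
    e.dTot j.pt (j.lin (e.dBaseInv (P.proj j.pt) x)) = (x, (Jet1.coords e j).2 x) := by
  refine Prod.ext ?_ rfl
  rw [← e.dBase_dproj hj]
  exact (congrArg _ (j.dproj_lin _)).trans (e.dBase_dBaseInv (e.mapsTo _ hj) x)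

/-- The effect of `shift` on the fibre coordinates. -/
def shiftCoord (e : AdaptedChart P) (j : Jet1 P) : (B →L[ℝ] B × F) →L[ℝ] (B →L[ℝ] F) :=
  let dT : B × F →L[ℝ] B × F := e.dTot j.pt
  let lin : B →L[ℝ] B × F := j.lin
  let dp : B × F →L[ℝ] B := P.dproj j.pt
  let dB : B →L[ℝ] B := e.dBaseInv (P.proj j.pt)
  ((ContinuousLinearMap.compL ℝ B B F).flip dB).comp (ContinuousLinearMap.compL ℝ B (B × F) F
    ((ContinuousLinearMap.snd ℝ B F).comp (dT - dT.comp (lin.comp dp))))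

theorem shiftCoord_apply (j : Jet1 P) (A : B →L[ℝ] B × F) (x : B) :
    shiftCoord e j A x = (e.dTot j.pt (A (e.dBaseInv (P.proj j.pt) x))).2 -
      (e.dTot j.pt (j.lin (P.dproj j.pt (A (e.dBaseInv (P.proj j.pt) x))))).2 := rfl

theorem coords_shift (j : Jet1 P) (A : B →L[ℝ] B × F) :
    Jet1.coords e (j.shift A) = Jet1.coords e j + ((0 : B × F), shiftCoord e j A) := by
  refine Prod.ext (add_zero _).symm ?_
  ext x
  let dT : B × F →L[ℝ] B × F := e.dTot j.pt
  let lin : B →L[ℝ] B × F := j.lin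
  let dp : B × F →L[ℝ] B := P.dproj j.pt
  let dB : B →L[ℝ] B := e.dBaseInv (P.proj j.pt)
  change (dT (lin (dB x) + (A (dB x) - lin (dp (A (dB x)))))).2 =
    (dT (lin (dB x))).2 + ((dT (A (dB x))).2 - (dT (lin (dp (A (dB x))))).2)
  rw [map_add, map_sub]
  rfl

/-- `shift` first makes a linear map vertical by subtracting its horizontal part along the jet. In
coordinates this replaces `w` by its contact component w.2 - v(w.1), the source of the contact form
in Θ. -/
theorem shiftCoord_smulRight {j : Jet1 P} (hj : j.pt ∈ e.tot.source) (β : B →L[ℝ] ℝ) (w : B × F)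
    (x : B) : shiftCoord e j (β.smulRight (e.dTotInv j.pt w : B × F)) x =
      β (e.dBaseInv (P.proj j.pt) x) • (w.2 - (Jet1.coords e j).2 w.1) := by
  let dT : B × F →L[ℝ] B × F := e.dTot j.pt
  let lin : B →L[ℝ] B × F := j.lin
  let dp : B × F →L[ℝ] B := P.dproj j.pt
  let v : B × F := e.dTotInv j.pt w
  have h1 : lin (dp v) = lin (e.dBaseInv (P.proj j.pt) w.1) := congrArg lin (e.dproj_dTotInv hj w)
  have h2 : dT v = w := e.dTot_dTotInv hj w
  have h3 : dT (lin (e.dBaseInv (P.proj j.pt) w.1)) = (w.1, (Jet1.coords e j).2 w.1) :=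
    dTot_lin hj w.1
  rw [shiftCoord_apply]
  set c : ℝ := β (e.dBaseInv (P.proj j.pt) x) with hc
  change (dT (c • v)).2 - (dT (lin (dp (c • v)))).2 = _
  rw [map_smul, map_smul, map_smul, h1, map_smul, h2, h3, smul_sub]
  rfl

end JetCharts

/-! ### The geometric objects in natural coordinates -/

section LocalExpressions

set_option maxSynthPendingDepth 3

variable {B F M E : Type*}
  [NormedAddCommGroup B] [NormedSpace ℝ B]
  [NormedAddCommGroup F] [NormedSpace ℝ F]
  [TopologicalSpace M] [ChartedSpace B M]
  [TopologicalSpace E] [ChartedSpace (B × F) E]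
  {P : FibredManifold B F M E} {k : ℕ}
  {L : Jet1 P → ℝ} {η : ∀ x : M, TangentSpace 𝓘(ℝ, B) x [⋀^Fin (k + 1)]→L[ℝ] ℝ}
  {e : AdaptedChart P}

/-- The Lagrangian in natural coordinates. -/
def lagLoc (L : Jet1 P → ℝ) (e : AdaptedChart P) (z : (B × F) × (B →L[ℝ] F)) : ℝ :=
  L ((jetChart e).symm z)

/-- The volume form in the chart of the base. -/
def volLoc (η : ∀ x : M, TangentSpace 𝓘(ℝ, B) x [⋀^Fin (k + 1)]→L[ℝ] ℝ) (e : AdaptedChart P) :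
    B → B [⋀^Fin (k + 1)]→L[ℝ] ℝ :=
  formIn e.base η

theorem contDiffAt_lagLoc (hL : ContMDiff 𝓘(ℝ, (B × F) × (B →L[ℝ] F)) 𝓘(ℝ) ∞ L)
    {z : (B × F) × (B →L[ℝ] F)} (hz : z.1 ∈ e.tot.target) : ContDiffAt ℝ ∞ (lagLoc L e) z := by
  have h := hL.comp_contMDiffOn (contMDiffOn_symm_of_mem_maximalAtlas (jetChart_mem_maximalAtlas e))
  exact (contMDiffOn_iff_contDiffOn.1 h).contDiffAt ((jetChart e).open_target.mem_nhds hz)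

theorem volLoc_base {x : M} (hx : x ∈ e.base.source) :
    volLoc η e (e.base x) = ContinuousAlternatingMap.compContinuousLinearMap
      (η x : B [⋀^Fin (k + 1)]→L[ℝ] ℝ) (e.dBaseInv x : B →L[ℝ] B) :=
  form_congr η (e.base.left_inv hx) rfl

theorem volLoc_base_apply {x : M} (hx : x ∈ e.base.source) (ξ : Fin (k + 1) → B) :
    volLoc η e (e.base x) ξ = η x (fun i => e.dBaseInv x (ξ i)) := by
  rw [volLoc_base hx]
  rfl

theorem volLoc_ne_zero (hη : IsVolumeForm η) {x : M} (hx : x ∈ e.base.source) :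
    volLoc η e (e.base x) ≠ 0 := by
  intro h
  refine hη.ne_zero x ?_
  ext w
  have h1 := volLoc_base_apply (η := η) hx (fun i => e.dBase x (w i))
  rw [h] at h1
  refine Eq.trans (congrArg (η x) (funext fun i => ?_)) h1.symm
  exact (e.dBaseInv_dBase hx _).symm

/-- `IsVolumeForm` asks for smoothness in the preferred charts only; the chart change to `e.base`
carries it over to adapted charts. -/
theorem contDiffAt_volLoc [FiniteDimensional ℝ B] [IsManifold 𝓘(ℝ, B) ∞ M]
    (hη : IsVolumeForm η) {x : M} (hx : x ∈ e.base.source) :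
    ContDiffAt ℝ ∞ (volLoc η e) (e.base x) := by
  set c := chartAt B x with hc
  have hca : c ∈ IsManifold.maximalAtlas 𝓘(ℝ, B) ∞ M := IsManifold.chart_mem_maximalAtlas x
  have hm := mdifferentiable_of_mem_maximalAtlas hca
  have hxc : x ∈ c.source := mem_chart_source B x
  set U : Set B := e.base.target ∩ e.base.symm ⁻¹' c.source with hU
  have hUo : IsOpen U := e.base.isOpen_inter_preimage_symm c.open_source
  have hxU : e.base x ∈ U := by
    refine ⟨e.base.map_source hx, ?_⟩
    rw [mem_preimage, e.base.left_inv hx]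
    exact hxc
  set φ : B → B := fun u => c (e.base.symm u) with hφ
  have hφs : ContDiffOn ℝ ∞ φ U :=
    contMDiffOn_iff_contDiffOn.1 ((contMDiffOn_of_mem_maximalAtlas hca).comp
      (e.smooth_base_symm.mono inter_subset_left) fun u hu => hu.2)
  have h1 : ContDiffOn ℝ ∞ (fun u => (formInChart η x (φ u)).compContinuousLinearMap
      (fderiv ℝ φ u)) U := by
    refine (contDiff_compContinuousLinearMap (V := B) (W := B) (k + 1)).comp_contDiffOn
      (ContDiffOn.prodMk ?_ ?_)
    · exact (hη.smooth x).comp hφs fun u hu => c.map_source hu.2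
    · exact hφs.fderiv_of_isOpen hUo (by simp)
  refine (h1.contDiffAt (hUo.mem_nhds hxU)).congr_of_eventuallyEq ?_
  filter_upwards [hUo.mem_nhds hxU] with u hu
  have hinv : c.symm (φ u) = e.base.symm u := c.left_inv hu.2
  have hder : (fderiv ℝ φ u : B →L[ℝ] B) = (mfderiv 𝓘(ℝ, B) 𝓘(ℝ, B) c (e.base.symm u)).comp
      (mfderiv 𝓘(ℝ, B) 𝓘(ℝ, B) e.base.symm u) := by
    rw [← mfderiv_eq_fderiv]
    exact mfderiv_comp u (hm.mdifferentiableAt hu.2) (e.mdiff_base.mdifferentiableAt_symm hu.1)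
  rw [hder]
  refine form_congr (W := B) η hinv.symm (A := mfderiv 𝓘(ℝ, B) 𝓘(ℝ, B) e.base.symm u)
    (A' := (mfderiv 𝓘(ℝ, B) 𝓘(ℝ, B) c.symm (φ u)).comp
      ((mfderiv 𝓘(ℝ, B) 𝓘(ℝ, B) c (e.base.symm u)).comp
        (mfderiv 𝓘(ℝ, B) 𝓘(ℝ, B) e.base.symm u))) ?_
  have h5 := hm.symm_comp_deriv hu.2
  ext w
  exact (congrArg (fun f => f (mfderiv 𝓘(ℝ, B) 𝓘(ℝ, B) e.base.symm u w)) h5).symm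

theorem coords_fst_fst {j : Jet1 P} (hj : j.pt ∈ e.tot.source) :
    (Jet1.coords e j).1.1 = e.base (P.proj j.pt) :=
  e.fst_eq _ hj

/-- In natural coordinates `shift` translates the fibre variable by the linear map `shiftCoord`, so
the chain rule applies. -/
theorem fibreDeriv_eq (hL : ContMDiff 𝓘(ℝ, (B × F) × (B →L[ℝ] F)) 𝓘(ℝ) ∞ L)
    {j : Jet1 P} (hj : j.pt ∈ e.tot.source) (A : B →L[ℝ] B × F) :
    fibreDeriv L j A = dvert (lagLoc L e) (Jet1.coords e j) (shiftCoord e j A) := by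
  have h1 : (fun A : B →L[ℝ] B × F => L (j.shift A)) = fun A => lagLoc L e
      (Jet1.coords e j + ContinuousLinearMap.inr ℝ (B × F) (B →L[ℝ] F) (shiftCoord e j A)) := by
    funext A
    have h2 : j.shift A ∈ (jetChart e).source := hj
    rw [lagLoc, ContinuousLinearMap.inr_apply, ← coords_shift, ← jetChart_apply,
      (jetChart e).left_inv h2]
  have hz : (Jet1.coords e j).1 ∈ e.tot.target := e.tot.map_source hj
  have h3 := ((contDiffAt_lagLoc hL hz).differentiableAt (by simp)).hasFDerivAt
  have h4 : HasFDerivAt (fun A : B →L[ℝ] B × F => Jet1.coords e j +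
      ContinuousLinearMap.inr ℝ (B × F) (B →L[ℝ] F) (shiftCoord e j A))
      ((ContinuousLinearMap.inr ℝ (B × F) (B →L[ℝ] F)).comp (shiftCoord e j)) 0 :=
    ((ContinuousLinearMap.inr ℝ (B × F) (B →L[ℝ] F)).comp (shiftCoord e j)).hasFDerivAt.const_add _
  have h5 : Jet1.coords e j + ContinuousLinearMap.inr ℝ (B × F) (B →L[ℝ] F) (shiftCoord e j 0) =
      Jet1.coords e j := by simp
  rw [← h5] at h3
  have h6 := HasFDerivAt.comp (0 : B →L[ℝ] B × F) h3 h4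
  rw [h5] at h6
  unfold fibreDeriv
  rw [h1]
  exact congrArg (fun f => f A) h6.fderiv

/-- The intrinsic coefficient is defined on all tangent vectors of E, while `mom` takes fibre
vectors; the contact component of `w` is what reconciles the two. -/
theorem legendreCoeff_dTotInv (hL : ContMDiff 𝓘(ℝ, (B × F) × (B →L[ℝ] F)) 𝓘(ℝ) ∞ L)
    {j : Jet1 P} (hj : j.pt ∈ e.tot.source) (w : B × F) (ξ : Fin k → B) :
    legendreCoeff L j (η (P.proj j.pt)) (e.dTotInv j.pt w)
      (fun i => e.dBaseInv (P.proj j.pt) (ξ i)) =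
    mom (lagLoc L e) (volLoc η e) (Jet1.coords e j) (w.2 - (Jet1.coords e j).2 w.1) ξ := by
  refine (legendreCoeff_apply L j (η (P.proj j.pt)) (e.dTotInv j.pt w) _).trans
    ((fibreDeriv_eq hL hj _).trans ?_)
  rw [mom, momMap_apply]
  congr 1
  ext x
  refine (shiftCoord_smulRight hj _ w x).trans ?_
  rw [ContinuousLinearMap.smulRight_apply, curryLeft_flipAlternating_apply, coords_fst_fst hj,
    volLoc_base_apply (e.mapsTo _ hj)]
  congr 1
  refine congrArg (η (P.proj j.pt)) (funext fun i => ?_)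
  refine Fin.cases rfl (fun i => rfl) i

/-- `thetaLoc` ignores jet components, so they are set to zero. This one formula yields both the
local form of Θ_L and that of the Legendre map. -/
theorem legendreForm_dTotInv (hL : ContMDiff 𝓘(ℝ, (B × F) × (B →L[ℝ] F)) 𝓘(ℝ) ∞ L)
    {j : Jet1 P} (hj : j.pt ∈ e.tot.source) (w : Fin (k + 1) → B × F) :
    legendreForm L η j (fun i => e.dTotInv j.pt (w i)) =
      thetaLoc (lagLoc L e) (volLoc η e) (Jet1.coords e j) (fun i => (w i, 0)) := by
  have hd : ∀ i, P.dproj j.pt (e.dTotInv j.pt (w i)) = e.dBaseInv (P.proj j.pt) (w i).1 :=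
    fun i => e.dproj_dTotInv hj (w i)
  rw [thetaLoc_apply]
  change L j * η (P.proj j.pt) (fun i => P.dproj j.pt (e.dTotInv j.pt (w i))) +
    ContinuousAlternatingMap.alternatizeUncurryFin
      ((ContinuousAlternatingMap.compContinuousLinearMapCLM (P.dproj j.pt : B × F →L[ℝ] B)).comp
        (legendreCoeff L j (η (P.proj j.pt))) : B × F →L[ℝ] (B × F) [⋀^Fin k]→L[ℝ] ℝ)
        (fun i => e.dTotInv j.pt (w i)) = _
  refine (congrArg (fun r : ℝ => L j * η (P.proj j.pt)
    (fun i => P.dproj j.pt (e.dTotInv j.pt (w i))) + r)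
    (ContinuousAlternatingMap.alternatizeUncurryFin_apply _ _)).trans ?_
  congr 1
  · congr 1
    · rw [lagLoc, ← jetChart_apply, (jetChart e).left_inv hj]
    · rw [coords_fst_fst hj, volLoc_base_apply (e.mapsTo _ hj)]
      exact congrArg (η (P.proj j.pt)) (funext hd)
  · refine Finset.sum_congr rfl fun i _ => ?_
    rw [int_neg_one_pow_smul, ← legendreCoeff_dTotInv hL hj]
    refine congrArg (fun x : ℝ => (-1 : ℝ) ^ (i : ℕ) * x) ?_
    exact congrArg (legendreCoeff L j (η (P.proj j.pt)) (e.dTotInv j.pt (w i)))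
      (funext fun l => hd (i.succAbove l))

/-- The Poincaré-Cartan form in natural coordinates. -/
theorem formIn_thetaL (hL : ContMDiff 𝓘(ℝ, (B × F) × (B →L[ℝ] F)) 𝓘(ℝ) ∞ L)
    {z : (B × F) × (B →L[ℝ] F)} (hz : z.1 ∈ e.tot.target) :
    formIn (jetChart e) (thetaL L η) z = thetaLoc (lagLoc L e) (volLoc η e) z := by
  obtain ⟨j, hj, rfl⟩ : ∃ j : Jet1 P, j.pt ∈ e.tot.source ∧ jetChart e j = z :=
    ⟨(jetChart e).symm z, (jetChart e).map_target hz, (jetChart e).right_inv hz⟩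
  have h1 : formIn (jetChart e) (thetaL L η) (jetChart e j) =
      ContinuousAlternatingMap.compContinuousLinearMap
        (thetaL L η j : ((B × F) × (B →L[ℝ] F)) [⋀^Fin (k + 1)]→L[ℝ] ℝ) (dJetInv e j) :=
    form_congr (thetaL L η) ((jetChart e).left_inv hj) rfl
  rw [h1]
  ext W
  have h2 := legendreForm_dTotInv (η := η) hL hj (fun i => (W i).1)
  refine Eq.trans (Eq.trans ?_ h2) ?_
  · exact congrArg (legendreForm L η j) (funext fun i => mfderiv_pt_dJetInv hj (W i))
  · rfl

theorem volLoc_coords_ne_zero (hη : IsVolumeForm η) {j : Jet1 P} (hj : j.pt ∈ e.tot.source) :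
    volLoc η e (Jet1.coords e j).1.1 ≠ 0 := by
  rw [coords_fst_fst hj]
  exact volLoc_ne_zero hη (e.mapsTo _ hj)

theorem contDiffAt_lagLoc_coords (hL : ContMDiff 𝓘(ℝ, (B × F) × (B →L[ℝ] F)) 𝓘(ℝ) ∞ L)
    {j : Jet1 P} (hj : j.pt ∈ e.tot.source) : ContDiffAt ℝ ∞ (lagLoc L e) (Jet1.coords e j) :=
  contDiffAt_lagLoc hL (e.tot.map_source hj)

theorem formIn_thetaL_eventuallyEq (hL : ContMDiff 𝓘(ℝ, (B × F) × (B →L[ℝ] F)) 𝓘(ℝ) ∞ L)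
    {j : Jet1 P} (hj : j.pt ∈ e.tot.source) : formIn (jetChart e) (thetaL L η) =ᶠ[𝓝 (jetChart e j)]
      thetaLoc (lagLoc L e) (volLoc η e) := by
  filter_upwards [(jetChart e).open_target.mem_nhds ((jetChart e).map_source hj)] with z hz
  exact formIn_thetaL hL hz

/-- The Legendre map in natural coordinates. -/
theorem coords_legendre (hL : ContMDiff 𝓘(ℝ, (B × F) × (B →L[ℝ] F)) 𝓘(ℝ) ∞ L)
    {j : Jet1 P} (hj : j.pt ∈ e.tot.source) :
    Multimomentum.coords e (legendre L η j) =
      ((Jet1.coords e j).1, mom (lagLoc L e) (volLoc η e) (Jet1.coords e j)) := by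
  refine (Multimomentum.coords_mk e hj (legendreForm L η j) _).trans (Prod.ext rfl ?_)
  ext u ξ
  have h1 := legendreForm_dTotInv (η := η) hL hj (Matrix.vecCons ((0 : B), u) fun i => (ξ i, 0))
  refine (momentumCoeff_apply _ u ξ).trans (h1.trans ?_)
  -- With one vertical argument the volume term vanishes, and so does every term of the sum that
  -- keeps this argument in the k-form; only the term i = 0 remains.
  rw [thetaLoc_apply, ContinuousAlternatingMap.map_coord_zero _ 0 rfl, mul_zero, zero_add,
    Fin.sum_univ_succ, Finset.sum_eq_zero, add_zero]
  · simp only [Fin.val_zero, pow_zero, one_mul, Matrix.cons_val_zero, map_zero, sub_zero]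
    rfl
  · intro i _
    obtain _ | k := k
    · exact i.elim0
    · rw [ContinuousAlternatingMap.map_coord_zero _ 0 (by simp [Fin.removeNth]), mul_zero]

variable [FiniteDimensional ℝ B] [IsManifold 𝓘(ℝ, B) ∞ M]

theorem contDiffAt_volLoc_coords (hη : IsVolumeForm η) {j : Jet1 P} (hj : j.pt ∈ e.tot.source) :
    ContDiffAt ℝ ∞ (volLoc η e) (Jet1.coords e j).1.1 := by
  rw [coords_fst_fst hj]
  exact contDiffAt_volLoc hη (e.mapsTo _ hj)

variable [FiniteDimensional ℝ F]

theorem differentiableAt_formIn_thetaL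
    (hL : ContMDiff 𝓘(ℝ, (B × F) × (B →L[ℝ] F)) 𝓘(ℝ) ∞ L) (hη : IsVolumeForm η)
    {j : Jet1 P} (hj : j.pt ∈ e.tot.source) :
    DifferentiableAt ℝ (formIn (jetChart e) (thetaL L η)) (jetChart e j) :=
  ((contDiffAt_thetaLoc (contDiffAt_lagLoc_coords hL hj)
    (contDiffAt_volLoc_coords hη hj)).differentiableAt (by simp)).congr_of_eventuallyEq
      (formIn_thetaL_eventuallyEq hL hj)

/-- The Poincaré-Cartan `(m+1)`-form in natural coordinates. -/
theorem omegaL_apply (hL : ContMDiff 𝓘(ℝ, (B × F) × (B →L[ℝ] F)) 𝓘(ℝ) ∞ L) (hη : IsVolumeForm η)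
    {j : Jet1 P} (hj : j.pt ∈ e.tot.source)
    (W : Fin (k + 1 + 1) → TangentSpace 𝓘(ℝ, (B × F) × (B →L[ℝ] F)) j) :
    omegaL L η j W = - extDeriv (thetaLoc (lagLoc L e) (volLoc η e)) (Jet1.coords e j)
      (fun i => dJet e j (W i)) := by
  have h := extD_eq_chart (jetChart_mem_maximalAtlas e) hj
    (differentiableAt_formIn_thetaL (η := η) hL hη hj)
  rw [(formIn_thetaL_eventuallyEq hL hj).extDeriv_eq] at h
  exact congrArg (fun f => -f W) h

end LocalExpressions

/-! ### Wedge products with a 1-form, and kernels of forms -/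

section Wedge

variable {T T' : Type*} [AddCommGroup T] [Module ℝ T] [AddCommGroup T'] [Module ℝ T'] {d : ℕ}

theorem wedgeOne_apply (σ : T [⋀^Fin d]→ₗ[ℝ] ℝ) (γ : T →ₗ[ℝ] ℝ) (v : Fin (d + 1) → T) :
    wedgeOne σ γ v = (-1 : ℝ) ^ d * ∑ i : Fin (d + 1), (-1 : ℝ) ^ (i : ℕ) *
      (γ (v i) * σ (i.removeNth v)) := by
  change (-1 : ℝ) ^ d * AlternatingMap.alternatizeUncurryFin (γ.smulRight σ) v = _
  rw [AlternatingMap.alternatizeUncurryFin_apply]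
  congr 1
  refine Finset.sum_congr rfl fun i _ => ?_
  rw [int_neg_one_pow_smul]
  rfl

/-- `γ` can absorb only one of the two vectors killed by `D`; the other is left in `σ`, which
vanishes on it. -/
theorem wedgeOne_eq_zero {σ : T [⋀^Fin d]→ₗ[ℝ] ℝ} (γ : T →ₗ[ℝ] ℝ) {D : T →ₗ[ℝ] T'}
    (hσ : ∀ w i, D (w i) = 0 → σ w = 0) {v : Fin (d + 1) → T} {a b : Fin (d + 1)} (hab : a ≠ b)
    (ha : D (v a) = 0) (hb : D (v b) = 0) : wedgeOne σ γ v = 0 := by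
  rw [wedgeOne_apply, Finset.sum_eq_zero, mul_zero]
  intro i _
  have : ∃ c, c ≠ i ∧ D (v c) = 0 := by
    by_cases h : a = i
    · exact ⟨b, fun h' => hab (h.trans h'.symm), hb⟩
    · exact ⟨a, h, ha⟩
  obtain ⟨c, hc, hc0⟩ := this
  obtain ⟨c', rfl⟩ := Fin.exists_succAbove_eq hc
  rw [hσ (i.removeNth v) c' hc0, mul_zero, mul_zero]

theorem apply_eq_zero_of_cons {φ : T [⋀^Fin (d + 1)]→ₗ[ℝ] ℝ} {w : T}
    (h : ∀ v, φ (Matrix.vecCons w v) = 0) {V : Fin (d + 1) → T} {i : Fin (d + 1)} (hV : V i = w) :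
    φ V = 0 := by
  have h1 := φ.map_insertNth i w (i.removeNth V)
  rw [← hV, Fin.insertNth_self_removeNth, hV, h, smul_zero] at h1
  exact h1

theorem curryLeft_injective_iff {φ : T [⋀^Fin (d + 1)]→ₗ[ℝ] ℝ} :
    Function.Injective φ.curryLeft ↔ ∀ w, (∀ v, φ (Matrix.vecCons w v) = 0) → w = 0 := by
  rw [injective_iff_map_eq_zero]
  refine forall_congr' fun w => ⟨fun h hv => h (AlternatingMap.ext hv), fun h hw => h fun v => ?_⟩
  exact congrArg (fun f => f v) hw

end Wedge

/-! ### Consequences of regularity: the Hessian and the modified forms -/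

section Regular

set_option maxSynthPendingDepth 3

variable {B F M E : Type*}
  [NormedAddCommGroup B] [NormedSpace ℝ B] [FiniteDimensional ℝ B]
  [NormedAddCommGroup F] [NormedSpace ℝ F] [FiniteDimensional ℝ F]
  [TopologicalSpace M] [ChartedSpace B M] [IsManifold 𝓘(ℝ, B) ∞ M]
  [TopologicalSpace E] [ChartedSpace (B × F) E]
  {P : FibredManifold B F M E} {k : ℕ}
  {L : Jet1 P → ℝ} {η : ∀ x : M, TangentSpace 𝓘(ℝ, B) x [⋀^Fin (k + 1)]→L[ℝ] ℝ}
  {e : AdaptedChart P}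

/-- The tangent map of the natural chart is bijective, so the kernel condition on Ω_L transfers to
the coordinate form; the sign in Ω = -dΘ is irrelevant. -/
theorem nondegenerate_thetaLoc (hL : ContMDiff 𝓘(ℝ, (B × F) × (B →L[ℝ] F)) 𝓘(ℝ) ∞ L)
    (hη : IsVolumeForm η) (hreg : IsRegularLagrangian L η) {j : Jet1 P} (hj : j.pt ∈ e.tot.source)
    (W : (B × F) × (B →L[ℝ] F)) (hW : ∀ V, extDeriv (thetaLoc (lagLoc L e) (volLoc η e))
      (Jet1.coords e j) (Matrix.vecCons W V) = 0) : W = 0 := by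
  have h := curryLeft_injective_iff.1 (hreg j (mem_univ j)) (dJetInv e j W) fun v => by
    refine (omegaL_apply hL hη hj _).trans (neg_eq_zero.2 ?_)
    rw [← hW fun i => dJet e j (v i)]
    refine congrArg _ (funext fun i => ?_)
    exact Fin.cases (dJet_dJetInv hj W) (fun i => rfl) i
  rw [← dJet_dJetInv hj W, h]
  exact map_zero _

theorem hess_lagLoc_injective (hdim : Module.finrank ℝ B = k + 1)
    (hL : ContMDiff 𝓘(ℝ, (B × F) × (B →L[ℝ] F)) 𝓘(ℝ) ∞ L)
    (hη : IsVolumeForm η) (hreg : IsRegularLagrangian L η) {j : Jet1 P} (hj : j.pt ∈ e.tot.source)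
    (a : B →L[ℝ] F) (ha : hess (lagLoc L e) (Jet1.coords e j) a = 0) : a = 0 :=
  hess_injective_of_nondegenerate hdim (contDiffAt_lagLoc_coords hL hj)
    (contDiffAt_volLoc_coords hη hj) (nondegenerate_thetaLoc hL hη hreg hj) ha

/-- If the Lagrangian is regular, then `Ω_L - ω ∧ γ` is `1`-nondegenerate for all `γ`. -/
theorem omegaL_sub_wedge_injective (hk : 1 ≤ k) (hdim : Module.finrank ℝ B = k + 1)
    (hL : ContMDiff 𝓘(ℝ, (B × F) × (B →L[ℝ] F)) 𝓘(ℝ) ∞ L)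
    (hη : IsVolumeForm η) (hreg : IsRegularLagrangian L η) (j : Jet1 P)
    (γ : TangentSpace 𝓘(ℝ, (B × F) × (B →L[ℝ] F)) j →ₗ[ℝ] ℝ) :
    Function.Injective ((omegaL L η j).toAlternatingMap -
      wedgeOne ((η j.toBase).compContinuousLinearMap
        (mfderiv 𝓘(ℝ, (B × F) × (B →L[ℝ] F)) 𝓘(ℝ, B) Jet1.toBase j)).toAlternatingMap
        γ).curryLeft := by
  obtain ⟨e, he⟩ := P.exists_adaptedChart j.pt
  have hj : j.pt ∈ e.tot.source := he ▸ e.ctr_mem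
  have hnd := nondegenerate_thetaLoc hL hη hreg hj
  have hF := nontrivial_fibre_of_nondegenerate hdim hnd
  refine curryLeft_injective_iff.2 fun W hW => ?_
  -- The correction ω ∧ γ vanishes on any tuple with two vertical entries, wherever W itself stands.
  -- On those tuples the hypothesis therefore concerns Ω_L alone, which suffices by
  -- `eq_zero_of_extDeriv_thetaLoc_vertical`.
  have h0 : dJet e j W = 0 := by
    refine eq_zero_of_extDeriv_thetaLoc_vertical hdim hk (contDiffAt_lagLoc_coords hL hj)
      (contDiffAt_volLoc_coords hη hj) (volLoc_coords_ne_zero hη hj)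
      (hess_lagLoc_injective hdim hL hη hreg hj) _ fun V ⟨i, hi⟩ hV0 hV1 => ?_
    have hV : ∀ i, dJet e j (dJetInv e j (V i)) = V i := fun i => dJet_dJetInv hj _
    have h1 := apply_eq_zero_of_cons hW (V := fun i => dJetInv e j (V i)) (i := i)
      (by rw [hi, dJetInv_dJet hj])
    have hker : ∀ i, (V i).1.1 = 0 → mfderiv 𝓘(ℝ, (B × F) × (B →L[ℝ] F)) 𝓘(ℝ, B) Jet1.toBase j
        (dJetInv e j (V i)) = 0 := fun i hi => by
      rw [mfderiv_toBase_eq hj, hV, hi]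
      exact map_zero _
    have h2 := wedgeOne_eq_zero (σ := ((η j.toBase).compContinuousLinearMap
        (mfderiv 𝓘(ℝ, (B × F) × (B →L[ℝ] F)) 𝓘(ℝ, B) Jet1.toBase j)).toAlternatingMap) γ
      (D := (mfderiv 𝓘(ℝ, (B × F) × (B →L[ℝ] F)) 𝓘(ℝ, B) Jet1.toBase j).toLinearMap)
      (fun w i hi => (η j.toBase).map_coord_zero i hi)
      (v := fun i => dJetInv e j (V i)) (a := 0) (b := 1) (by simp) (hker 0 hV0) (hker 1 hV1)
    have h3 : omegaL L η j (fun i => dJetInv e j (V i)) = 0 := by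
      rw [AlternatingMap.sub_apply, h2, sub_zero] at h1
      exact h1
    rw [omegaL_apply hL hη hj, neg_eq_zero] at h3
    rw [← h3]
    exact congrArg _ (funext fun i => (hV i).symm)
  rw [← dJetInv_dJet hj W, h0]
  exact map_zero _

end Regular

/-! ### The Legendre map is a local diffeomorphism -/

section LegendreDiffeo

set_option maxSynthPendingDepth 3

variable {B F M E : Type*}
  [NormedAddCommGroup B] [NormedSpace ℝ B] [FiniteDimensional ℝ B]
  [NormedAddCommGroup F] [NormedSpace ℝ F] [FiniteDimensional ℝ F]
  [TopologicalSpace M] [ChartedSpace B M]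
  [TopologicalSpace E] [ChartedSpace (B × F) E]
  {P : FibredManifold B F M E} {k : ℕ}
  {L : Jet1 P → ℝ} {η : ∀ x : M, TangentSpace 𝓘(ℝ, B) x [⋀^Fin (k + 1)]→L[ℝ] ℝ}

/-- The natural chart of the multimomentum bundle, as a chart of its manifold structure. -/
def momentumChart (k : ℕ) (e : AdaptedChart P) :
    OpenPartialHomeomorph (Multimomentum P k) ((B × F) × (F →L[ℝ] B [⋀^Fin k]→L[ℝ] ℝ)) :=
  (Multimomentum.core P k).openPartialHomeomorph (Multimomentum.natChart k e) (mem_range_self e)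

theorem momentumChart_mem_maximalAtlas (e : AdaptedChart P) : momentumChart k e ∈
    IsManifold.maximalAtlas 𝓘(ℝ, (B × F) × (F →L[ℝ] B [⋀^Fin k]→L[ℝ] ℝ)) ∞ (Multimomentum P k) := by
  refine IsManifold.subset_maximalAtlas ?_
  exact mem_iUnion₂.2 ⟨Multimomentum.natChart k e, mem_range_self e, rfl⟩

/-- The Legendre map in natural coordinates. -/
def legLoc (L : Jet1 P → ℝ) (η : ∀ x : M, TangentSpace 𝓘(ℝ, B) x [⋀^Fin (k + 1)]→L[ℝ] ℝ)
    (e : AdaptedChart P) (z : (B × F) × (B →L[ℝ] F)) :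
    (B × F) × (F →L[ℝ] B [⋀^Fin k]→L[ℝ] ℝ) :=
  (z.1, mom (lagLoc L e) (volLoc η e) z)

variable {e : AdaptedChart P} [IsManifold 𝓘(ℝ, B) ∞ M]

theorem contDiffAt_legLoc (hL : ContMDiff 𝓘(ℝ, (B × F) × (B →L[ℝ] F)) 𝓘(ℝ) ∞ L)
    (hη : IsVolumeForm η) {j : Jet1 P} (hj : j.pt ∈ e.tot.source) :
    ContDiffAt ℝ ∞ (legLoc L η e) (Jet1.coords e j) :=
  contDiff_fst.contDiffAt.prodMk
    (contDiffAt_mom (contDiffAt_lagLoc_coords hL hj) (contDiffAt_volLoc_coords hη hj))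

/-- The differential is block triangular, with the identity on (x, y) and the invertible fibre
derivative of `mom` on the jet component. -/
theorem exists_hasFDerivAt_legLoc (hdim : Module.finrank ℝ B = k + 1)
    (hL : ContMDiff 𝓘(ℝ, (B × F) × (B →L[ℝ] F)) 𝓘(ℝ) ∞ L)
    (hη : IsVolumeForm η) (hreg : IsRegularLagrangian L η) {j : Jet1 P}
    (hj : j.pt ∈ e.tot.source) :
    ∃ A : ((B × F) × (B →L[ℝ] F)) ≃L[ℝ] (B × F) × (F →L[ℝ] B [⋀^Fin k]→L[ℝ] ℝ),
      HasFDerivAt (legLoc L η e)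
        (A : ((B × F) × (B →L[ℝ] F)) →L[ℝ] (B × F) × (F →L[ℝ] B [⋀^Fin k]→L[ℝ] ℝ))
        (Jet1.coords e j) := by
  have hl := contDiffAt_lagLoc_coords hL hj
  have hN := contDiffAt_volLoc_coords hη hj
  have hn := volLoc_coords_ne_zero hη hj
  have hh := hess_lagLoc_injective hdim hL hη hreg hj
  let D : ((B × F) × (B →L[ℝ] F)) →L[ℝ] (B × F) × (F →L[ℝ] B [⋀^Fin k]→L[ℝ] ℝ) :=
    (ContinuousLinearMap.fst ℝ (B × F) (B →L[ℝ] F)).prod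
      (fderiv ℝ (mom (lagLoc L e) (volLoc η e)) (Jet1.coords e j))
  have hD : HasFDerivAt (legLoc L η e) D (Jet1.coords e j) :=
    hasFDerivAt_fst.prodMk ((contDiffAt_mom hl hN).differentiableAt (by simp)).hasFDerivAt
  have hbij : Function.Bijective D := by
    constructor
    · refine (injective_iff_map_eq_zero D).2 fun w hw => ?_
      have h1 : w.1 = 0 := congrArg Prod.fst hw
      have h2 : fderiv ℝ (mom (lagLoc L e) (volLoc η e)) (Jet1.coords e j) w = 0 :=
        congrArg Prod.snd hw
      obtain ⟨w1, a⟩ := w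
      subst h1
      rw [eq_zero_of_fderiv_mom_vertical hdim hl hN hn hh h2]
      rfl
    · rintro ⟨w, q⟩
      obtain ⟨a, ha⟩ := exists_fderiv_mom_eq hdim hl hN hn hh w q
      exact ⟨(w, a), Prod.ext rfl ha⟩
  exact ⟨(LinearEquiv.ofBijective D.toLinearMap hbij).toContinuousLinearEquiv, hD⟩

theorem contMDiff_legendre (hL : ContMDiff 𝓘(ℝ, (B × F) × (B →L[ℝ] F)) 𝓘(ℝ) ∞ L)
    (hη : IsVolumeForm η) : ContMDiff 𝓘(ℝ, (B × F) × (B →L[ℝ] F))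
      𝓘(ℝ, (B × F) × (F →L[ℝ] B [⋀^Fin k]→L[ℝ] ℝ)) ∞ (legendre L η) := by
  intro j
  obtain ⟨e, he⟩ := P.exists_adaptedChart j.pt
  have hj : j.pt ∈ e.tot.source := he ▸ e.ctr_mem
  have h1 : ContMDiffAt 𝓘(ℝ, (B × F) × (B →L[ℝ] F))
      𝓘(ℝ, (B × F) × (F →L[ℝ] B [⋀^Fin k]→L[ℝ] ℝ)) ∞
      (fun j => legLoc L η e (jetChart e j)) j :=
    (contDiffAt_legLoc hL hη hj).contMDiffAt.comp j
      ((contMDiffOn_of_mem_maximalAtlas (jetChart_mem_maximalAtlas e)).contMDiffAt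
        ((jetChart e).open_source.mem_nhds hj))
  have ht : legLoc L η e (jetChart e j) ∈ (momentumChart k e).target := e.tot.map_source hj
  have h2 := ((contMDiffOn_symm_of_mem_maximalAtlas (momentumChart_mem_maximalAtlas e)).contMDiffAt
    ((momentumChart k e).open_target.mem_nhds ht)).comp j h1
  refine h2.congr_of_eventuallyEq ?_
  filter_upwards [(jetChart e).open_source.mem_nhds hj] with j' hj'
  have h3 : momentumChart k e (legendre L η j') = legLoc L η e (jetChart e j') :=
    coords_legendre hL hj'
  have h4 : legendre L η j' ∈ (momentumChart k e).source := hj'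
  exact (((momentumChart k e).left_inv h4).symm.trans (congrArg _ h3))

/-- The Legendre map of a regular Lagrangian is a local diffeomorphism. -/
theorem isLocalDiffeomorph_legendre (hdim : Module.finrank ℝ B = k + 1)
    (hL : ContMDiff 𝓘(ℝ, (B × F) × (B →L[ℝ] F)) 𝓘(ℝ) ∞ L)
    (hη : IsVolumeForm η) (hreg : IsRegularLagrangian L η) :
    IsLocalDiffeomorph 𝓘(ℝ, (B × F) × (B →L[ℝ] F))
      𝓘(ℝ, (B × F) × (F →L[ℝ] B [⋀^Fin k]→L[ℝ] ℝ)) ∞ (legendre L η) := by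
  intro j
  obtain ⟨e, he⟩ := P.exists_adaptedChart j.pt
  have hj : j.pt ∈ e.tot.source := he ▸ e.ctr_mem
  obtain ⟨A, hA⟩ := exists_hasFDerivAt_legLoc hdim hL hη hreg hj
  -- The inverse function theorem in coordinates; conjugating with the natural charts gives the
  -- local inverse on the manifolds.
  let Ψ := (contDiffAt_legLoc hL hη hj).toOpenPartialHomeomorph (legLoc L η e) hA (by simp)
  have hΨ : ∀ z, Ψ z = legLoc L η e z := fun z => rfl
  have hΨj : jetChart e j ∈ Ψ.source :=
    (contDiffAt_legLoc hL hη hj).mem_toOpenPartialHomeomorph_source hA (by simp)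
  let G := ((jetChart e).trans Ψ).trans (momentumChart k e).symm
  have hGs : ∀ j' ∈ G.source, j'.pt ∈ e.tot.source ∧ jetChart e j' ∈ Ψ.source :=
    fun j' hj' => hj'.1
  have hG : ∀ j' ∈ G.source, legendre L η j' = G j' := fun j' hj' => by
    have h3 : momentumChart k e (legendre L η j') = legLoc L η e (jetChart e j') :=
      coords_legendre hL (hGs j' hj').1
    have h4 : legendre L η j' ∈ (momentumChart k e).source := (hGs j' hj').1
    exact (((momentumChart k e).left_inv h4).symm.trans (congrArg _ h3))
  refine ⟨{ toPartialEquiv := G.toPartialEquiv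
            open_source := G.open_source
            open_target := G.open_target
            contMDiffOn_toFun := ?_
            contMDiffOn_invFun := ?_ }, ?_, hG⟩
  · exact (contMDiff_legendre hL hη).contMDiffOn.congr fun j' hj' => (hG j' hj').symm
  · intro q hq
    have hq1 : q ∈ (momentumChart k e).source := hq.1
    have hq2 : momentumChart k e q ∈ Ψ.target := hq.2.1
    have hq3 : Ψ.symm (momentumChart k e q) ∈ (jetChart e).target := hq.2.2
    have hc : Jet1.coords e ((jetChart e).symm (Ψ.symm (momentumChart k e q))) =
        Ψ.symm (momentumChart k e q) := (jetChart e).right_inv hq3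
    have hp : ((jetChart e).symm (Ψ.symm (momentumChart k e q))).pt ∈ e.tot.source :=
      (jetChart e).map_target hq3
    -- Smoothness of the inverse is needed on the whole target. At each of its points it follows
    -- from invertibility of the differential at the corresponding jet, regularity being assumed
    -- everywhere.
    obtain ⟨A', hA'⟩ := exists_hasFDerivAt_legLoc hdim hL hη hreg hp
    have hs := contDiffAt_legLoc hL hη hp
    rw [hc] at hA' hs
    have h1 := Ψ.contDiffAt_symm hq2 hA' hs
    have h2 := h1.contMDiffAt.comp q
      ((contMDiffOn_of_mem_maximalAtlas (momentumChart_mem_maximalAtlas e)).contMDiffAt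
        ((momentumChart k e).open_source.mem_nhds hq1))
    exact (((contMDiffOn_symm_of_mem_maximalAtlas (jetChart_mem_maximalAtlas e)).contMDiffAt
      ((jetChart e).open_target.mem_nhds hq3)).comp q h2).contMDiffWithinAt
  · refine ⟨⟨hj, hΨj⟩, ?_⟩
    exact e.tot.map_source hj

end LegendreDiffeo

/-! ### Solving the Euler-Lagrange equations in coordinates -/

section LocalEulerLagrange

set_option maxSynthPendingDepth 3

variable {B F : Type*}
  [NormedAddCommGroup B] [NormedSpace ℝ B]
  [NormedAddCommGroup F] [NormedSpace ℝ F] [FiniteDimensional ℝ F] {k : ℕ}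
  {l : (B × F) × (B →L[ℝ] F) → ℝ} {N : B → B [⋀^Fin (k + 1)]→L[ℝ] ℝ}
  {z : (B × F) × (B →L[ℝ] F)} {b : Fin (k + 1) → B}

/-- The part of the Euler-Lagrange operator that does not depend on second derivatives. -/
def elRhs (l : (B × F) × (B →L[ℝ] F) → ℝ) (N : B → B [⋀^Fin (k + 1)]→L[ℝ] ℝ)
    (b : Fin (k + 1) → B) (z : (B × F) × (B →L[ℝ] F)) : F →L[ℝ] ℝ :=
  LinearMap.toContinuousLinearMap
    { toFun := fun u => fderiv ℝ l z (((0 : B), u), 0) * N z.1.1 b -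
        ∑ i : Fin (k + 1), (-1 : ℝ) ^ (i : ℕ) *
          fderiv ℝ (mom l N) z ((b i, z.2 (b i)), 0) u (i.removeNth b)
      map_add' := fun u u' => by
        have h : (((0 : B), u + u'), (0 : B →L[ℝ] F)) = (((0 : B), u), 0) + (((0 : B), u'), 0) := by
          simp
        simp only [h, map_add, ContinuousAlternatingMap.add_apply, mul_add, Finset.sum_add_distrib]
        ring
      map_smul' := fun c u => by
        have h : (((0 : B), c • u), (0 : B →L[ℝ] F)) = c • (((0 : B), u), (0 : B →L[ℝ] F)) := by
          simp
        simp only [h, map_smul, ContinuousAlternatingMap.smul_apply, smul_eq_mul, RingHom.id_apply,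
          mul_sub, Finset.mul_sum]
        congr 1
        · ring
        · exact Finset.sum_congr rfl fun i _ => by ring }

theorem elRhs_apply (u : F) : elRhs l N b z u = fderiv ℝ l z (((0 : B), u), 0) * N z.1.1 b -
    ∑ i : Fin (k + 1), (-1 : ℝ) ^ (i : ℕ) *
      fderiv ℝ (mom l N) z ((b i, z.2 (b i)), 0) u (i.removeNth b) := rfl

variable [FiniteDimensional ℝ B]

theorem contDiffAt_elRhs (hl : ContDiffAt ℝ ∞ l z) (hN : ContDiffAt ℝ ∞ N z.1.1) :
    ContDiffAt ℝ ∞ (elRhs l N b) z := by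
  refine contDiffAt_clm fun u => ?_
  simp only [elRhs_apply]
  have h1 : ContDiffAt ℝ ∞ (fderiv ℝ l) z := hl.fderiv_right (by simp)
  have h2 : ContDiffAt ℝ ∞ (fderiv ℝ (mom l N)) z := (contDiffAt_mom hl hN).fderiv_right (by simp)
  refine ((h1.clm_apply contDiffAt_const).mul (contDiffAt_evalBase hN b)).sub
    (ContDiffAt.sum fun i _ => contDiffAt_const.mul ?_)
  have h3 : ContDiffAt ℝ ∞ (fun z : (B × F) × (B →L[ℝ] F) =>
      (((b i, z.2 (b i)), 0) : (B × F) × (B →L[ℝ] F))) z :=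
    (contDiffAt_const.prodMk (contDiffAt_snd.clm_apply contDiffAt_const)).prodMk contDiffAt_const
  have h4 := (h2.clm_apply h3).clm_apply (contDiffAt_const (c := u))
  let ev : (B [⋀^Fin k]→L[ℝ] ℝ) →ₗ[ℝ] ℝ :=
    { toFun := fun f => f (i.removeNth b), map_add' := fun _ _ => rfl, map_smul' := fun _ _ => rfl }
  exact (LinearMap.toContinuousLinearMap ev).contDiff.contDiffAt.comp z h4

/-- The second order part of a solution of the Euler-Lagrange equations. -/
def elSol (l : (B × F) × (B →L[ℝ] F) → ℝ) (N : B → B [⋀^Fin (k + 1)]→L[ℝ] ℝ)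
    (b : Fin (k + 1) → B) (z : (B × F) × (B →L[ℝ] F)) : B →L[ℝ] B →L[ℝ] F :=
  (((k : ℝ) + 1) * N z.1.1 b)⁻¹ • (hess l z).inverse.comp
    ((ContinuousLinearMap.compL ℝ (B →L[ℝ] F) F ℝ (elRhs l N b z)).comp
      (ContinuousLinearMap.apply ℝ F))

/-- `elSol` distributes the required right side `elRhs` equally over the m = k + 1 directions of the
frame, whence the factor 1/(k + 1). Division by N(b) compensates the volume that reappears when the
momenta are evaluated on the frame. -/
theorem hess_elSol (hreg : ∀ a, hess l z a = 0 → a = 0) (x : B) (A : B →L[ℝ] F) :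
    hess l z (elSol l N b z x) A = (((k : ℝ) + 1) * N z.1.1 b)⁻¹ * elRhs l N b z (A x) := by
  let H : (B →L[ℝ] F) ≃L[ℝ] ((B →L[ℝ] F) →L[ℝ] ℝ) :=
    (LinearEquiv.ofBijective (hess l z).toLinearMap (hess_bijective hreg)).toContinuousLinearEquiv
  have hH : hess l z = (H : (B →L[ℝ] F) →L[ℝ] ((B →L[ℝ] F) →L[ℝ] ℝ)) := rfl
  unfold elSol
  rw [hH, ContinuousLinearMap.inverse_equiv]
  simp

/-- `ContinuousLinearMap.inverse` is a total function with junk value zero; it is smooth at the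
Hessian because the Hessian is invertible there. -/
theorem contDiffAt_elSol (hl : ContDiffAt ℝ ∞ l z) (hN : ContDiffAt ℝ ∞ N z.1.1)
    (hb : N z.1.1 b ≠ 0) (hreg : ∀ a, hess l z a = 0 → a = 0) :
    ContDiffAt ℝ ∞ (elSol l N b) z := by
  let H : (B →L[ℝ] F) ≃L[ℝ] ((B →L[ℝ] F) →L[ℝ] ℝ) :=
    (LinearEquiv.ofBijective (hess l z).toLinearMap (hess_bijective hreg)).toContinuousLinearEquiv
  have hH : hess l z = (H : (B →L[ℝ] F) →L[ℝ] ((B →L[ℝ] F) →L[ℝ] ℝ)) := rfl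
  have h1 : ContDiffAt ℝ ∞ (fun z => (hess l z).inverse) z := by
    have := contDiffAt_map_inverse (n := ∞) H
    rw [← hH] at this
    exact this.comp z (contDiffAt_hess hl)
  have h2 : ContDiffAt ℝ ∞
      (fun z => ContinuousLinearMap.compL ℝ (B →L[ℝ] F) F ℝ (elRhs l N b z)) z :=
    (ContinuousLinearMap.contDiff _).contDiffAt.comp z (contDiffAt_elRhs hl hN)
  refine ContDiffAt.smul (ContDiffAt.inv (contDiffAt_const.mul (contDiffAt_evalBase hN b)) ?_)
    (h1.clm_comp (h2.clm_comp contDiffAt_const))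
  exact mul_ne_zero (by positivity) hb

/-- The Euler-Lagrange equations for `elSol`. -/
theorem sum_fderiv_mom_elSol (hl : ContDiffAt ℝ ∞ l z) (hN : ContDiffAt ℝ ∞ N z.1.1)
    (hb : N z.1.1 b ≠ 0) (hreg : ∀ a, hess l z a = 0 → a = 0) (u : F) :
    ∑ i : Fin (k + 1), (-1 : ℝ) ^ (i : ℕ) *
      fderiv ℝ (mom l N) z ((b i, z.2 (b i)), elSol l N b z (b i)) u (i.removeNth b) =
    fderiv ℝ l z (((0 : B), u), 0) * N z.1.1 b := by
  -- Moving b_i back to its place in N costs the sign (-1)^i, which the sign in the Euler-Lagrange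
  -- sum undoes. Each direction thus contributes the same share of `elRhs`.
  have h1 : ∀ i : Fin (k + 1), fderiv ℝ (mom l N) z ((0 : B × F), elSol l N b z (b i)) u
      (i.removeNth b) = (-1 : ℝ) ^ (i : ℕ) * (((k : ℝ) + 1)⁻¹ * elRhs l N b z u) := by
    intro i
    rw [fderiv_mom_vertical hl hN, momMap_apply, hess_elSol hreg]
    have h2 := (N z.1.1).map_insertNth i (b i) (i.removeNth b)
    rw [Fin.insertNth_self_removeNth, int_neg_one_pow_smul] at h2
    have h3 : N z.1.1 (Matrix.vecCons (b i) (i.removeNth b)) = (-1 : ℝ) ^ (i : ℕ) * N z.1.1 b := by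
      rw [h2, smul_eq_mul, ← mul_assoc, ← mul_pow]; simp
    rw [ContinuousLinearMap.smulRight_apply, curryLeft_flipAlternating_apply, h3, map_smul,
      smul_eq_mul]
    field_simp
  have h4 : ∀ i : Fin (k + 1), (-1 : ℝ) ^ (i : ℕ) *
      fderiv ℝ (mom l N) z ((b i, z.2 (b i)), elSol l N b z (b i)) u (i.removeNth b) =
      (-1 : ℝ) ^ (i : ℕ) * fderiv ℝ (mom l N) z ((b i, z.2 (b i)), 0) u (i.removeNth b) +
        ((k : ℝ) + 1)⁻¹ * elRhs l N b z u := by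
    intro i
    have h5 : (((b i, z.2 (b i)), elSol l N b z (b i)) : (B × F) × (B →L[ℝ] F)) =
        ((b i, z.2 (b i)), 0) + ((0 : B × F), elSol l N b z (b i)) := by simp
    rw [h5, map_add]
    have h6 : (-1 : ℝ) ^ (i : ℕ) * (-1 : ℝ) ^ (i : ℕ) = 1 := by rw [← mul_pow]; simp
    have h7 := h1 i
    calc _ = (-1 : ℝ) ^ (i : ℕ) * (fderiv ℝ (mom l N) z ((b i, z.2 (b i)), 0) u (i.removeNth b) +
          fderiv ℝ (mom l N) z ((0 : B × F), elSol l N b z (b i)) u (i.removeNth b)) := rfl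
      _ = _ := by
        rw [h7, mul_add, ← mul_assoc ((-1 : ℝ) ^ (i : ℕ)) ((-1 : ℝ) ^ (i : ℕ)), h6, one_mul]
  rw [Finset.sum_congr rfl fun i _ => h4 i, Finset.sum_add_distrib, Finset.sum_const,
    Finset.card_univ, Fintype.card_fin, nsmul_eq_mul, elRhs_apply]
  push_cast
  have hk : (k : ℝ) + 1 ≠ 0 := by positivity
  rw [mul_inv_cancel_left₀ hk]
  ring

end LocalEulerLagrange

/-! ### Semi-holonomic lifts and the affine structure of solutions -/

section EulerLagrangeLifts

set_option maxSynthPendingDepth 3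

variable {B F M E : Type*}
  [NormedAddCommGroup B] [NormedSpace ℝ B]
  [NormedAddCommGroup F] [NormedSpace ℝ F]
  [TopologicalSpace M] [ChartedSpace B M]
  [TopologicalSpace E] [ChartedSpace (B × F) E]
  {P : FibredManifold B F M E} {k : ℕ}
  {L : Jet1 P → ℝ} {η : ∀ x : M, TangentSpace 𝓘(ℝ, B) x [⋀^Fin (k + 1)]→L[ℝ] ℝ}
  {e : AdaptedChart P} {j : Jet1 P} {D : B →L[ℝ] (B × F) × (B →L[ℝ] F)}

/-- A horizontal lift at `j` is semi-holonomic if it projects to `j`. -/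
def IsSemiHolonomicLift (j : Jet1 P) (D : B →L[ℝ] (B × F) × (B →L[ℝ] F)) : Prop :=
  ∀ ξ : B, mfderiv 𝓘(ℝ, (B × F) × (B →L[ℝ] F)) 𝓘(ℝ, B × F) Jet1.pt j (D ξ) = j.lin ξ

/-- The horizontal lifts at `j` that solve the Euler-Lagrange equations. -/
structure IsEulerLagrangeLift (L : Jet1 P → ℝ)
    (η : ∀ x : M, TangentSpace 𝓘(ℝ, B) x [⋀^Fin (k + 1)]→L[ℝ] ℝ) (j : Jet1 P)
    (D : B →L[ℝ] (B × F) × (B →L[ℝ] F)) : Prop where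
  semiHolonomic : IsSemiHolonomicLift j D
  equation : ∀ (W : (B × F) × (B →L[ℝ] F)) (v : Fin (k + 1) → B),
    omegaL L η j (Matrix.vecCons W fun i => D (v i)) = 0

theorem IsSemiHolonomicLift.dJet_fst (hD : IsSemiHolonomicLift j D) (hj : j.pt ∈ e.tot.source)
    (x : B) : (dJet e j (D (e.dBaseInv (P.proj j.pt) x))).1 = (x, (Jet1.coords e j).2 x) := by
  exact (dTot_mfderiv_pt hj _).symm.trans
    ((congrArg (e.dTot j.pt) (hD _)).trans (dTot_lin hj x))

theorem IsSemiHolonomicLift.mfderiv_toBase (hD : IsSemiHolonomicLift j D) (ξ : B) :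
    mfderiv 𝓘(ℝ, (B × F) × (B →L[ℝ] F)) 𝓘(ℝ, B) Jet1.toBase j (D ξ) = ξ := by
  rw [Multisymp.mfderiv_toBase]
  exact (congrArg (P.dproj j.pt) (hD ξ)).trans (j.dproj_lin ξ)

/-- The horizontal lift with given coordinates. -/
def liftOfCoords (e : AdaptedChart P) (j : Jet1 P) (G : B →L[ℝ] B →L[ℝ] F) :
    B →L[ℝ] (B × F) × (B →L[ℝ] F) :=
  let dB : B →L[ℝ] B := e.dBase (P.proj j.pt)
  let dJ : ((B × F) × (B →L[ℝ] F)) →L[ℝ] (B × F) × (B →L[ℝ] F) := dJetInv e j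
  dJ.comp ((((ContinuousLinearMap.id ℝ B).prod (Jet1.coords e j).2).prod G).comp dB)

theorem dJet_liftOfCoords (hj : j.pt ∈ e.tot.source) (G : B →L[ℝ] B →L[ℝ] F) (ξ : B) :
    dJet e j (liftOfCoords e j G ξ) = ((e.dBase (P.proj j.pt) ξ,
      (Jet1.coords e j).2 (e.dBase (P.proj j.pt) ξ)), G (e.dBase (P.proj j.pt) ξ)) :=
  dJet_dJetInv hj _

theorem dJet_liftOfCoords_dBaseInv (hj : j.pt ∈ e.tot.source) (G : B →L[ℝ] B →L[ℝ] F) (x : B) :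
    dJet e j (liftOfCoords e j G (e.dBaseInv (P.proj j.pt) x)) =
      ((x, (Jet1.coords e j).2 x), G x) := by
  refine (dJet_liftOfCoords hj G _).trans ?_
  rw [e.dBase_dBaseInv (e.mapsTo _ hj)]

theorem isSemiHolonomicLift_liftOfCoords (hj : j.pt ∈ e.tot.source) (G : B →L[ℝ] B →L[ℝ] F) :
    IsSemiHolonomicLift j (liftOfCoords e j G) := by
  intro ξ
  refine (mfderiv_pt_dJetInv hj _).trans ?_
  rw [← e.dTotInv_dTot hj (j.lin ξ)]
  have h := dTot_lin hj (e.dBase (P.proj j.pt) ξ)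
  have h2 : e.dBaseInv (P.proj j.pt) (e.dBase (P.proj j.pt) ξ) = ξ :=
    e.dBaseInv_dBase (e.mapsTo _ hj) ξ
  exact congrArg (e.dTotInv j.pt)
    (h.symm.trans (congrArg (fun x => e.dTot j.pt (j.lin x)) h2))

variable [FiniteDimensional ℝ B] [IsManifold 𝓘(ℝ, B) ∞ M] [FiniteDimensional ℝ F]

/-- The Euler-Lagrange equations for semi-holonomic lifts, in natural coordinates. -/
theorem IsSemiHolonomicLift.equation_iff (hdim : Module.finrank ℝ B = k + 1)
    (hL : ContMDiff 𝓘(ℝ, (B × F) × (B →L[ℝ] F)) 𝓘(ℝ) ∞ L) (hη : IsVolumeForm η)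
    (hD : IsSemiHolonomicLift j D) (hj : j.pt ∈ e.tot.source) {b : Fin (k + 1) → B}
    (hb : volLoc η e (Jet1.coords e j).1.1 b ≠ 0) :
    (∀ (W : (B × F) × (B →L[ℝ] F)) (v : Fin (k + 1) → B),
      omegaL L η j (Matrix.vecCons W fun i => D (v i)) = 0) ↔
    ∀ u : F, ∑ i : Fin (k + 1), (-1 : ℝ) ^ (i : ℕ) *
      fderiv ℝ (mom (lagLoc L e) (volLoc η e)) (Jet1.coords e j)
        (dJet e j (D (e.dBaseInv (P.proj j.pt) (b i)))) u (i.removeNth b) =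
      fderiv ℝ (lagLoc L e) (Jet1.coords e j) (((0 : B), u), 0) *
        volLoc η e (Jet1.coords e j).1.1 b := by
  let dB : B →L[ℝ] B := e.dBaseInv (P.proj j.pt)
  -- For vertical W the value does not depend on the jet component `a`, so the equation is a
  -- condition on u alone.
  have key : ∀ (W : (B × F) × (B →L[ℝ] F)) (u : F) (a : B →L[ℝ] F),
      dJet e j W = (((0 : B), u), a) → omegaL L η j (Matrix.vecCons W fun i => D (dB (b i))) =
        ∑ i : Fin (k + 1), (-1 : ℝ) ^ (i : ℕ) *
          fderiv ℝ (mom (lagLoc L e) (volLoc η e)) (Jet1.coords e j)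
            (dJet e j (D (dB (b i)))) u (i.removeNth b) -
        fderiv ℝ (lagLoc L e) (Jet1.coords e j) (((0 : B), u), 0) *
          volLoc η e (Jet1.coords e j).1.1 b := by
    intro W u a hW
    have hx : ∀ i, (dJet e j (D (dB (b i)))).1 = (b i, (Jet1.coords e j).2 (b i)) :=
      fun i => hD.dJet_fst hj (b i)
    have h1 := extDeriv_thetaLoc_cons_lift hdim (contDiffAt_lagLoc_coords hL hj)
      (contDiffAt_volLoc_coords hη hj) u a (fun i => dJet e j (D (dB (b i))))
      (fun i => by rw [hx i])
    have h2 : (fun i => (dJet e j (D (dB (b i)))).1.1) = b := funext fun i => by rw [hx i]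
    rw [h2] at h1
    refine (omegaL_apply hL hη hj _).trans ?_
    rw [← neg_sub (fderiv ℝ (lagLoc L e) (Jet1.coords e j) (((0 : B), u), 0) * _), ← h1]
    refine congrArg (fun w => -extDeriv (thetaLoc (lagLoc L e) (volLoc η e)) (Jet1.coords e j) w)
      (funext fun i => ?_)
    exact Fin.cases hW (fun i => rfl) i
  constructor
  · intro h u
    have h1 := key (dJetInv e j (((0 : B), u), 0)) u 0 (dJet_dJetInv hj _)
    exact sub_eq_zero.1 (h1.symm.trans (h _ _))
  · intro h W v
    let Ω : ((B × F) × (B →L[ℝ] F)) [⋀^Fin (k + 1 + 1)]→L[ℝ] ℝ := omegaL L η j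
    let dJ : ((B × F) × (B →L[ℝ] F)) →L[ℝ] (B × F) × (B →L[ℝ] F) := dJet e j
    set x : B := (dJ W).1.1 with hx
    -- An arbitrary W is split into its horizontal part with respect to D and a vertical remainder.
    set W' : (B × F) × (B →L[ℝ] F) := W - D (dB x) with hW'
    have hdW' : dJ W' = (((0 : B), (dJ W').1.2), (dJ W').2) := by
      have h1 : (dJ (D (dB x))).1 = (x, (Jet1.coords e j).2 x) := hD.dJet_fst hj x
      have h2 : (dJ W').1.1 = 0 := by
        rw [hW', map_sub, Prod.fst_sub, Prod.fst_sub, h1, hx, sub_self]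
      exact Prod.ext (Prod.ext h2 rfl) rfl
    -- Pulled back by D to the m-dimensional base, the (m + 1)-form Ω is zero.
    have h1 : Ω (Matrix.vecCons (D (dB x)) fun i => D (v i)) = 0 := by
      have h2 : (Ω.compContinuousLinearMap D).toAlternatingMap = 0 :=
        alternating_eq_zero_of_finrank_lt (by omega) _
      have h3 := congrArg (fun f => f (Matrix.vecCons (dB x) v)) h2
      refine Eq.trans (congrArg Ω (funext fun i => ?_)) h3
      exact Fin.cases rfl (fun i => rfl) i
    -- In the last m arguments this is a form of top degree on the base, so its vanishing on the one
    -- frame `b` is enough.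
    have h2 : ∀ v : Fin (k + 1) → B, Ω (Matrix.vecCons W' fun i => D (v i)) = 0 := by
      intro v
      have h3 := topForm_mul_comm hdim (volLoc η e (Jet1.coords e j).1.1).toAlternatingMap
        ((((Ω.curryLeft W').compContinuousLinearMap D).compContinuousLinearMap
          dB).toAlternatingMap) b (fun i => e.dBase (P.proj j.pt) (v i))
      have h4 : Ω (Matrix.vecCons W' fun i => D (dB (b i))) = 0 :=
        (key W' _ _ hdW').trans (sub_eq_zero.2 (h _))
      have h5 : (volLoc η e (Jet1.coords e j).1.1) b *
          Ω (Matrix.vecCons W' fun i => D (dB (e.dBase (P.proj j.pt) (v i)))) =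
          (volLoc η e (Jet1.coords e j).1.1) (fun i => e.dBase (P.proj j.pt) (v i)) *
          Ω (Matrix.vecCons W' fun i => D (dB (b i))) := h3
      rw [h4, mul_zero] at h5
      have h6 : ∀ ξ : B, dB (e.dBase (P.proj j.pt) ξ) = ξ := e.dBaseInv_dBase (e.mapsTo _ hj)
      simp only [h6] at h5
      exact (mul_eq_zero.1 h5).resolve_left hb
    have h3 : W = D (dB x) + W' := by rw [hW']; abel
    change Ω (Matrix.vecCons W fun i => D (v i)) = 0
    rw [h3]
    exact (Ω.toMultilinearMap.cons_add _ _ _).trans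
      ((congrArg₂ (· + ·) h1 (h2 v)).trans (add_zero 0))

/-- Affine combinations of solutions of the Euler-Lagrange equations are solutions. -/
theorem IsEulerLagrangeLift.sum_smul (hdim : Module.finrank ℝ B = k + 1)
    (hL : ContMDiff 𝓘(ℝ, (B × F) × (B →L[ℝ] F)) 𝓘(ℝ) ∞ L) (hη : IsVolumeForm η)
    {ι : Type*} {t : Finset ι} {c : ι → ℝ} (hc : ∑ i ∈ t, c i = 1)
    {D : ι → B →L[ℝ] (B × F) × (B →L[ℝ] F)} (hD : ∀ i ∈ t, IsEulerLagrangeLift L η j (D i)) :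
    IsEulerLagrangeLift L η j (∑ i ∈ t, c i • D i) := by
  obtain ⟨e, he⟩ := P.exists_adaptedChart j.pt
  have hj : j.pt ∈ e.tot.source := he ▸ e.ctr_mem
  obtain ⟨b, hb⟩ := exists_ne_zero_of_form_ne_zero (volLoc_coords_ne_zero hη hj)
  have hS : IsSemiHolonomicLift j (∑ i ∈ t, c i • D i) := by
    intro ξ
    let A : ((B × F) × (B →L[ℝ] F)) →L[ℝ] B × F :=
      mfderiv 𝓘(ℝ, (B × F) × (B →L[ℝ] F)) 𝓘(ℝ, B × F) Jet1.pt j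
    have h1 : ∀ i ∈ t, c i • A (D i ξ) = c i • (j.lin ξ : B × F) :=
      fun i hi => congrArg (c i • ·) ((hD i hi).semiHolonomic ξ)
    change A ((∑ i ∈ t, c i • D i) ξ) = j.lin ξ
    rw [sum_apply, map_sum]
    refine (Finset.sum_congr rfl fun i hi => (map_smul A (c i) (D i ξ)).trans (h1 i hi)).trans ?_
    exact (Finset.sum_smul (x := (j.lin ξ : B × F))).symm.trans
      ((congrArg (· • (j.lin ξ : B × F)) hc).trans (one_smul ℝ _))
  refine ⟨hS, (hS.equation_iff hdim hL hη hj hb).2 fun u => ?_⟩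
  -- In a frame, the equation has a left side linear in the lift and a right side independent of it,
  -- so it survives combinations with coefficients of sum one.
  have h1 := fun i hi =>
    ((hD i hi).semiHolonomic.equation_iff hdim hL hη hj hb).1 (hD i hi).equation u
  let T : ((B × F) × (B →L[ℝ] F)) →L[ℝ] F →L[ℝ] B [⋀^Fin k]→L[ℝ] ℝ :=
    (fderiv ℝ (mom (lagLoc L e) (volLoc η e)) (Jet1.coords e j)).comp (dJet e j)
  let dB : B →L[ℝ] B := e.dBaseInv (P.proj j.pt)
  have h2 : ∀ l : Fin (k + 1), T ((∑ i ∈ t, c i • D i) (dB (b l))) u (l.removeNth b) =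
      ∑ i ∈ t, c i * T (D i (dB (b l))) u (l.removeNth b) := by
    intro l
    let ev : ((B × F) × (B →L[ℝ] F)) →ₗ[ℝ] ℝ :=
      { toFun := fun w => T w u (l.removeNth b)
        map_add' := fun w w' => by rw [map_add]; rfl
        map_smul' := fun r w => by rw [map_smul]; rfl }
    change ev _ = ∑ i ∈ t, c i * ev _
    rw [sum_apply, map_sum]
    exact Finset.sum_congr rfl fun i _ => map_smul ev _ _
  have h3 : ∀ i ∈ t, ∑ l : Fin (k + 1), (-1 : ℝ) ^ (l : ℕ) * T (D i (dB (b l))) u (l.removeNth b) =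
      fderiv ℝ (lagLoc L e) (Jet1.coords e j) (((0 : B), u), 0) *
        volLoc η e (Jet1.coords e j).1.1 b := h1
  change ∑ l : Fin (k + 1), (-1 : ℝ) ^ (l : ℕ) *
    T ((∑ i ∈ t, c i • D i) (dB (b l))) u (l.removeNth b) = _
  simp only [h2, Finset.mul_sum]
  rw [Finset.sum_comm]
  have h4 : ∀ i ∈ t, ∑ l : Fin (k + 1), (-1 : ℝ) ^ (l : ℕ) *
      (c i * T (D i (dB (b l))) u (l.removeNth b)) =
      c i * (fderiv ℝ (lagLoc L e) (Jet1.coords e j) (((0 : B), u), 0) *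
        volLoc η e (Jet1.coords e j).1.1 b) := by
    intro i hi
    rw [← h3 i hi, Finset.mul_sum]
    exact Finset.sum_congr rfl fun l _ => by ring
  rw [Finset.sum_congr rfl h4, ← Finset.sum_mul, hc, one_mul]

/-- Solutions of the Euler-Lagrange equations in the domain of an adapted chart. -/
def elLift (L : Jet1 P → ℝ) (η : ∀ x : M, TangentSpace 𝓘(ℝ, B) x [⋀^Fin (k + 1)]→L[ℝ] ℝ)
    (e : AdaptedChart P) (b : Fin (k + 1) → B) (j : Jet1 P) : B →L[ℝ] (B × F) × (B →L[ℝ] F) :=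
  liftOfCoords e j (elSol (lagLoc L e) (volLoc η e) b (Jet1.coords e j))

theorem isEulerLagrangeLift_elLift (hdim : Module.finrank ℝ B = k + 1)
    (hL : ContMDiff 𝓘(ℝ, (B × F) × (B →L[ℝ] F)) 𝓘(ℝ) ∞ L) (hη : IsVolumeForm η)
    (hreg : IsRegularLagrangian L η) (hj : j.pt ∈ e.tot.source) {b : Fin (k + 1) → B}
    (hb : volLoc η e (Jet1.coords e j).1.1 b ≠ 0) :
    IsEulerLagrangeLift L η j (elLift L η e b j) := by
  have hS : IsSemiHolonomicLift j (elLift L η e b j) := isSemiHolonomicLift_liftOfCoords hj _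
  refine ⟨hS, (hS.equation_iff hdim hL hη hj hb).2 fun u => ?_⟩
  rw [← sum_fderiv_mom_elSol (contDiffAt_lagLoc_coords hL hj) (contDiffAt_volLoc_coords hη hj) hb
    (hess_lagLoc_injective hdim hL hη hreg hj) u]
  refine Finset.sum_congr rfl fun i _ => ?_
  have h := dJet_liftOfCoords_dBaseInv hj
    (elSol (lagLoc L e) (volLoc η e) b (Jet1.coords e j)) (b i)
  exact congrArg (fun w => (-1 : ℝ) ^ (i : ℕ) * fderiv ℝ (mom (lagLoc L e) (volLoc η e))
    (Jet1.coords e j) w u (i.removeNth b)) h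

end EulerLagrangeLifts

/-! ### Smoothness of vector fields through their components -/

section FieldsInCharts

variable {V N : Type*} [NormedAddCommGroup V] [NormedSpace ℝ V] [CompleteSpace V]
  [TopologicalSpace N] [ChartedSpace V N] [IsManifold 𝓘(ℝ, V) ∞ N]
  {c : OpenPartialHomeomorph N V} {s : Set N} {Y : ∀ q : N, TangentSpace 𝓘(ℝ, V) q}

/-- A vector field with smooth components in a chart is smooth. -/
theorem isSmoothFieldOn_of_chart (hc : c ∈ IsManifold.maximalAtlas 𝓘(ℝ, V) ∞ N) (hs : IsOpen s)
    (hsc : s ⊆ c.source) {f : N → V} (hf : ContMDiffOn 𝓘(ℝ, V) 𝓘(ℝ, V) ∞ f s)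
    (hY : ∀ q ∈ s, mfderiv 𝓘(ℝ, V) 𝓘(ℝ, V) c q (Y q) = f q) : IsSmoothFieldOn Y s := by
  have hm := mdifferentiable_of_mem_maximalAtlas hc
  refine IsSmoothFieldOn.pullback (V := V) (N := V) hs
    ((contMDiffOn_of_mem_maximalAtlas hc).mono hsc)
    (t := c.target ∩ c.symm ⁻¹' s) (Y := fun u => f (c.symm u)) ?_ ?_ ?_ ?_
  · intro q hq
    refine ⟨c.map_source (hsc hq), ?_⟩
    rw [mem_preimage, c.left_inv (hsc hq)]
    exact hq
  · refine contMDiffOn_vectorSpace_iff_contDiffOn.2 (contMDiffOn_iff_contDiffOn.1 ?_)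
    exact hf.comp ((contMDiffOn_symm_of_mem_maximalAtlas hc).mono inter_subset_left)
      fun u hu => hu.2
  · intro q hq
    exact ⟨hm.mfderiv (hsc hq), rfl⟩
  · intro q hq
    rw [hY q hq, c.left_inv (hsc hq)]

/-- The components of a smooth vector field in a chart are smooth. -/
theorem IsSmoothFieldOn.contMDiffOn_chart (hY : IsSmoothFieldOn Y s)
    (hc : c ∈ IsManifold.maximalAtlas 𝓘(ℝ, V) ∞ N) (hs : IsOpen s) (hsc : s ⊆ c.source) :
    ContMDiffOn 𝓘(ℝ, V) 𝓘(ℝ, V) ∞ (fun q => (mfderiv 𝓘(ℝ, V) 𝓘(ℝ, V) c q (Y q) : V)) s := by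
  have hm := mdifferentiable_of_mem_maximalAtlas hc
  have h1 : IsSmoothFieldOn (N := V)
      (fun u => mfderiv 𝓘(ℝ, V) 𝓘(ℝ, V) c (c.symm u) (Y (c.symm u))) (c.target ∩ c.symm ⁻¹' s) := by
    refine IsSmoothFieldOn.pullback (Ψ := c.symm) (t := s) (c.isOpen_inter_preimage_symm hs)
      ((contMDiffOn_symm_of_mem_maximalAtlas hc).mono inter_subset_left) (fun u hu => hu.2) hY ?_ ?_
    · intro u hu
      exact ⟨hm.symm.mfderiv hu.1, rfl⟩
    · intro u hu
      have h := hm.symm_comp_deriv (hsc hu.2)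
      rw [c.right_inv hu.1] at h
      exact congrArg (fun f => f (Y (c.symm u))) h
  have h2 := (contMDiffOn_vectorSpace_iff_contDiffOn.1 h1).contMDiffOn.comp
    ((contMDiffOn_of_mem_maximalAtlas hc).mono hsc) (fun q hq => ?_)
  · refine h2.congr fun q hq => ?_
    have h3 : ∀ q', q' = q → (mfderiv 𝓘(ℝ, V) 𝓘(ℝ, V) c q (Y q) : V) =
        mfderiv 𝓘(ℝ, V) 𝓘(ℝ, V) c q' (Y q') := by rintro _ rfl; rfl
    exact h3 _ (c.left_inv (hsc hq))
  · refine ⟨c.map_source (hsc hq), ?_⟩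
    rw [mem_preimage, c.left_inv (hsc hq)]
    exact hq

end FieldsInCharts

/-! ### Gluing local solutions to a global connection -/

section EulerLagrangeConnection

set_option maxSynthPendingDepth 3

variable {B F M E : Type*}
  [NormedAddCommGroup B] [NormedSpace ℝ B]
  [NormedAddCommGroup F] [NormedSpace ℝ F]
  [TopologicalSpace M] [ChartedSpace B M]
  [TopologicalSpace E] [ChartedSpace (B × F) E]
  {P : FibredManifold B F M E} {k : ℕ}
  {L : Jet1 P → ℝ} {η : ∀ x : M, TangentSpace 𝓘(ℝ, B) x [⋀^Fin (k + 1)]→L[ℝ] ℝ}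
  {e : AdaptedChart P}

theorem volLoc_coords_basis_ne_zero (hη : IsVolumeForm η) (b : Module.Basis (Fin (k + 1)) ℝ B)
    {j : Jet1 P} (hj : j.pt ∈ e.tot.source) : volLoc η e (Jet1.coords e j).1.1 b ≠ 0 := by
  refine (AlternatingMap.map_basis_ne_zero_iff b
    (volLoc η e (Jet1.coords e j).1.1).toAlternatingMap).2 fun h => ?_
  refine volLoc_coords_ne_zero hη hj (ContinuousAlternatingMap.ext fun v => ?_)
  exact congrArg (fun f => f v) h

variable [FiniteDimensional ℝ B] [FiniteDimensional ℝ F] [IsManifold 𝓘(ℝ, B) ∞ M]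

/-- The image under `elLift` of a smooth vector field is smooth. -/
theorem isSmoothFieldOn_elLift (hdim : Module.finrank ℝ B = k + 1)
    (hL : ContMDiff 𝓘(ℝ, (B × F) × (B →L[ℝ] F)) 𝓘(ℝ) ∞ L) (hη : IsVolumeForm η)
    (hreg : IsRegularLagrangian L η) (b : Module.Basis (Fin (k + 1)) ℝ B) {U : Set (Jet1 P)}
    (hU : IsOpen U) (hUe : U ⊆ (jetChart e).source)
    {Y : ∀ j : Jet1 P, TangentSpace 𝓘(ℝ, (B × F) × (B →L[ℝ] F)) j} (hY : IsSmoothFieldOn Y U) :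
    IsSmoothFieldOn (fun j => elLift L η e b j
      (mfderiv 𝓘(ℝ, (B × F) × (B →L[ℝ] F)) 𝓘(ℝ, B) Jet1.toBase j (Y j))) U := by
  have hc := jetChart_mem_maximalAtlas e
  have h1 := hY.contMDiffOn_chart hc hU hUe
  have h2 : ContMDiffOn 𝓘(ℝ, (B × F) × (B →L[ℝ] F)) 𝓘(ℝ, B) ∞
      (fun j => (dJet e j (Y j)).1.1) U :=
    ((contDiff_fst.comp contDiff_fst).contMDiff (n := ∞)).comp_contMDiffOn h1
  have h3 : ContMDiffOn 𝓘(ℝ, (B × F) × (B →L[ℝ] F)) 𝓘(ℝ, (B × F) × (B →L[ℝ] F)) ∞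
      (jetChart e) U := (contMDiffOn_of_mem_maximalAtlas hc).mono hUe
  have h4 : ContMDiffOn 𝓘(ℝ, (B × F) × (B →L[ℝ] F)) 𝓘(ℝ, B →L[ℝ] F) ∞
      (fun j => (jetChart e j).2) U := (contDiff_snd.contMDiff (n := ∞)).comp_contMDiffOn h3
  have h5 : ContMDiffOn 𝓘(ℝ, (B × F) × (B →L[ℝ] F)) 𝓘(ℝ, B →L[ℝ] B →L[ℝ] F) ∞
      (fun j => elSol (lagLoc L e) (volLoc η e) b (jetChart e j)) U := by
    intro j hj
    have h6 : ContDiffAt ℝ ∞ (elSol (lagLoc L e) (volLoc η e) b) (jetChart e j) :=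
      contDiffAt_elSol (contDiffAt_lagLoc_coords hL (hUe hj))
        (contDiffAt_volLoc_coords hη (hUe hj)) (volLoc_coords_basis_ne_zero hη b (hUe hj))
        (hess_lagLoc_injective hdim hL hη hreg (hUe hj))
    exact h6.contMDiffAt.comp_contMDiffWithinAt j (h3 j hj)
  -- The components are (x, v x, G x), where x is the base component of the given field, v the fibre
  -- coordinate and G = `elSol`, all smooth in the jet.
  refine isSmoothFieldOn_of_chart hc hU hUe
    ((h2.prodMk_space (h4.clm_apply h2)).prodMk_space (h5.clm_apply h2)) fun j hj => ?_
  have h7 := dBase_mfderiv_toBase (hUe hj) (Y j)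
  refine (dJet_liftOfCoords (hUe hj) _ _).trans ?_
  exact congrArg (fun x : B => ((x, (Jet1.coords e j).2 x),
    elSol (lagLoc L e) (volLoc η e) b (Jet1.coords e j) x)) h7

variable [IsManifold 𝓘(ℝ, B × F) ∞ E] [T2Space E] [SigmaCompactSpace E]

/-- There is a global Ehresmann connection that solves the Euler-Lagrange equations. -/
theorem exists_eulerLagrange_connection (hdim : Module.finrank ℝ B = k + 1)
    (hL : ContMDiff 𝓘(ℝ, (B × F) × (B →L[ℝ] F)) 𝓘(ℝ) ∞ L) (hη : IsVolumeForm η)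
    (hreg : IsRegularLagrangian L η) :
    ∃ nabla : ∀ j : Jet1 P,
      TangentSpace 𝓘(ℝ, B) j.toBase →L[ℝ] TangentSpace 𝓘(ℝ, (B × F) × (B →L[ℝ] F)) j,
      IsEhresmannConnectionOn Jet1.toBase univ nabla ∧
        ∀ j, IsEulerLagrangeLift L η j (nabla j) := by
  choose e he using P.exists_adaptedChart
  let b : Module.Basis (Fin (k + 1)) ℝ B := Module.finBasisOfFinrankEq ℝ B hdim
  -- Natural charts are defined over whole preimages of open sets of E, so a partition of unity on E
  -- suffices; its functions are composed with the projection.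
  obtain ⟨ρ, hρ⟩ := SmoothPartitionOfUnity.exists_isSubordinate 𝓘(ℝ, B × F) isClosed_univ
    (fun y => (e y).tot.source) (fun y => (e y).tot.open_source)
    (fun y _ => mem_iUnion.2 ⟨y, by have h := (e y).ctr_mem; rwa [he] at h⟩)
  let D : Jet1 P → B →L[ℝ] (B × F) × (B →L[ℝ] F) := fun j =>
    ∑ y ∈ ρ.finsupport j.pt, ρ y j.pt • elLift L η (e y) b j
  have hsup : ∀ (j : Jet1 P), ∀ y ∈ ρ.finsupport j.pt, j.pt ∈ (e y).tot.source := fun j y hy =>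
    hρ y (subset_tsupport _ ((ρ.mem_finsupport j.pt).1 hy))
  have hD : ∀ j, IsEulerLagrangeLift L η j (D j) := fun j =>
    IsEulerLagrangeLift.sum_smul hdim hL hη (ρ.sum_finsupport j.pt (mem_univ _)) fun y hy =>
      isEulerLagrangeLift_elLift hdim hL hη hreg (hsup j y hy)
        (volLoc_coords_basis_ne_zero hη b (hsup j y hy))
  refine ⟨D, ⟨fun j _ ξ => (hD j).semiHolonomic.mfderiv_toBase ξ, ?_⟩, hD⟩
  intro U Y hU _ hY j hj
  -- Near `j` all sums run inside this fixed finite set. Membership in it puts `j.pt` in the closed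
  -- support, hence in the chart domain, so each summand is smooth near `j`.
  set t := ρ.fintsupport j.pt with ht
  let Z : E → ∀ j : Jet1 P, TangentSpace 𝓘(ℝ, (B × F) × (B →L[ℝ] F)) j := fun y j =>
    elLift L η (e y) b j (mfderiv 𝓘(ℝ, (B × F) × (B →L[ℝ] F)) 𝓘(ℝ, B) Jet1.toBase j (Y j))
  have h1 : ∀ y ∈ t, ContMDiffAt 𝓘(ℝ, (B × F) × (B →L[ℝ] F))
      𝓘(ℝ, (B × F) × (B →L[ℝ] F)).tangent ∞
      (fun j => (⟨j, ((fun j : Jet1 P => ρ y j.pt) • Z y) j⟩ :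
        TangentBundle 𝓘(ℝ, (B × F) × (B →L[ℝ] F)) (Jet1 P))) j := by
    intro y hy
    have hjy : j.pt ∈ (e y).tot.source := hρ y ((ρ.mem_fintsupport_iff j.pt y).1 hy)
    have hV : IsOpen (U ∩ (jetChart (e y)).source) := hU.inter (jetChart (e y)).open_source
    have h2 := isSmoothFieldOn_elLift hdim hL hη hreg b hV inter_subset_right
      (hY.mono inter_subset_left)
    refine ContMDiffAt.smul_section ?_ (h2.contMDiffAt (hV.mem_nhds ⟨hj, hjy⟩))
    exact (ρ y).contMDiff.contMDiffAt.comp j (contMDiff_jet_pt j)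
  have h2 := ContMDiffAt.sum_section h1
  refine (h2.congr_of_eventuallyEq ?_).contMDiffWithinAt
  filter_upwards [continuous_jet_pt.continuousAt.eventually
    (ρ.eventually_finsupport_subset j.pt)] with j' hj'
  -- Enlarging the index set adds only terms with coefficient zero.
  have h3 : D j' = ∑ y ∈ t, ρ y j'.pt • elLift L η (e y) b j' := by
    refine Finset.sum_subset hj' fun y _ hy => ?_
    have : ρ y j'.pt = 0 := by simpa [SmoothPartitionOfUnity.mem_finsupport] using hy
    rw [this, zero_smul]
  let x : B := mfderiv 𝓘(ℝ, (B × F) × (B →L[ℝ] F)) 𝓘(ℝ, B) Jet1.toBase j' (Y j')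
  have h4 : D j' x = ∑ y ∈ t, ρ y j'.pt • elLift L η (e y) b j' x := by
    rw [h3, sum_apply]
    rfl
  exact congrArg (fun w => (⟨j', w⟩ : TangentBundle 𝓘(ℝ, (B × F) × (B →L[ℝ] F)) (Jet1 P))) h4

end EulerLagrangeConnection

/-! ### Pairings and contractions of decomposable multivectors -/

section MultivectorAlgebra

variable {T : Type*} [AddCommGroup T] [Module ℝ T] {d : ℕ}

theorem pairing_ιMulti (φ : T [⋀^Fin d]→ₗ[ℝ] ℝ) (v : Fin d → T) :
    pairing φ (exteriorPower.ιMulti ℝ d v) = φ v :=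
  exteriorPower.alternatingMapLinearEquiv_apply_ιMulti φ v

theorem contract_smul_ιMulti_eq_zero {Ω : T [⋀^Fin (d + 1)]→ₗ[ℝ] ℝ} (c : ℝ) {v : Fin d → T}
    (h : ∀ w, Ω (Matrix.vecCons w v) = 0) :
    contract Ω (c • exteriorPower.ιMulti ℝ d v) = 0 := by
  ext w
  have h1 : exteriorPower.alternatingMapLinearEquiv (Ω.curryLeft w)
      (c • exteriorPower.ιMulti ℝ d v) = 0 := by
    rw [map_smul, exteriorPower.alternatingMapLinearEquiv_apply_ιMulti]
    exact (congrArg (c • ·) (h w)).trans (smul_zero c)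
  exact (congrArg ((-1 : ℝ) ^ d • ·) h1).trans (smul_zero _)

/-- Contraction by a covector is an antiderivation, so it kills a product of vectors that it kills
one by one. -/
theorem contractLeft_ιMulti_eq_zero {l : Module.Dual ℝ T} {v : Fin d → T} (h : ∀ i, l (v i) = 0) :
    CliffordAlgebra.contractLeft (Q := 0) l (ExteriorAlgebra.ιMulti ℝ d v) = 0 := by
  induction d with
  | zero =>
    rw [ExteriorAlgebra.ιMulti_zero_apply]
    exact CliffordAlgebra.contractLeft_one 0 l
  | succ d ih =>
    rw [ExteriorAlgebra.ιMulti_succ_apply]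
    refine (CliffordAlgebra.contractLeft_ι_mul l (v 0) _).trans ?_
    rw [h 0, zero_smul, ih (v := Matrix.vecTail v) fun i => h i.succ, mul_zero, sub_zero]

theorem ιMulti_smul_univ (c : Fin d → ℝ) (v : Fin d → T) :
    exteriorPower.ιMulti ℝ d (fun i => c i • v i) = (∏ i, c i) • exteriorPower.ιMulti ℝ d v :=
  (exteriorPower.ιMulti ℝ d).toMultilinearMap.map_smul_univ c v

/-- The image of a frame in the exterior power is an alternating function of top degree, hence
scales like the volume: the normalized multivector does not depend on the frame. -/
theorem inv_smul_ιMulti_eq {B : Type*} [NormedAddCommGroup B] [NormedSpace ℝ B]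
    [FiniteDimensional ℝ B] {k : ℕ} (hdim : Module.finrank ℝ B = k + 1)
    (n : B [⋀^Fin (k + 1)]→ₗ[ℝ] ℝ) (D : B →ₗ[ℝ] T) {b w : Fin (k + 1) → B} (hb : n b ≠ 0)
    (hw : n w ≠ 0) : (n b)⁻¹ • exteriorPower.ιMulti ℝ (k + 1) (fun i => D (b i)) =
      (n w)⁻¹ • exteriorPower.ιMulti ℝ (k + 1) (fun i => D (w i)) := by
  have h : n b • exteriorPower.ιMulti ℝ (k + 1) (fun i => D (w i)) =
    n w • exteriorPower.ιMulti ℝ (k + 1) (fun i => D (b i)) :=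
    topForm_mul_comm hdim n ((exteriorPower.ιMulti ℝ (k + 1)).compLinearMap D) b w
  rw [inv_smul_eq_iff₀ hb, smul_comm, h, inv_smul_smul₀ hw]

end MultivectorAlgebra

/-! ### The global Euler-Lagrange multivector field -/

section EulerLagrangeField

set_option maxSynthPendingDepth 3

variable {B F M E : Type*}
  [NormedAddCommGroup B] [NormedSpace ℝ B]
  [NormedAddCommGroup F] [NormedSpace ℝ F]
  [TopologicalSpace M] [ChartedSpace B M]
  [TopologicalSpace E] [ChartedSpace (B × F) E]
  {P : FibredManifold B F M E} {k : ℕ}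
  {L : Jet1 P → ℝ} {η : ∀ x : M, TangentSpace 𝓘(ℝ, B) x [⋀^Fin (k + 1)]→L[ℝ] ℝ}
  {nabla : ∀ j : Jet1 P,
      TangentSpace 𝓘(ℝ, B) j.toBase →L[ℝ] TangentSpace 𝓘(ℝ, (B × F) × (B →L[ℝ] F)) j}

/-- The horizontal `m`-vector field `Y^∇_η`. -/
def horizontalMultivector (η : ∀ x : M, TangentSpace 𝓘(ℝ, B) x [⋀^Fin (k + 1)]→L[ℝ] ℝ)
    (nabla : ∀ j : Jet1 P,
      TangentSpace 𝓘(ℝ, B) j.toBase →L[ℝ] TangentSpace 𝓘(ℝ, (B × F) × (B →L[ℝ] F)) j)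
    (b : Fin (k + 1) → B) (j : Jet1 P) :
    ⋀[ℝ]^(k + 1) (TangentSpace 𝓘(ℝ, (B × F) × (B →L[ℝ] F)) j) :=
  (η j.toBase b)⁻¹ • exteriorPower.ιMulti ℝ (k + 1) fun i => nabla j (b i)

theorem volume_basis_ne_zero (hη : IsVolumeForm η) (b : Module.Basis (Fin (k + 1)) ℝ B) (x : M) :
    η x b ≠ 0 := by
  refine (AlternatingMap.map_basis_ne_zero_iff b
    (η x : B [⋀^Fin (k + 1)]→L[ℝ] ℝ).toAlternatingMap).2 fun h => ?_
  exact hη.ne_zero x (ContinuousAlternatingMap.ext fun v => congrArg (fun f => f v) h)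

theorem horizontalMultivector_eq [FiniteDimensional ℝ B] (hdim : Module.finrank ℝ B = k + 1)
    {b : Fin (k + 1) → B} {j : Jet1 P} (hb : η j.toBase b ≠ 0) {w : Fin (k + 1) → B}
    (hw : η j.toBase w ≠ 0) :
    horizontalMultivector η nabla b j = horizontalMultivector η nabla w j :=
  inv_smul_ιMulti_eq (B := B) hdim (η j.toBase).toAlternatingMap (nabla j).toLinearMap hb hw

theorem pairing_horizontalMultivector (hD : IsEhresmannConnectionOn Jet1.toBase univ nabla)
    {b : Fin (k + 1) → B} {j : Jet1 P} (hb : η j.toBase b ≠ 0) :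
    pairing ((η j.toBase).compContinuousLinearMap (mfderiv 𝓘(ℝ, (B × F) × (B →L[ℝ] F)) 𝓘(ℝ, B)
      Jet1.toBase j)).toAlternatingMap (horizontalMultivector η nabla b j) = 1 := by
  rw [horizontalMultivector, map_smul, pairing_ιMulti]
  have h : (fun i =>
      mfderiv 𝓘(ℝ, (B × F) × (B →L[ℝ] F)) 𝓘(ℝ, B) Jet1.toBase j (nabla j (b i))) = b :=
    funext fun i => hD.lift j (mem_univ j) (b i)
  exact (congrArg (fun v => (η j.toBase b)⁻¹ * η j.toBase v) h).trans (inv_mul_cancel₀ hb)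

/-- The vertical endomorphism factors through the contact part of the projected vector, and a
semi-holonomic lift projects into the image of the jet, where the contact part is zero. -/
theorem verticalEndo_eq_zero {j : Jet1 P} {D : B →L[ℝ] (B × F) × (B →L[ℝ] F)}
    (hD : IsSemiHolonomicLift j D) (β : B →L[ℝ] ℝ) (ξ : B) : verticalEndo j β (D ξ) = 0 := by
  let dpt : (B × F) × (B →L[ℝ] F) →L[ℝ] B × F :=
    mfderiv 𝓘(ℝ, (B × F) × (B →L[ℝ] F)) 𝓘(ℝ, B × F) Jet1.pt j
  let dproj : B × F →L[ℝ] B := P.dproj j.pt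
  let lin : B →L[ℝ] B × F := j.lin
  have h1 : dpt (D ξ) = lin ξ := hD ξ
  have h2 : dproj (lin ξ) = ξ := j.dproj_lin ξ
  have h3 : dpt (D ξ) - lin (dproj (dpt (D ξ))) = 0 := by rw [h1, h2, sub_self]
  let vlift : (B →L[ℝ] B × F) →L[ℝ] (B × F) × (B →L[ℝ] F) :=
    mfderiv 𝓘(ℝ, B →L[ℝ] B × F) 𝓘(ℝ, (B × F) × (B →L[ℝ] F))
      (fun A : B →L[ℝ] B × F => j.shift A) 0
  change vlift (ContinuousLinearMap.smulRightL ℝ B (B × F) β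
    (dpt (D ξ) - lin (dproj (dpt (D ξ))))) = 0
  rw [h3, map_zero, map_zero]

theorem isSemiHolonomic_horizontalMultivector (hD : ∀ j, IsSemiHolonomicLift j (nabla j))
    (b : Fin (k + 1) → B) : IsSemiHolonomic (horizontalMultivector η nabla b) := by
  intro j β l
  have h1 : ∀ i, (l ∘ₗ (verticalEndo j β).toLinearMap) (nabla j (b i)) = 0 := fun i =>
    (congrArg l (verticalEndo_eq_zero (hD j) β (b i))).trans (map_zero l)
  have h2 := contractLeft_ιMulti_eq_zero h1
  rw [horizontalMultivector, Submodule.coe_smul, map_smul, exteriorPower.ιMulti_apply_coe]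
  exact (congrArg _ h2).trans (smul_zero _)

variable [FiniteDimensional ℝ B] [FiniteDimensional ℝ F] [IsManifold 𝓘(ℝ, B) ∞ M]

/-- A constant frame of the model space need not be smooth on M, because the tangent spaces are
identified with the model by preferred charts. By `horizontalMultivector_eq` the m-vector may be
recomputed in the coordinate frame of an adapted chart, where all factors are smooth. -/
theorem isLocallyDecomposableOn_horizontalMultivector (hdim : Module.finrank ℝ B = k + 1)
    (hη : IsVolumeForm η) (hD : IsEhresmannConnectionOn Jet1.toBase univ nabla)
    (b : Module.Basis (Fin (k + 1)) ℝ B) :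
    IsLocallyDecomposableOn univ (horizontalMultivector η nabla b) := by
  intro j₀ _
  obtain ⟨e, he⟩ := P.exists_adaptedChart j₀.pt
  have hc := jetChart_mem_maximalAtlas e
  have hU : IsOpen (jetChart e).source := (jetChart e).open_source
  let W : Fin (k + 1) → ∀ j : Jet1 P, TangentSpace 𝓘(ℝ, (B × F) × (B →L[ℝ] F)) j := fun i j =>
    dJetInv e j ((b i, 0), 0)
  have hW : ∀ i, IsSmoothFieldOn (W i) (jetChart e).source := fun i =>
    isSmoothFieldOn_of_chart hc hU subset_rfl contMDiffOn_const fun j hj => dJet_dJetInv hj _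
  let Z : Fin (k + 1) → ∀ j : Jet1 P, TangentSpace 𝓘(ℝ, (B × F) × (B →L[ℝ] F)) j := fun i j =>
    nabla j (mfderiv 𝓘(ℝ, (B × F) × (B →L[ℝ] F)) 𝓘(ℝ, B) Jet1.toBase j (W i j))
  have hZ : ∀ i, IsSmoothFieldOn (Z i) (jetChart e).source := fun i =>
    hD.smooth _ _ hU (subset_univ _) (hW i)
  -- The normalizing scalar is absorbed into the first of the m factors.
  let r : Fin (k + 1) → Jet1 P → ℝ := fun i j =>
    if i = 0 then (volLoc η e (Jet1.coords e j).1.1 b)⁻¹ else 1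
  have hr : ∀ i, ContMDiffOn 𝓘(ℝ, (B × F) × (B →L[ℝ] F)) 𝓘(ℝ) ∞ (r i) (jetChart e).source := by
    intro i
    by_cases hi : i = 0
    · simp only [r, hi, if_true]
      intro j hj
      have h1 : ContDiffAt ℝ ∞ (fun z : (B × F) × (B →L[ℝ] F) => (volLoc η e z.1.1 b)⁻¹)
          (jetChart e j) :=
        (contDiffAt_evalBase (contDiffAt_volLoc_coords hη hj) b).inv
          (volLoc_coords_basis_ne_zero hη b hj)
      exact h1.contMDiffAt.comp_contMDiffWithinAt j (contMDiffOn_of_mem_maximalAtlas hc j hj)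
    · simp only [r, hi, if_false]
      exact contMDiffOn_const
  refine ⟨(jetChart e).source, hU, (he ▸ e.ctr_mem : j₀.pt ∈ e.tot.source), subset_univ _,
    fun i => r i • Z i, fun i =>
    ContMDiffOn.smul_section (hr i) (hZ i), fun j hj => ?_⟩
  let w : Fin (k + 1) → B := fun i => e.dBaseInv (P.proj j.pt) (b i)
  have hw : ∀ i, mfderiv 𝓘(ℝ, (B × F) × (B →L[ℝ] F)) 𝓘(ℝ, B) Jet1.toBase j (W i j) = w i := by
    intro i
    refine (mfderiv_toBase_eq hj _).trans ?_
    have h1 : dJet e j (W i j) = ((b i, 0), 0) := dJet_dJetInv hj _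
    rw [h1]
  have hv : η j.toBase w = volLoc η e (Jet1.coords e j).1.1 b := by
    rw [coords_fst_fst hj]
    exact (volLoc_base_apply (e.mapsTo _ hj) _).symm
  have hw0 : η j.toBase w ≠ 0 := hv ▸ volLoc_coords_basis_ne_zero hη b hj
  rw [horizontalMultivector_eq hdim (volume_basis_ne_zero hη b _) hw0]
  have h1 := ιMulti_smul_univ (fun i => r i j) (fun i => Z i j)
  have h2 : ∏ i, r i j = (η j.toBase w)⁻¹ := by
    rw [hv]
    exact Finset.prod_ite_eq' _ _ _ |>.trans (if_pos (Finset.mem_univ _))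
  rw [h2] at h1
  refine Eq.trans ?_ h1.symm
  rw [horizontalMultivector]
  congr 2
  funext i
  exact congrArg (nabla j) (hw i).symm

variable [IsManifold 𝓘(ℝ, B × F) ∞ E] [T2Space E] [SigmaCompactSpace E]

/-- Euler-Lagrange `m`-vector fields exist on the whole jet bundle. -/
theorem exists_isEulerLagrange (hdim : Module.finrank ℝ B = k + 1)
    (hL : ContMDiff 𝓘(ℝ, (B × F) × (B →L[ℝ] F)) 𝓘(ℝ) ∞ L) (hη : IsVolumeForm η)
    (hreg : IsRegularLagrangian L η) : ∃ X, IsEulerLagrange L η X := by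
  obtain ⟨nabla, hn, hD⟩ := exists_eulerLagrange_connection hdim hL hη hreg
  let b : Module.Basis (Fin (k + 1)) ℝ B := Module.finBasisOfFinrankEq ℝ B hdim
  refine ⟨horizontalMultivector η nabla b,
    isLocallyDecomposableOn_horizontalMultivector hdim hη hn b,
    fun j => pairing_horizontalMultivector hn (volume_basis_ne_zero hη b _),
    isSemiHolonomic_horizontalMultivector (fun j => (hD j).semiHolonomic) b, fun j => ?_⟩
  have h : ∀ W : TangentSpace 𝓘(ℝ, (B × F) × (B →L[ℝ] F)) j, (omegaL L η j).toAlternatingMap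
    (Matrix.vecCons W fun i => nabla j (b i)) = 0 := fun W => (hD j).equation W b
  exact contract_smul_ιMulti_eq_zero _ h

end EulerLagrangeField

/-! ### Functoriality of pairings, contractions and wedges -/

section MultivectorMaps

variable {T T' : Type*} [AddCommGroup T] [Module ℝ T] [AddCommGroup T'] [Module ℝ T'] {d : ℕ}

theorem pairing_map (φ : T' [⋀^Fin d]→ₗ[ℝ] ℝ) (f : T →ₗ[ℝ] T') (X : ⋀[ℝ]^d T) :
    pairing φ (exteriorPower.map d f X) = pairing (φ.compLinearMap f) X := by
  have h : pairing φ ∘ₗ exteriorPower.map d f = pairing (φ.compLinearMap f) := by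
    refine exteriorPower.linearMap_ext (AlternatingMap.ext fun v => ?_)
    change pairing φ (exteriorPower.map d f (exteriorPower.ιMulti ℝ d v)) =
      pairing (φ.compLinearMap f) (exteriorPower.ιMulti ℝ d v)
    rw [exteriorPower.map_apply_ιMulti, pairing_ιMulti, pairing_ιMulti]
    rfl
  exact congrArg (fun g => g X) h

theorem contract_map (Ω : T' [⋀^Fin (d + 1)]→ₗ[ℝ] ℝ) (f : T →ₗ[ℝ] T') (X : ⋀[ℝ]^d T) (w : T) :
    contract Ω (exteriorPower.map d f X) (f w) = contract (Ω.compLinearMap f) X w := by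
  have h : (Ω.curryLeft (f w)).compLinearMap f = (Ω.compLinearMap f).curryLeft w := by
    ext v
    refine congrArg Ω (funext fun i => ?_)
    exact Fin.cases rfl (fun i => rfl) i
  have h1 := pairing_map (Ω.curryLeft (f w)) f X
  rw [h] at h1
  exact congrArg ((-1 : ℝ) ^ d • ·) h1

theorem wedgeOne_comp (σ : T' [⋀^Fin d]→ₗ[ℝ] ℝ) (γ : T' →ₗ[ℝ] ℝ) (f : T →ₗ[ℝ] T')
    (v : Fin (d + 1) → T) :
    wedgeOne (σ.compLinearMap f) (γ ∘ₗ f) v = wedgeOne σ γ fun i => f (v i) := by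
  rw [wedgeOne_apply, wedgeOne_apply]
  rfl

end MultivectorMaps

section VolumeCongr

variable {B M : Type*} [NormedAddCommGroup B] [NormedSpace ℝ B] [TopologicalSpace M]
  [ChartedSpace B M] {k : ℕ} {η : ∀ x : M, TangentSpace 𝓘(ℝ, B) x [⋀^Fin (k + 1)]→L[ℝ] ℝ}

theorem volume_congr {x x' : M} (h : x = x') (v : Fin (k + 1) → B) : η x v = η x' v := by
  subst h; rfl

end VolumeCongr

/-! ### Transport to the multimomentum bundle: the Hamilton-Cartan form -/

section Hamiltonian

set_option maxSynthPendingDepth 3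

variable {B F M E : Type*}
  [NormedAddCommGroup B] [NormedSpace ℝ B] [FiniteDimensional ℝ B]
  [NormedAddCommGroup F] [NormedSpace ℝ F] [FiniteDimensional ℝ F]
  [TopologicalSpace M] [ChartedSpace B M]
  [TopologicalSpace E] [ChartedSpace (B × F) E]
  {P : FibredManifold B F M E} {k : ℕ}
  {L : Jet1 P → ℝ} {η : ∀ x : M, TangentSpace 𝓘(ℝ, B) x [⋀^Fin (k + 1)]→L[ℝ] ℝ}
  {Φ : PartialDiffeomorph 𝓘(ℝ, (B × F) × (B →L[ℝ] F))
    𝓘(ℝ, (B × F) × (F →L[ℝ] B [⋀^Fin k]→L[ℝ] ℝ)) (Jet1 P) (Multimomentum P k) ∞}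
  {q : Multimomentum P k}

/-- The tangent map of the local inverse of the Legendre map. -/
def dLegInv (Φ : PartialDiffeomorph 𝓘(ℝ, (B × F) × (B →L[ℝ] F))
      𝓘(ℝ, (B × F) × (F →L[ℝ] B [⋀^Fin k]→L[ℝ] ℝ)) (Jet1 P) (Multimomentum P k) ∞)
    (q : Multimomentum P k) :
    ((B × F) × (F →L[ℝ] B [⋀^Fin k]→L[ℝ] ℝ)) →L[ℝ] (B × F) × (B →L[ℝ] F) :=
  mfderiv 𝓘(ℝ, (B × F) × (F →L[ℝ] B [⋀^Fin k]→L[ℝ] ℝ)) 𝓘(ℝ, (B × F) × (B →L[ℝ] F)) Φ.symm q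

/-- The tangent map of the Legendre map. -/
def dLeg (L : Jet1 P → ℝ) (η : ∀ x : M, TangentSpace 𝓘(ℝ, B) x [⋀^Fin (k + 1)]→L[ℝ] ℝ)
    (j : Jet1 P) : ((B × F) × (B →L[ℝ] F)) →L[ℝ] (B × F) × (F →L[ℝ] B [⋀^Fin k]→L[ℝ] ℝ) :=
  mfderiv 𝓘(ℝ, (B × F) × (B →L[ℝ] F)) 𝓘(ℝ, (B × F) × (F →L[ℝ] B [⋀^Fin k]→L[ℝ] ℝ))
    (legendre L η) j

theorem mdifferentiable_toOpenPartialHomeomorph : Φ.toOpenPartialHomeomorph.MDifferentiable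
    𝓘(ℝ, (B × F) × (B →L[ℝ] F)) 𝓘(ℝ, (B × F) × (F →L[ℝ] B [⋀^Fin k]→L[ℝ] ℝ)) :=
  ⟨Φ.contMDiffOn_toFun.mdifferentiableOn (by simp),
    Φ.contMDiffOn_invFun.mdifferentiableOn (by simp)⟩

theorem symm_mem_source (hq : q ∈ Φ.target) : Φ.symm q ∈ Φ.source := Φ.map_target hq

theorem mdifferentiableAt_symm (hq : q ∈ Φ.target) :
    MDifferentiableAt 𝓘(ℝ, (B × F) × (F →L[ℝ] B [⋀^Fin k]→L[ℝ] ℝ))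
      𝓘(ℝ, (B × F) × (B →L[ℝ] F)) Φ.symm q :=
  (Φ.contMDiffOn_invFun.contMDiffAt (Φ.open_target.mem_nhds hq)).mdifferentiableAt (by simp)

theorem isInvertible_dLegInv (hq : q ∈ Φ.target) : (dLegInv Φ q).IsInvertible :=
  ⟨(mdifferentiable_toOpenPartialHomeomorph (Φ := Φ)).symm.mfderiv hq, rfl⟩

theorem dLeg_eq (hΦ : ∀ j ∈ Φ.source, Φ j = legendre L η j) {j : Jet1 P} (hj : j ∈ Φ.source) :
    dLeg L η j = mfderiv 𝓘(ℝ, (B × F) × (B →L[ℝ] F))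
      𝓘(ℝ, (B × F) × (F →L[ℝ] B [⋀^Fin k]→L[ℝ] ℝ)) Φ j := by
  refine Filter.EventuallyEq.mfderiv_eq ?_
  filter_upwards [Φ.open_source.mem_nhds hj] with j' hj'
  exact (hΦ j' hj').symm

theorem dLeg_dLegInv (hΦ : ∀ j ∈ Φ.source, Φ j = legendre L η j) (hq : q ∈ Φ.target)
    (w : (B × F) × (F →L[ℝ] B [⋀^Fin k]→L[ℝ] ℝ)) :
    dLeg L η (Φ.symm q) (dLegInv Φ q w) = w := by
  rw [dLeg_eq hΦ (symm_mem_source hq)]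
  exact congrArg (fun f => f w)
    ((mdifferentiable_toOpenPartialHomeomorph (Φ := Φ)).comp_symm_deriv hq)

theorem dLegInv_dLeg (hΦ : ∀ j ∈ Φ.source, Φ j = legendre L η j) (hq : q ∈ Φ.target)
    (w : (B × F) × (B →L[ℝ] F)) : dLegInv Φ q (dLeg L η (Φ.symm q) w) = w := by
  obtain ⟨A, hA⟩ := isInvertible_dLegInv hq
  obtain ⟨x, rfl⟩ : ∃ x, dLegInv Φ q x = w := by
    obtain ⟨x, hx⟩ := A.surjective w
    exact ⟨x, by rw [← hA]; exact hx⟩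
  rw [dLeg_dLegInv hΦ hq]

theorem legendre_symm (hΦ : ∀ j ∈ Φ.source, Φ j = legendre L η j) (hq : q ∈ Φ.target) :
    legendre L η (Φ.symm q) = q :=
  (hΦ _ (symm_mem_source hq)).symm.trans (Φ.right_inv hq)

theorem symm_pt (hΦ : ∀ j ∈ Φ.source, Φ j = legendre L η j) (hq : q ∈ Φ.target) :
    (Φ.symm q).pt = q.pt :=
  congrArg Multimomentum.pt (legendre_symm hΦ hq)

theorem symm_toBase (hΦ : ∀ j ∈ Φ.source, Φ j = legendre L η j) (hq : q ∈ Φ.target) :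
    (Φ.symm q).toBase = q.toBase :=
  congrArg P.proj (symm_pt hΦ hq)

theorem mfderiv_multimomentum_toBase (hΦ : ∀ j ∈ Φ.source, Φ j = legendre L η j)
    (hq : q ∈ Φ.target) (w : (B × F) × (F →L[ℝ] B [⋀^Fin k]→L[ℝ] ℝ)) :
    (mfderiv 𝓘(ℝ, (B × F) × (F →L[ℝ] B [⋀^Fin k]→L[ℝ] ℝ)) 𝓘(ℝ, B) Multimomentum.toBase q w : B) =
      mfderiv 𝓘(ℝ, (B × F) × (B →L[ℝ] F)) 𝓘(ℝ, B) Jet1.toBase (Φ.symm q) (dLegInv Φ q w) := by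
  have h1 : MDifferentiableAt 𝓘(ℝ, (B × F) × (B →L[ℝ] F)) 𝓘(ℝ, B) Jet1.toBase (Φ.symm q) :=
    MDifferentiableAt.comp (Φ.symm q) AdaptedChart.mdiffAt_proj (mdifferentiableAt_jet_pt _)
  have h2 := HasMFDerivAt.comp q h1.hasMFDerivAt (mdifferentiableAt_symm hq).hasMFDerivAt
  have h3 : (Multimomentum.toBase : Multimomentum P k → M) =ᶠ[𝓝 q] Jet1.toBase ∘ Φ.symm := by
    filter_upwards [Φ.open_target.mem_nhds hq] with q' hq'
    exact (symm_toBase hΦ hq').symm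
  exact congrArg (fun f => f w) (h2.congr_of_eventuallyEq h3).mfderiv

theorem mfderiv_multimomentum_toBase_dLeg (hΦ : ∀ j ∈ Φ.source, Φ j = legendre L η j)
    (hq : q ∈ Φ.target) (w : (B × F) × (B →L[ℝ] F)) :
    (mfderiv 𝓘(ℝ, (B × F) × (F →L[ℝ] B [⋀^Fin k]→L[ℝ] ℝ)) 𝓘(ℝ, B) Multimomentum.toBase q
      (dLeg L η (Φ.symm q) w) : B) =
      mfderiv 𝓘(ℝ, (B × F) × (B →L[ℝ] F)) 𝓘(ℝ, B) Jet1.toBase (Φ.symm q) w := by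
  rw [mfderiv_multimomentum_toBase hΦ hq]
  exact congrArg (mfderiv 𝓘(ℝ, (B × F) × (B →L[ℝ] F)) 𝓘(ℝ, B) Jet1.toBase (Φ.symm q))
    (dLegInv_dLeg hΦ hq w)

/-- The Hamiltonian section takes at q the value of the extended Legendre map at `Φ.symm q`. Both
forms are thus the same `legendreForm`, and only the chain rule for the projection to E is needed.
-/
theorem thetaH_hamiltonianSection (hq : q ∈ Φ.target) :
    thetaH (hamiltonianSection L η Φ) q = (thetaL L η (Φ.symm q)).compContinuousLinearMap
      (mfderiv 𝓘(ℝ, (B × F) × (F →L[ℝ] B [⋀^Fin k]→L[ℝ] ℝ)) 𝓘(ℝ, (B × F) × (B →L[ℝ] F))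
        Φ.symm q) := by
  have h := mfderiv_comp q (mdifferentiableAt_jet_pt (Φ.symm q)) (mdifferentiableAt_symm hq)
  ext w
  exact congrArg (legendreForm L η (Φ.symm q)) (funext fun i => congrArg (fun f => f (w i)) h)

variable [IsManifold 𝓘(ℝ, B) ∞ M]

/-- The Hamilton-Cartan form is the pull-back of the Poincaré-Cartan form. -/
theorem omegaH_hamiltonianSection (hL : ContMDiff 𝓘(ℝ, (B × F) × (B →L[ℝ] F)) 𝓘(ℝ) ∞ L)
    (hη : IsVolumeForm η) (hq : q ∈ Φ.target)
    (w : Fin (k + 1 + 1) → (B × F) × (F →L[ℝ] B [⋀^Fin k]→L[ℝ] ℝ)) :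
    omegaH (hamiltonianSection L η Φ) q w = omegaL L η (Φ.symm q) fun i => dLegInv Φ q (w i) := by
  obtain ⟨e, he⟩ := P.exists_adaptedChart (Φ.symm q).pt
  have hj : (Φ.symm q).pt ∈ e.tot.source := he ▸ e.ctr_mem
  have h := extD_pullback Φ.open_target hq Φ.contMDiffOn_invFun (jetChart_mem_maximalAtlas e) hj
    (fun q' hq' => thetaH_hamiltonianSection hq') (differentiableAt_formIn_thetaL (η := η) hL hη hj)
  exact congrArg (fun f => -f w) h

theorem omegaH_dLeg (hL : ContMDiff 𝓘(ℝ, (B × F) × (B →L[ℝ] F)) 𝓘(ℝ) ∞ L)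
    (hη : IsVolumeForm η) (hΦ : ∀ j ∈ Φ.source, Φ j = legendre L η j) (hq : q ∈ Φ.target)
    (w : Fin (k + 1 + 1) → (B × F) × (B →L[ℝ] F)) :
    omegaH (hamiltonianSection L η Φ) q (fun i => dLeg L η (Φ.symm q) (w i)) =
      omegaL L η (Φ.symm q) w :=
  (omegaH_hamiltonianSection hL hη hq _).trans
    (congrArg (omegaL L η (Φ.symm q)) (funext fun i => dLegInv_dLeg hΦ hq (w i)))

/-- The tangent Legendre map preserves the pulled back volume and carries Ω_h to Ω_L. A 1-form γ
pulls back to another 1-form, so the Lagrangian result, valid for every γ, applies. -/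
theorem omegaH_sub_wedge_injective (hk : 1 ≤ k) (hdim : Module.finrank ℝ B = k + 1)
    (hL : ContMDiff 𝓘(ℝ, (B × F) × (B →L[ℝ] F)) 𝓘(ℝ) ∞ L) (hη : IsVolumeForm η)
    (hreg : IsRegularLagrangian L η) (hΦ : ∀ j ∈ Φ.source, Φ j = legendre L η j)
    (hq : q ∈ Φ.target)
    (γ : TangentSpace 𝓘(ℝ, (B × F) × (F →L[ℝ] B [⋀^Fin k]→L[ℝ] ℝ)) q →ₗ[ℝ] ℝ) :
    Function.Injective ((omegaH (hamiltonianSection L η Φ) q).toAlternatingMap -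
      wedgeOne ((η q.toBase).compContinuousLinearMap
        (mfderiv 𝓘(ℝ, (B × F) × (F →L[ℝ] B [⋀^Fin k]→L[ℝ] ℝ)) 𝓘(ℝ, B)
          Multimomentum.toBase q)).toAlternatingMap γ).curryLeft := by
  let γ' : ((B × F) × (F →L[ℝ] B [⋀^Fin k]→L[ℝ] ℝ)) →ₗ[ℝ] ℝ := γ
  let A : ((B × F) × (B →L[ℝ] F)) →ₗ[ℝ] (B × F) × (F →L[ℝ] B [⋀^Fin k]→L[ℝ] ℝ) :=
    (dLeg L η (Φ.symm q)).toLinearMap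
  let σ : ((B × F) × (F →L[ℝ] B [⋀^Fin k]→L[ℝ] ℝ)) [⋀^Fin (k + 1)]→ₗ[ℝ] ℝ :=
    ((η q.toBase).compContinuousLinearMap
        (mfderiv 𝓘(ℝ, (B × F) × (F →L[ℝ] B [⋀^Fin k]→L[ℝ] ℝ)) 𝓘(ℝ, B)
          Multimomentum.toBase q)).toAlternatingMap
  let τ : ((B × F) × (B →L[ℝ] F)) [⋀^Fin (k + 1)]→ₗ[ℝ] ℝ :=
    ((η (Φ.symm q).toBase).compContinuousLinearMap
        (mfderiv 𝓘(ℝ, (B × F) × (B →L[ℝ] F)) 𝓘(ℝ, B) Jet1.toBase (Φ.symm q))).toAlternatingMap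
  have hτ : σ.compLinearMap A = τ := by
    ext v
    refine (volume_congr (η := η) (symm_toBase hΦ hq).symm _).trans ?_
    exact congrArg (η (Φ.symm q).toBase)
      (funext fun i => mfderiv_multimomentum_toBase_dLeg hΦ hq (v i))
  have hinj := curryLeft_injective_iff.1
    (omegaL_sub_wedge_injective hk hdim hL hη hreg (Φ.symm q) (γ' ∘ₗ A))
  refine curryLeft_injective_iff.2 fun w hw => ?_
  have h1 : dLegInv Φ q w = 0 := hinj (dLegInv Φ q w) fun v => by
    let V : Fin (k + 1 + 1) → (B × F) × (B →L[ℝ] F) := Matrix.vecCons (dLegInv Φ q w) v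
    have h2 : (fun i => A (V i)) = Matrix.vecCons w fun i => A (v i) := by
      funext i
      exact Fin.cases (dLeg_dLegInv hΦ hq w) (fun i => rfl) i
    have h3 := hw fun i => A (v i)
    have h4 : omegaL L η (Φ.symm q) V =
        omegaH (hamiltonianSection L η Φ) q (Matrix.vecCons w fun i => A (v i)) :=
      (omegaH_dLeg hL hη hΦ hq V).symm.trans
        (congrArg (omegaH (hamiltonianSection L η Φ) q) h2)
    have h5 : wedgeOne τ (γ' ∘ₗ A) V = wedgeOne σ γ' (Matrix.vecCons w fun i => A (v i)) := by
      rw [← hτ, wedgeOne_comp]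
      exact congrArg (wedgeOne σ γ') h2
    exact (congrArg₂ (· - ·) h4 h5).trans h3
  rw [← dLeg_dLegInv hΦ hq w, h1]
  exact map_zero _

end Hamiltonian

/-! ### Push-forward of the multivector equations -/

section MultivectorMaps

variable {T T' : Type*} [AddCommGroup T] [Module ℝ T] [AddCommGroup T'] [Module ℝ T'] {d : ℕ}

theorem pairing_map_eq {φ : T' [⋀^Fin d]→ₗ[ℝ] ℝ} {φ' : T [⋀^Fin d]→ₗ[ℝ] ℝ} {f : T →ₗ[ℝ] T'}
    (h : ∀ v : Fin d → T, φ (fun i => f (v i)) = φ' v) (X : ⋀[ℝ]^d T) :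
    pairing φ (exteriorPower.map d f X) = pairing φ' X := by
  rw [pairing_map, show φ.compLinearMap f = φ' from AlternatingMap.ext h]

theorem contract_map_eq_zero {Ω : T' [⋀^Fin (d + 1)]→ₗ[ℝ] ℝ} {Ω' : T [⋀^Fin (d + 1)]→ₗ[ℝ] ℝ}
    {f : T →ₗ[ℝ] T'} (h : ∀ v : Fin (d + 1) → T, Ω (fun i => f (v i)) = Ω' v)
    (hf : Function.Surjective f) {X : ⋀[ℝ]^d T} (hX : contract Ω' X = 0) :
    contract Ω (exteriorPower.map d f X) = 0 := by
  ext w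
  obtain ⟨w, rfl⟩ := hf w
  rw [contract_map, show Ω.compLinearMap f = Ω' from AlternatingMap.ext h, hX]
  rfl

theorem map_eq_ιMulti {f : T →ₗ[ℝ] T'} {X : ⋀[ℝ]^d T} {v : Fin d → T}
    (hX : X = exteriorPower.ιMulti ℝ d v) :
    exteriorPower.map d f X = exteriorPower.ιMulti ℝ d fun i => f (v i) := by
  rw [hX]
  exact exteriorPower.map_apply_ιMulti _ _

end MultivectorMaps

/-! ### Transported connections and Hamilton-De Donder-Weyl fields -/

section HamiltonianFields

set_option maxSynthPendingDepth 3

variable {B F M E : Type*}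
  [NormedAddCommGroup B] [NormedSpace ℝ B] [FiniteDimensional ℝ B]
  [NormedAddCommGroup F] [NormedSpace ℝ F] [FiniteDimensional ℝ F]
  [TopologicalSpace M] [ChartedSpace B M]
  [TopologicalSpace E] [ChartedSpace (B × F) E]
  {P : FibredManifold B F M E} {k : ℕ}
  {L : Jet1 P → ℝ} {η : ∀ x : M, TangentSpace 𝓘(ℝ, B) x [⋀^Fin (k + 1)]→L[ℝ] ℝ}
  {Φ : PartialDiffeomorph 𝓘(ℝ, (B × F) × (B →L[ℝ] F))
    𝓘(ℝ, (B × F) × (F →L[ℝ] B [⋀^Fin k]→L[ℝ] ℝ)) (Jet1 P) (Multimomentum P k) ∞}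

theorem isOpen_target_inter_preimage {U : Set (Jet1 P)} (hU : IsOpen U) :
    IsOpen (Φ.target ∩ Φ.symm ⁻¹' U) :=
  Φ.contMDiffOn_invFun.continuousOn.isOpen_inter_preimage Φ.open_target hU

/-- The push-forward of a smooth vector field by the Legendre map. -/
theorem IsSmoothFieldOn.pushforward_legendre (hΦ : ∀ j ∈ Φ.source, Φ j = legendre L η j)
    {U : Set (Jet1 P)} (hU : IsOpen U)
    {Z : ∀ j : Jet1 P, TangentSpace 𝓘(ℝ, (B × F) × (B →L[ℝ] F)) j} (hZ : IsSmoothFieldOn Z U) :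
    IsSmoothFieldOn (N := Multimomentum P k) (fun q => dLeg L η (Φ.symm q) (Z (Φ.symm q)))
      (Φ.target ∩ Φ.symm ⁻¹' U) :=
  IsSmoothFieldOn.pullback (Ψ := Φ.symm) (t := U) (isOpen_target_inter_preimage hU)
    (Φ.contMDiffOn_invFun.mono inter_subset_left) (fun _ hq => hq.2) hZ
    (fun _ hq => isInvertible_dLegInv hq.1) (fun _ hq => dLegInv_dLeg hΦ hq.1 _)

/-- The pull-back of a smooth vector field by the Legendre map. -/
theorem IsSmoothFieldOn.pullback_legendre {U : Set (Multimomentum P k)} (hU : IsOpen U)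
    {Y : ∀ q : Multimomentum P k,
      TangentSpace 𝓘(ℝ, (B × F) × (F →L[ℝ] B [⋀^Fin k]→L[ℝ] ℝ)) q} (hY : IsSmoothFieldOn Y U) :
    IsSmoothFieldOn (N := Jet1 P) (fun j => dLegInv Φ (Φ j) (Y (Φ j))) (Φ.source ∩ Φ ⁻¹' U) := by
  have hm := mdifferentiable_toOpenPartialHomeomorph (Φ := Φ)
  refine IsSmoothFieldOn.pullback (Ψ := Φ) (t := U)
    (Φ.contMDiffOn_toFun.continuousOn.isOpen_inter_preimage Φ.open_source hU)
    (Φ.contMDiffOn_toFun.mono inter_subset_left) (fun q hq => hq.2) hY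
    (fun j hj => ⟨hm.mfderiv hj.1, rfl⟩) (fun j hj => ?_)
  have h := hm.comp_symm_deriv (Φ.map_source hj.1)
  have h1 : Φ.toOpenPartialHomeomorph.symm (Φ j) = j := Φ.left_inv hj.1
  rw [h1] at h
  exact congrArg (fun f => f (Y (Φ j))) h

/-- The transported connection. -/
theorem exists_transported_connection (hΦ : ∀ j ∈ Φ.source, Φ j = legendre L η j)
    {nabla : ∀ j : Jet1 P,
      TangentSpace 𝓘(ℝ, B) j.toBase →L[ℝ] TangentSpace 𝓘(ℝ, (B × F) × (B →L[ℝ] F)) j}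
    (hn : IsEhresmannConnectionOn Jet1.toBase univ nabla) :
    ∃ nablaStar, IsEhresmannConnectionOn Multimomentum.toBase Φ.target nablaStar ∧
      IsTransportedOn L η Φ.source nabla nablaStar := by
  -- The base points of q and of `Φ.symm q` agree only propositionally. With values in model spaces,
  -- `g (Φ.symm q)` can serve as a lift at q without casts.
  let g : Jet1 P → B →L[ℝ] (B × F) × (F →L[ℝ] B [⋀^Fin k]→L[ℝ] ℝ) := fun j =>
    let D : B →L[ℝ] (B × F) × (B →L[ℝ] F) := nabla j
    (dLeg L η j).comp D
  refine ⟨fun q => g (Φ.symm q), ⟨fun q hq ξ => ?_, fun U Y hU hUt hY => ?_⟩, fun j hj ξ => ?_⟩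
  · exact (mfderiv_multimomentum_toBase_dLeg hΦ hq _).trans (hn.lift (Φ.symm q) (mem_univ _) ξ)
  · have h1 := hY.pullback_legendre (Φ := Φ) hU
    have hU' : IsOpen (Φ.source ∩ Φ ⁻¹' U) :=
      Φ.contMDiffOn_toFun.continuousOn.isOpen_inter_preimage Φ.open_source hU
    -- The horizontal part of Y for the transported connection is obtained by pulling Y back to the
    -- jets, taking the horizontal part there, and pushing the result forward.
    have h2 := (hn.smooth _ _ hU' (subset_univ _) h1).pushforward_legendre hΦ hU'
    have h3 : U ⊆ Φ.target ∩ Φ.symm ⁻¹' (Φ.source ∩ Φ ⁻¹' U) := fun q hq =>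
      ⟨hUt hq, symm_mem_source (hUt hq), by
        change Φ (Φ.symm q) ∈ U
        rw [show Φ (Φ.symm q) = q from Φ.right_inv (hUt hq)]
        exact hq⟩
    refine (h2.mono h3).congr fun q hq => ?_
    have h4 : ∀ q', q' = q → (dLegInv Φ q' (Y q') : (B × F) × (B →L[ℝ] F)) = dLegInv Φ q (Y q) := by
      rintro _ rfl; rfl
    have h5 : (mfderiv 𝓘(ℝ, (B × F) × (F →L[ℝ] B [⋀^Fin k]→L[ℝ] ℝ)) 𝓘(ℝ, B)
        Multimomentum.toBase q (Y q) : B) =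
        mfderiv 𝓘(ℝ, (B × F) × (B →L[ℝ] F)) 𝓘(ℝ, B) Jet1.toBase (Φ.symm q)
          (dLegInv Φ (Φ (Φ.symm q)) (Y (Φ (Φ.symm q)))) :=
      (mfderiv_multimomentum_toBase hΦ (hUt hq) (Y q)).trans
        (congrArg (mfderiv 𝓘(ℝ, (B × F) × (B →L[ℝ] F)) 𝓘(ℝ, B) Jet1.toBase (Φ.symm q))
          (h4 _ (Φ.right_inv (hUt hq))).symm)
    exact congrArg (fun w => (⟨q, w⟩ : TangentBundle
      𝓘(ℝ, (B × F) × (F →L[ℝ] B [⋀^Fin k]→L[ℝ] ℝ)) (Multimomentum P k)))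
      (congrArg (g (Φ.symm q)) h5)
  · have h1 : Φ.symm (legendre L η j) = j :=
      (congrArg Φ.symm (hΦ j hj)).symm.trans (Φ.left_inv hj)
    exact congrArg (fun j' => g j' ξ) h1

/-- The tangent map of the Legendre map at the point over `q`, with values in `T_q J¹π^*`. -/
def legendreTangent (L : Jet1 P → ℝ)
    (η : ∀ x : M, TangentSpace 𝓘(ℝ, B) x [⋀^Fin (k + 1)]→L[ℝ] ℝ)
    (Φ : PartialDiffeomorph 𝓘(ℝ, (B × F) × (B →L[ℝ] F))
      𝓘(ℝ, (B × F) × (F →L[ℝ] B [⋀^Fin k]→L[ℝ] ℝ)) (Jet1 P) (Multimomentum P k) ∞)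
    (q : Multimomentum P k) :
    TangentSpace 𝓘(ℝ, (B × F) × (B →L[ℝ] F)) (Φ.symm q) →ₗ[ℝ]
      TangentSpace 𝓘(ℝ, (B × F) × (F →L[ℝ] B [⋀^Fin k]→L[ℝ] ℝ)) q where
  toFun w := dLeg L η (Φ.symm q) w
  map_add' v w := (dLeg L η (Φ.symm q)).map_add v w
  map_smul' c w := (dLeg L η (Φ.symm q)).map_smul c w

theorem legendreTangent_surjective (hΦ : ∀ j ∈ Φ.source, Φ j = legendre L η j)
    {q : Multimomentum P k} (hq : q ∈ Φ.target) :
    Function.Surjective (legendreTangent L η Φ q) :=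
  fun w => ⟨dLegInv Φ q w, dLeg_dLegInv hΦ hq w⟩

theorem volume_legendreTangent (hΦ : ∀ j ∈ Φ.source, Φ j = legendre L η j)
    {q : Multimomentum P k} (hq : q ∈ Φ.target)
    (v : Fin (k + 1) → TangentSpace 𝓘(ℝ, (B × F) × (B →L[ℝ] F)) (Φ.symm q)) :
    ((η q.toBase).compContinuousLinearMap
        (mfderiv 𝓘(ℝ, (B × F) × (F →L[ℝ] B [⋀^Fin k]→L[ℝ] ℝ)) 𝓘(ℝ, B)
          Multimomentum.toBase q)).toAlternatingMap (fun i => legendreTangent L η Φ q (v i)) =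
      ((η (Φ.symm q).toBase).compContinuousLinearMap
        (mfderiv 𝓘(ℝ, (B × F) × (B →L[ℝ] F)) 𝓘(ℝ, B) Jet1.toBase
          (Φ.symm q))).toAlternatingMap v :=
  (volume_congr (η := η) (symm_toBase hΦ hq).symm _).trans
    (congrArg (η (Φ.symm q).toBase)
      (funext fun i => mfderiv_multimomentum_toBase_dLeg hΦ hq (v i)))

/-- The push-forward of an `m`-vector field by the Legendre map. -/
def pushforwardMultivector (L : Jet1 P → ℝ)
    (η : ∀ x : M, TangentSpace 𝓘(ℝ, B) x [⋀^Fin (k + 1)]→L[ℝ] ℝ)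
    (Φ : PartialDiffeomorph 𝓘(ℝ, (B × F) × (B →L[ℝ] F))
      𝓘(ℝ, (B × F) × (F →L[ℝ] B [⋀^Fin k]→L[ℝ] ℝ)) (Jet1 P) (Multimomentum P k) ∞)
    (X : ∀ j : Jet1 P, ⋀[ℝ]^(k + 1) (TangentSpace 𝓘(ℝ, (B × F) × (B →L[ℝ] F)) j))
    (q : Multimomentum P k) :
    ⋀[ℝ]^(k + 1) (TangentSpace 𝓘(ℝ, (B × F) × (F →L[ℝ] B [⋀^Fin k]→L[ℝ] ℝ)) q) :=
  exteriorPower.map (k + 1) (legendreTangent L η Φ q) (X (Φ.symm q))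

theorem isLocallyDecomposableOn_pushforwardMultivector
    (hΦ : ∀ j ∈ Φ.source, Φ j = legendre L η j)
    {X : ∀ j : Jet1 P, ⋀[ℝ]^(k + 1) (TangentSpace 𝓘(ℝ, (B × F) × (B →L[ℝ] F)) j)}
    (hX : IsLocallyDecomposableOn univ X) :
    IsLocallyDecomposableOn Φ.target (pushforwardMultivector L η Φ X) := by
  intro q hq
  obtain ⟨U, hU, hqU, -, Y, hY, hXY⟩ := hX (Φ.symm q) (mem_univ _)
  exact ⟨Φ.target ∩ Φ.symm ⁻¹' U, isOpen_target_inter_preimage hU, ⟨hq, hqU⟩,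
    inter_subset_left, fun i q => legendreTangent L η Φ q (Y i (Φ.symm q)),
    fun i => (hY i).pushforward_legendre hΦ hU, fun q' hq' => map_eq_ιMulti (hXY _ hq'.2)⟩

variable [IsManifold 𝓘(ℝ, B) ∞ M]

theorem omegaH_legendreTangent (hL : ContMDiff 𝓘(ℝ, (B × F) × (B →L[ℝ] F)) 𝓘(ℝ) ∞ L)
    (hη : IsVolumeForm η) (hΦ : ∀ j ∈ Φ.source, Φ j = legendre L η j) {q : Multimomentum P k}
    (hq : q ∈ Φ.target)
    (v : Fin (k + 1 + 1) → TangentSpace 𝓘(ℝ, (B × F) × (B →L[ℝ] F)) (Φ.symm q)) :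
    (omegaH (hamiltonianSection L η Φ) q).toAlternatingMap
        (fun i => legendreTangent L η Φ q (v i)) =
      (omegaL L η (Φ.symm q)).toAlternatingMap v :=
  omegaH_dLeg hL hη hΦ hq v

/-- The push-forward of an Euler-Lagrange `m`-vector field by the Legendre map is a
Hamilton-De Donder-Weyl `m`-vector field. -/
theorem IsEulerLagrange.isHamiltonDeDonderWeylOn
    (hL : ContMDiff 𝓘(ℝ, (B × F) × (B →L[ℝ] F)) 𝓘(ℝ) ∞ L) (hη : IsVolumeForm η)
    (hΦ : ∀ j ∈ Φ.source, Φ j = legendre L η j)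
    {X : ∀ j : Jet1 P, ⋀[ℝ]^(k + 1) (TangentSpace 𝓘(ℝ, (B × F) × (B →L[ℝ] F)) j)}
    (hX : IsEulerLagrange L η X) : IsHamiltonDeDonderWeylOn (hamiltonianSection L η Φ) η Φ.target
      (pushforwardMultivector L η Φ X) where
  decomposable := isLocallyDecomposableOn_pushforwardMultivector hΦ hX.decomposable
  transverse q hq :=
    (pairing_map_eq (volume_legendreTangent hΦ hq) _).trans (hX.transverse (Φ.symm q))
  equation q hq := contract_map_eq_zero (omegaH_legendreTangent hL hη hΦ hq)
    (legendreTangent_surjective hΦ hq) (hX.equation (Φ.symm q))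

end HamiltonianFields

end Multisymp

end

/-- The dimension of the base is m = k + 1, so `hk` says m ≥ 2. The sets U and U^* of the fourth
claim are the source and target of a partial diffeomorphism `Φ` that agrees with the Legendre map on
its source. -/
theorem mainTheorem8 {B F M E : Type*}
    [NormedAddCommGroup B] [NormedSpace ℝ B] [FiniteDimensional ℝ B]
    [NormedAddCommGroup F] [NormedSpace ℝ F] [FiniteDimensional ℝ F]
    [TopologicalSpace M] [ChartedSpace B M] [IsManifold 𝓘(ℝ, B) ∞ M]
    [T2Space M] [SigmaCompactSpace M]
    [TopologicalSpace E] [ChartedSpace (B × F) E] [IsManifold 𝓘(ℝ, B × F) ∞ E]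
    [T2Space E] [SigmaCompactSpace E]
    (P : FibredManifold B F M E)
    (k : ℕ) (hk : 1 ≤ k) (hdim : Module.finrank ℝ B = k + 1)
    (η : ∀ x : M, TangentSpace 𝓘(ℝ, B) x [⋀^Fin (k + 1)]→L[ℝ] ℝ) (hη : IsVolumeForm η)
    (L : Jet1 P → ℝ) (hL : ContMDiff 𝓘(ℝ, (B × F) × (B →L[ℝ] F)) 𝓘(ℝ) ∞ L)
    (hreg : IsRegularLagrangian L η) :
    IsLocalDiffeomorph 𝓘(ℝ, (B × F) × (B →L[ℝ] F))
      𝓘(ℝ, (B × F) × (F →L[ℝ] B [⋀^Fin k]→L[ℝ] ℝ)) ∞ (legendre L η) ∧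
    (∀ nabla, IsEhresmannConnectionOn Jet1.toBase univ nabla →
      IsOneNondegenerateOn univ (modifiedForm η Jet1.toBase (omegaL L η) nabla)) ∧
    (∃ X, IsEulerLagrange L η X) ∧
    ∀ Φ : PartialDiffeomorph 𝓘(ℝ, (B × F) × (B →L[ℝ] F))
        𝓘(ℝ, (B × F) × (F →L[ℝ] B [⋀^Fin k]→L[ℝ] ℝ)) (Jet1 P) (Multimomentum P k) ∞,
      (∀ j ∈ Φ.source, Φ j = legendre L η j) →
      (∀ nabla, IsEhresmannConnectionOn Jet1.toBase univ nabla →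
        (∃ nablaStar, IsEhresmannConnectionOn Multimomentum.toBase Φ.target nablaStar ∧
          IsTransportedOn L η Φ.source nabla nablaStar) ∧
        ∀ nablaStar, IsTransportedOn L η Φ.source nabla nablaStar →
          IsOneNondegenerateOn Φ.target
            (modifiedForm η Multimomentum.toBase (omegaH (hamiltonianSection L η Φ)) nablaStar)) ∧
      ∃ X, IsHamiltonDeDonderWeylOn (hamiltonianSection L η Φ) η Φ.target X := by
  refine ⟨isLocalDiffeomorph_legendre hdim hL hη hreg,
    fun nabla _ j _ => omegaL_sub_wedge_injective hk hdim hL hη hreg j _,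
    exists_isEulerLagrange hdim hL hη hreg, fun Φ hΦ => ⟨fun nabla hn =>
      ⟨exists_transported_connection hΦ hn, fun nablaStar _ q hq =>
        omegaH_sub_wedge_injective hk hdim hL hη hreg hΦ hq _⟩, ?_⟩⟩
  -- The Hamiltonian field on U^* is the push-forward of a global Euler-Lagrange field, so no second
  -- gluing is needed.
  obtain ⟨X, hX⟩ := exists_isEulerLagrange hdim hL hη hreg
  exact ⟨_, hX.isHamiltonDeDonderWeylOn hL hη hΦ⟩
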